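/- **Setting.** Let $X$ be a random variable on a probability space $(\Omega,\mathcal F,\mathbb P)$ with $X\in[0,M]$ a.s., $M>0$, let $F_X$ be its distribution function and $F_X^{-1}(t)=\inf\{x\ge 0:\ F_X(x)\ge t\}$, $t\in[0,1]$. Let $\rho>-1$, $W_0\in\mathbb R$ and $W:=W_0-(1+\rho)E[X]$. For a premium $\pi$ consider the problem $$\max_I\ V\big(W_0-\pi-X+I(X)\big)\quad\text{s.t.}\quad (1+\rho)E[I(X)]\le\pi,\quad I(0)=0,\quad 0\le I(x)-I(y)\le x-y\ \ (0\le y\le x\le M),\qquad(1)$$ where $V(Y)=\int_{[0,\infty)}u(x)\,d[-T(1-F_Y(x))]$ is the rank-dependent utility. Assume: * $F_X$ is strictly increasing on $[0,M]$ and $F_X^{-1}$ is absolutely continuous on $[0,1]$. * $u:[0,\infty)\to[0,\infty)$ is strictly increasing, twice differentiable on $(0,\infty)$, $u'$ is strictly decreasing, and $A_u:=-u''/u'$ is strictly decreasing on $(0,\infty)$. * $T:[0,1]\to[0,1]$ is continuous, strictly increasing and onto, twice differentiable on $(0,1)$, and for some $b\in(0,1)$ the derivative $T'$ is strictly decreasing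 on $(0,b)$ and strictly increasing on $(b,1)$; $T'(0+)\in(1,\infty]$ and $T'(1-)=+\infty$. Let $a$ be the point such that $z\mapsto\frac{1-T(z)}{1-z}$ is strictly decreasing on $[0,a]$ and strictly increasing on $[a,1)$, and let $c\in(a,1)$ be the point with $T(c)=c$. Put $\Delta(d):=\int_0^dF_X^{-1}(z)\,dz+F_X^{-1}(d)(1-d)$ and $W_\Delta:=W+(1+\rho)\Delta$. Assume further: * $A_T(z):=-T''(z)/T'(z)>A_u(W-F_X^{-1}(z))\,(F_X^{-1})'(z)$ at every $z\in(0,a]$ at which $F_X^{-1}$ is differentiable. * $W\ge M$, and $F_X^{-1}(c)<W_{\Delta(a)}$ (the latter is automatic unless $W=M$, $\mathbb P(X=0)\ge a$ and $\mathbb P(X=M)\ge 1-c$). Let $$h_\Delta(z):=\int_0^z\Big[\tfrac{u'(W_\Delta-F_X^{-1}(z))(1-T(z))}{1-z}-u'(W_\Delta-F_X^{-1}(t))T'(t)\Big]dt,\qquad g(z):=h_{\Delta(z)}(z),$$ let $l_{\Delta(a)}$ and $l_{\Delta(c)}$ be the zeros in $[a,c]$ of $h_{\Delta(a)}$ and $h_{\Delta(c)}$,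 and let $\widetilde\Delta:=\Delta(l_{\Delta(a)})$, $\overline\Delta:=\Delta(l_{\Delta(c)})$. **Theorem.** The points $a$, $c$, $l_{\Delta(a)}$, $l_{\Delta(c)}$ exist and are unique, with $a\in(0,b)$ and $l_{\Delta(a)},l_{\Delta(c)}\in(a,c]$, and both of the latter lie in $(a,c)$ if $\mathbb P(X=0)<c$. Problem (1) has in each of the following cases an optimal solution $I^*$, unique as a function on $[0,M]$: (i) If $\pi=(1+\rho)E[X]$, then $I^*(z)=z$ on $[0,M]$. (ii) If $(1+\rho)(E[X]-\widetilde\Delta)\le\pi<(1+\rho)E[X]$, then $I^*$ is the threefold contract $$I^*(z)=\begin{cases}z,&0\le z<F_X^{-1}(z_2),\\ F_X^{-1}(z_2),&F_X^{-1}(z_2)\le z<F_X^{-1}(z_1),\\ z-F_X^{-1}(z_1)+F_X^{-1}(z_2),&F_X^{-1}(z_1)\le z\le M,\end{cases}\qquad(2)$$ where $(z_2,z_1)$ satisfies $0\le z_2\le a\le z_1<1$, $E[I^*(X)]=\frac{\pi}{1+\rho}$ and $$\int_{z_2}^{z_1}\Big[\tfrac{u'(W_0-\pi-F_X^{-1}(z_1)+F_X^{-1}(z_2))(1-T(z_1))}{1-z_1}-u'(W_0-\pi-F_X^{-1}(t)+F_X^{-1}(z_2))T'(t)\Big]dt=0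 .$$ Such a pair exists; the values $F_X^{-1}(z_2)$, $F_X^{-1}(z_1)$ are uniquely determined, and the pair itself is unique unless both of these values are atoms of $X$. (iii) If $(1+\rho)(E[X]-\overline\Delta)<\pi<(1+\rho)(E[X]-\widetilde\Delta)$, then there is $p\in(l_{\Delta(a)},l_{\Delta(c)})$ with $\Delta(p)=E[X]-\frac{\pi}{1+\rho}$, and for any such $p$: if $g(p)<0$, then $I^*$ is the threefold contract (2) with $(z_2,z_1)$ as in (ii); if $g(p)\ge0$, then $I^*$ is the deductible contract $$I^*(z)=\begin{cases}0,&0\le z<F_X^{-1}(f),\\ z-F_X^{-1}(f),&F_X^{-1}(f)\le z\le M,\end{cases}\qquad(3)$$ where $0\le f<l_{\Delta(c)}$ and $E[I^*(X)]=\frac{\pi}{1+\rho}$. Such an $f$ exists; the deductible $F_X^{-1}(f)$ is uniquely determined, and $f$ itself is unique unless $F_X^{-1}(f)$ is an atom of $X$. (iv) If $0\le\pi\le(1+\rho)(E[X]-\overline\Delta)$, then $I^*$ is the deductible contract (3), where $l_{\Delta(c)}\le f\le1$ and $E[I^*(X)]=\frac{\pi}{1+\rho}$; existence and uniqueness of $F_X^{-1}(f)$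 and of $f$ are as in (iii). -/

import Mathlib

open Set Filter Topology MeasureTheory

noncomputable section

namespace RDUInsurance

/-! ### The probabilistic model -/

/-- Distribution function of the random variable `Y`. -/
def cdf {Ω : Type*} [MeasurableSpace Ω] (P : Measure Ω) (Y : Ω → ℝ) (x : ℝ) : ℝ :=
  P.real {ω | Y ω ≤ x}

/-- Quantile function of a nonnegative random variable `Y`:
`inf {x ≥ 0 : P (Y ≤ x) ≥ t}`. -/
def quantile {Ω : Type*} [MeasurableSpace Ω] (P : Measure Ω) (Y : Ω → ℝ) (t : ℝ) : ℝ :=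
  sInf {x : ℝ | 0 ≤ x ∧ t ≤ cdf P Y x}

open Classical in
/-- Rank-dependent utility of the final wealth `Y`: the Lebesgue–Stieltjes integral
`∫_{[0,∞)} u(x) d[-T(1 - F_Y(x))]`. The function `x ↦ -T(1 - F_Y(x))` is monotone (and
right-continuous) for every weighting function `T`, so the `else` branch is never used. -/
def rdu {Ω : Type*} [MeasurableSpace Ω] (P : Measure Ω) (u T : ℝ → ℝ) (Y : Ω → ℝ) : ℝ :=
  if h : Monotone (fun x => -T (1 - cdf P Y x)) then
    ∫ x in Ici (0 : ℝ), u x ∂h.stieltjesFunction.measure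
  else 0

/-- Admissible indemnities on `[0, M]`: `I 0 = 0`, and both the indemnity `I` and the retention
`x - I x` are nondecreasing. -/
def IsIndemnity (M : ℝ) (I : ℝ → ℝ) : Prop :=
  I 0 = 0 ∧ ∀ x y : ℝ, 0 ≤ y → y ≤ x → x ≤ M → 0 ≤ I x - I y ∧ I x - I y ≤ x - y

/-- Admissible indemnities satisfying the insurer's participation constraint. -/
def IsFeasible {Ω : Type*} [MeasurableSpace Ω] (P : Measure Ω) (X : Ω → ℝ) (M ρ prem : ℝ)
    (I : ℝ → ℝ) : Prop :=
  IsIndemnity M I ∧ (1 + ρ) * (∫ ω, I (X ω) ∂P) ≤ prem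

/-- `I` maximises the rank-dependent utility of `W₀ - prem - X + I(X)` among feasible
indemnities. -/
def IsOptimal {Ω : Type*} [MeasurableSpace Ω] (P : Measure Ω) (X : Ω → ℝ) (u T : ℝ → ℝ)
    (M W₀ ρ prem : ℝ) (I : ℝ → ℝ) : Prop :=
  IsFeasible P X M ρ prem I ∧ ∀ J : ℝ → ℝ, IsFeasible P X M ρ prem J →
    rdu P u T (fun ω => W₀ - prem - X ω + J (X ω)) ≤
      rdu P u T (fun ω => W₀ - prem - X ω + I (X ω))

/-- `I` is *the* optimal indemnity: it is optimal, and every optimal indemnity coincides with it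
on `[0, M]`. -/
def IsTheOptimal {Ω : Type*} [MeasurableSpace Ω] (P : Measure Ω) (X : Ω → ℝ) (u T : ℝ → ℝ)
    (M W₀ ρ prem : ℝ) (I : ℝ → ℝ) : Prop :=
  IsOptimal P X u T M W₀ ρ prem I ∧
    ∀ J : ℝ → ℝ, IsOptimal P X u T M W₀ ρ prem J → EqOn J I (Icc 0 M)

/-! ### Assumptions -/

/-- The loss is supported in `[0, M]`, its distribution function is strictly increasing there, and
its quantile function is absolutely continuous on `[0, 1]`. -/
structure IsLoss {Ω : Type*} [MeasurableSpace Ω] (P : Measure Ω) (X : Ω → ℝ) (M : ℝ) : Prop where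
  measurable : Measurable X
  support : ∀ᵐ ω ∂P, X ω ∈ Icc 0 M
  cdf_strictMono : StrictMonoOn (cdf P X) (Icc 0 M)
  quantile_ac : AbsolutelyContinuousOnInterval (quantile P X) 0 1

/-- Inverse-S shaped weighting function with turning point `b` of its derivative.
The limit `T'(0+)` may be infinite. -/
structure IsInverseS (T : ℝ → ℝ) (b : ℝ) : Prop where
  continuousOn : ContinuousOn T (Icc 0 1)
  strictMonoOn : StrictMonoOn T (Icc 0 1)
  map_zero : T 0 = 0
  map_one : T 1 = 1
  differentiableOn : DifferentiableOn ℝ T (Ioo 0 1)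
  differentiableOn_deriv : DifferentiableOn ℝ (deriv T) (Ioo 0 1)
  b_mem : b ∈ Ioo (0 : ℝ) 1
  deriv_anti : StrictAntiOn (deriv T) (Ioo 0 b)
  deriv_mono : StrictMonoOn (deriv T) (Ioo b 1)
  deriv_zero : ∃ L : EReal, 1 < L ∧
    Tendsto (fun z => ((deriv T z : ℝ) : EReal)) (𝓝[>] 0) (𝓝 L)
  deriv_one : Tendsto (deriv T) (𝓝[<] 1) atTop

/-- Strictly concave utility `u : [0,∞) → [0,∞)`, twice differentiable on `(0,∞)`. -/
structure IsUtility (u : ℝ → ℝ) : Prop where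
  nonneg : ∀ x, 0 ≤ x → 0 ≤ u x
  strictMonoOn : StrictMonoOn u (Ici 0)
  differentiableOn : DifferentiableOn ℝ u (Ioi 0)
  differentiableOn_deriv : DifferentiableOn ℝ (deriv u) (Ioi 0)
  deriv_anti : StrictAntiOn (deriv u) (Ioi 0)

/-- Arrow–Pratt measure of absolute risk aversion. -/
def arrowPratt (f : ℝ → ℝ) (x : ℝ) : ℝ := -(deriv (deriv f) x / deriv f x)

/-! ### Auxiliary quantities -/

/-- `z ↦ (1 - T(z)) / (1 - z)` on `[0, 1)`. -/
def tailRatio (T : ℝ → ℝ) (z : ℝ) : ℝ := (1 - T z) / (1 - z)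

/-- The point `a`: the tail ratio is strictly decreasing on `[0, a]` and strictly increasing on
`[a, 1)`. -/
def aPt (T : ℝ → ℝ) : ℝ :=
  sInf {z : ℝ | z ∈ Ioo (0 : ℝ) 1 ∧ StrictAntiOn (tailRatio T) (Icc 0 z) ∧
    StrictMonoOn (tailRatio T) (Ico z 1)}

/-- The point `c`: the solution in `(a, 1)` of `(1 - T(c)) / (1 - c) = 1`. -/
def cPt (T : ℝ → ℝ) : ℝ := sInf {z : ℝ | z ∈ Ioo (aPt T) 1 ∧ tailRatio T z = 1}

/-- `h_Δ(z)`, as a function of the wealth `w = W_Δ` and of the quantile function `F`. -/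
def hFun (u T F : ℝ → ℝ) (w z : ℝ) : ℝ :=
  ∫ t in (0 : ℝ)..z,
    (deriv u (w - F z) * (1 - T z) / (1 - z) - deriv u (w - F t) * deriv T t)

/-- `l_Δ`: the zero of `h_Δ` on `[a, c]`, as a function of `w = W_Δ`. -/
def lPt (u T F : ℝ → ℝ) (w : ℝ) : ℝ :=
  sInf {z : ℝ | z ∈ Icc (aPt T) (cPt T) ∧ hFun u T F w z = 0}

/-- `Δ(d) = ∫_0^d F(z) dz + F(d) (1 - d)`. -/
def deltaFun (F : ℝ → ℝ) (d : ℝ) : ℝ := (∫ z in (0 : ℝ)..d, F z) + F d * (1 - d)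

/-- `g(z)`; here `W = W₀ - (1+ρ)E[X]`. -/
def gFun (u T F : ℝ → ℝ) (W ρ z : ℝ) : ℝ :=
  ∫ t in (0 : ℝ)..z,
    (deriv u (W + (1 + ρ) * deltaFun F z - F z) * (1 - T z) / (1 - z)
      - deriv u (W + (1 + ρ) * deltaFun F z - F t) * deriv T t)

/-- The integral whose vanishing links `z₂` and `z₁` in a threefold contract; `w = W_Δ`. -/
def psiFun (u T F : ℝ → ℝ) (w z₂ z₁ : ℝ) : ℝ :=
  ∫ t in z₂..z₁,
    (deriv u (w - F z₁ + F z₂) * (1 - T z₁) / (1 - z₁)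
      - deriv u (w - F t + F z₂) * deriv T t)

/-! ### Contracts -/

/-- Threefold contract: full coverage below `x₂`, constant `x₂` on `[x₂, x₁)`, and
`z - x₁ + x₂` from `x₁` on. -/
def threefold (x₂ x₁ z : ℝ) : ℝ := if z < x₂ then z else if z < x₁ then x₂ else z - x₁ + x₂

/-- Deductible contract with deductible `x`. -/
def deductible (x z : ℝ) : ℝ := if z < x then 0 else z - x

/-- The defining requirements on the pair `(z₂, z₁)` of a threefold contract. -/
def IsThreefoldPair {Ω : Type*} [MeasurableSpace Ω] (P : Measure Ω) (X : Ω → ℝ) (u T : ℝ → ℝ)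
    (W₀ ρ prem z₂ z₁ : ℝ) : Prop :=
  0 ≤ z₂ ∧ z₂ ≤ aPt T ∧ aPt T ≤ z₁ ∧ z₁ < 1 ∧
  psiFun u T (quantile P X) (W₀ - prem) z₂ z₁ = 0 ∧
  ∫ ω, threefold (quantile P X z₂) (quantile P X z₁) (X ω) ∂P = prem / (1 + ρ)

/-- The optimal indemnity is a threefold contract given by a pair `(z₂, z₁)` as above.
The numbers `F_X⁻¹(z₂)`, `F_X⁻¹(z₁)` are uniquely determined, and so is the pair itself unless both
of them are atoms of `X`. -/
def OptimalIsThreefold {Ω : Type*} [MeasurableSpace Ω] (P : Measure Ω) (X : Ω → ℝ)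
    (u T : ℝ → ℝ) (M W₀ ρ prem : ℝ) : Prop :=
  ∃ z₂ z₁ : ℝ, IsThreefoldPair P X u T W₀ ρ prem z₂ z₁ ∧
    IsTheOptimal P X u T M W₀ ρ prem (threefold (quantile P X z₂) (quantile P X z₁)) ∧
    ∀ y₂ y₁ : ℝ, IsThreefoldPair P X u T W₀ ρ prem y₂ y₁ →
      quantile P X y₂ = quantile P X z₂ ∧ quantile P X y₁ = quantile P X z₁ ∧
      (P {ω | X ω = quantile P X z₂} = 0 ∨ P {ω | X ω = quantile P X z₁} = 0 →
        y₂ = z₂ ∧ y₁ = z₁)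

/-- The optimal indemnity is a deductible contract with deductible `F_X⁻¹(f)`, where `f ∈ S` and
the participation constraint is binding. The deductible is uniquely determined, and so is `f`
unless the deductible is an atom of `X`. -/
def OptimalIsDeductible {Ω : Type*} [MeasurableSpace Ω] (P : Measure Ω) (X : Ω → ℝ)
    (u T : ℝ → ℝ) (M W₀ ρ prem : ℝ) (S : Set ℝ) : Prop :=
  ∃ f ∈ S, ∫ ω, deductible (quantile P X f) (X ω) ∂P = prem / (1 + ρ) ∧
    IsTheOptimal P X u T M W₀ ρ prem (deductible (quantile P X f)) ∧
    ∀ f' ∈ S, ∫ ω, deductible (quantile P X f') (X ω) ∂P = prem / (1 + ρ) →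
      quantile P X f' = quantile P X f ∧
      (P {ω | X ω = quantile P X f} = 0 → f' = f)

end RDUInsurance

end

/-! Write R(x) = x - I(x) for the retained loss, F for the quantile function of X and w = W₀ - π. By
`rdu_eq_integral` the objective is ∫ u(w - R(F t)) T'(t) dt over ranks t in (0,1), and the premium
constraint says that the mean of R(X) is at least D = E[X] - π/(1+ρ). R and I are both
nondecreasing, so R has slope in [0,1].

Concavity of u makes first-order conditions sufficient (`InsuranceData.value_le`). For a candidate
G, the gain of R over G is at most ∫ u'(w - G(F t)) T'(t) (G - R)(F t) dt. The mean constraint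
allows a nonnegative multiplier λ to be subtracted from u' T'. Integration by parts
(`integral_mul_nonpos_of_tail`) then leaves the tail integral of u' T' - λ against the derivative of
(G - R)∘F. This is nonpositive if G has slope 0 where the tail is nonnegative and slope 1 where it
is nonpositive. For the layer G with endpoints F(z₂), F(z₁), let λ be the mean of u' T' over ranks
above z₁. The tail vanishes at z₁ and equals -ψ(z₂,z₁) at z₂, with ψ = `psiFun`. Its signs follow
from three facts: (1-T(z))/(1-z) increases beyond a; u' T' decreases up to a, which is where A_T >
A_u F' enters (`InsuranceData.strictAntiOn_marginal`); and T' decreases before a. If z₂ > 0 one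
needs ψ = 0; if z₂ = 0, so that G is a deductible, ψ ≥ 0 suffices. Strict concavity and T' > 0 off
the point b give uniqueness.

For existence, ψ(z₂,·) has a unique zero in [a,c], continuous in z₂. Along these zeros the mean
retention runs from Δ(l), with l the zero of h at wealth w, down to 0 at z₂ = a
(`InsuranceData.exists_threefold_pair`). So D ≤ Δ(l) yields a threefold contract. A deductible with
Δ(f) = D and f ≥ l is a candidate as well. Since w = W + (1+ρ)D and l is monotone in wealth under
decreasing risk aversion (`InsuranceData.lPt_mono`), comparison with wealths W_Δ(a) and W_Δ(c) gives
the premium ranges. -/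

namespace RDUInsurance

/-! ### Inverse-S shaped weighting functions -/

namespace IsInverseS

variable {T : ℝ → ℝ} {b : ℝ}

theorem hasDerivAt (hT : IsInverseS T b) {z : ℝ} (hz : z ∈ Ioo (0 : ℝ) 1) :
    HasDerivAt T (deriv T z) z :=
  (hT.differentiableOn.differentiableAt (isOpen_Ioo.mem_nhds hz)).hasDerivAt

theorem continuousAt_deriv (hT : IsInverseS T b) {z : ℝ} (hz : z ∈ Ioo (0 : ℝ) 1) :
    ContinuousAt (deriv T) z :=
  (hT.differentiableOn_deriv.differentiableAt (isOpen_Ioo.mem_nhds hz)).continuousAt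

theorem deriv_nonneg (hT : IsInverseS T b) {z : ℝ} (hz : z ∈ Ioo (0 : ℝ) 1) : 0 ≤ deriv T z := by
  have h := (hT.strictMonoOn.monotoneOn.mono Ioo_subset_Icc_self).derivWithin_nonneg (x := z)
  rwa [derivWithin_of_mem_nhds (isOpen_Ioo.mem_nhds hz)] at h

/-- Strictness survives at b: by continuity of T' there, T'(b) is at most the value at a midpoint,
which is already strictly below T'(x). -/
theorem strictAntiOn_deriv (hT : IsInverseS T b) : StrictAntiOn (deriv T) (Ioc 0 b) := by
  have hb := hT.b_mem
  intro x hx y hy hxy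
  rcases hy.2.lt_or_eq with h | rfl
  · exact hT.deriv_anti ⟨hx.1, hxy.trans h⟩ ⟨hy.1, h⟩ hxy
  · have hm : (x + y) / 2 ∈ Ioo 0 y := ⟨by linarith [hx.1, hy.1], by linarith⟩
    have h1 : deriv T ((x + y) / 2) < deriv T x :=
      hT.deriv_anti ⟨hx.1, hxy⟩ hm (by linarith)
    refine lt_of_le_of_lt ?_ h1
    refine le_of_tendsto ((hT.continuousAt_deriv hb).tendsto.mono_left nhdsWithin_le_nhds :
      Tendsto (deriv T) (𝓝[<] y) _) ?_
    filter_upwards [Ioo_mem_nhdsLT hm.2] with t ht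
    exact (hT.deriv_anti hm ⟨hm.1.trans ht.1, ht.2⟩ ht.1).le

theorem strictMonoOn_deriv (hT : IsInverseS T b) : StrictMonoOn (deriv T) (Ico b 1) := by
  have hb := hT.b_mem
  intro x hx y hy hxy
  rcases hx.1.lt_or_eq with h | rfl
  · exact hT.deriv_mono ⟨h, hx.2⟩ ⟨h.trans hxy, hy.2⟩ hxy
  · have hm : (b + y) / 2 ∈ Ioo b 1 := ⟨by linarith, by linarith [hy.2, hx.2]⟩
    have h1 : deriv T ((b + y) / 2) < deriv T y :=
      hT.deriv_mono hm ⟨hxy, hy.2⟩ (by linarith)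
    refine lt_of_le_of_lt ?_ h1
    refine le_of_tendsto ((hT.continuousAt_deriv hb).tendsto.mono_left nhdsWithin_le_nhds :
      Tendsto (deriv T) (𝓝[>] b) _) ?_
    filter_upwards [Ioo_mem_nhdsGT hm.1] with t ht
    exact (hT.deriv_mono ⟨ht.1, ht.2.trans hm.2⟩ hm ht.2).le

/-- T' is nonnegative and has its strict minimum at b, the only point where it could vanish. -/
theorem deriv_pos (hT : IsInverseS T b) {z : ℝ} (hz : z ∈ Ioo (0 : ℝ) 1) (hzb : z ≠ b) :
    0 < deriv T z := by
  have hb := hT.b_mem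
  refine (hT.deriv_nonneg hb).trans_lt ?_
  rcases hzb.lt_or_gt with h | h
  · exact hT.strictAntiOn_deriv ⟨hz.1, h.le⟩ ⟨hb.1, le_rfl⟩ h
  · exact hT.strictMonoOn_deriv ⟨le_rfl, hb.2⟩ ⟨h.le, hz.2⟩ h

theorem intervalIntegrable_deriv (hT : IsInverseS T b) {x y : ℝ} (hx : x ∈ Icc (0 : ℝ) 1)
    (hy : y ∈ Icc (0 : ℝ) 1) : IntervalIntegrable (deriv T) volume x y :=
  (hT.strictMonoOn.monotoneOn.mono (uIcc_subset_Icc hx hy)).intervalIntegrable_deriv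

theorem integral_deriv (hT : IsInverseS T b) {x y : ℝ} (hx : x ∈ Icc (0 : ℝ) 1)
    (hy : y ∈ Icc (0 : ℝ) 1) (hxy : x ≤ y) : ∫ t in x..y, deriv T t = T y - T x :=
  intervalIntegral.integral_eq_sub_of_hasDerivAt_of_le hxy
    (hT.continuousOn.mono (Icc_subset_Icc hx.1 hy.2))
    (fun _ ht => hT.hasDerivAt ⟨hx.1.trans_lt ht.1, ht.2.trans_le hy.2⟩)
    (hT.intervalIntegrable_deriv hx hy)

theorem map_lt_one (hT : IsInverseS T b) {z : ℝ} (hz : z ∈ Ico (0 : ℝ) 1) : T z < 1 := by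
  rw [← hT.map_one]
  exact hT.strictMonoOn ⟨hz.1, hz.2.le⟩ (right_mem_Icc.2 zero_le_one) hz.2

theorem tailRatio_pos (hT : IsInverseS T b) {z : ℝ} (hz : z ∈ Ico (0 : ℝ) 1) :
    0 < tailRatio T z :=
  div_pos (by linarith [hT.map_lt_one hz]) (by linarith [hz.2])

/-- Numerator of the derivative of the tail ratio. -/
noncomputable def tailGap (T : ℝ → ℝ) (z : ℝ) : ℝ := (1 - T z) - deriv T z * (1 - z)

theorem hasDerivAt_tailRatio (hT : IsInverseS T b) {z : ℝ} (hz : z ∈ Ioo (0 : ℝ) 1) :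
    HasDerivAt (tailRatio T) (tailGap T z / (1 - z) ^ 2) z := by
  have h1 : HasDerivAt (fun z => 1 - T z) (-deriv T z) z := (hT.hasDerivAt hz).const_sub 1
  have h2 : HasDerivAt (fun z : ℝ => 1 - z) (-1) z := (hasDerivAt_id z).const_sub 1
  have := h1.div h2 (sub_pos.2 hz.2).ne'
  refine this.congr_deriv ?_
  rw [tailGap]
  ring

theorem continuousOn_tailRatio (hT : IsInverseS T b) : ContinuousOn (tailRatio T) (Ico 0 1) := by
  refine ContinuousOn.div (continuousOn_const.sub (hT.continuousOn.mono Ico_subset_Icc_self))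
    (continuousOn_const.sub continuousOn_id) ?_
  exact fun z hz => (sub_pos.2 hz.2).ne'

theorem exists_deriv_eq_slope (hT : IsInverseS T b) {x y : ℝ} (hx : 0 ≤ x) (hxy : x < y)
    (hy : y ≤ 1) : ∃ t ∈ Ioo x y, T y - T x = deriv T t * (y - x) := by
  obtain ⟨t, ht, h⟩ := exists_hasDerivAt_eq_slope T (deriv T) hxy
    (hT.continuousOn.mono (Icc_subset_Icc hx hy))
    (fun t ht => hT.hasDerivAt ⟨hx.trans_lt ht.1, ht.2.trans_le hy⟩)
  refine ⟨t, ht, ?_⟩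
  rw [h]
  field_simp [(sub_pos.2 hxy).ne']

/-- By the mean value theorem 1 - T(z) = T'(t)(1 - z) with t in (z,1), and T' increases beyond b. -/
theorem tailGap_pos_of_le (hT : IsInverseS T b) {z : ℝ} (hz : z ∈ Ico b 1) : 0 < tailGap T z := by
  have hb := hT.b_mem
  obtain ⟨t, ht, h⟩ := hT.exists_deriv_eq_slope (hb.1.le.trans hz.1) hz.2 le_rfl
  rw [hT.map_one] at h
  have := hT.strictMonoOn_deriv hz ⟨hz.1.trans ht.1.le, ht.2⟩ ht.1
  rw [tailGap, h]
  nlinarith [hz.2]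

/-- With T(y) - T(x) = T'(t)(y - x), the increment is (T'(x) - T'(y))(1 - y) + (T'(x) - T'(t))(y -
x); both terms are controlled by the decrease of T', so the sign of T'' is not needed. -/
theorem strictMonoOn_tailGap (hT : IsInverseS T b) : StrictMonoOn (tailGap T) (Ioc 0 b) := by
  have hb := hT.b_mem
  intro x hx y hy hxy
  obtain ⟨t, ht, h⟩ := hT.exists_deriv_eq_slope hx.1.le hxy (hy.2.trans hb.2.le)
  have h1 := hT.strictAntiOn_deriv hx ⟨hx.1.trans ht.1, ht.2.le.trans hy.2⟩ ht.1
  have h2 := hT.strictAntiOn_deriv hx hy hxy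
  simp only [tailGap]
  nlinarith [hy.2, hb.2]

theorem exists_tailGap_neg (hT : IsInverseS T b) : ∃ z ∈ Ioo 0 b, tailGap T z < 0 := by
  have hb := hT.b_mem
  obtain ⟨L, hL, hlim⟩ := hT.deriv_zero
  obtain ⟨q, hq1, hqL⟩ := EReal.lt_iff_exists_real_btwn.1 hL
  have hq1 : 1 < q := by exact_mod_cast hq1
  have h1 : ∀ᶠ z in 𝓝[>] (0 : ℝ), q < deriv T z := by
    filter_upwards [hlim.eventually (lt_mem_nhds hqL)] with z hz
    exact_mod_cast hz
  -- The bound 1 - 1/q makes q(1 - z) > 1, which exceeds 1 - T(z).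
  have hpos : 0 < min b (1 - 1 / q) :=
    lt_min hb.1 (by rw [sub_pos, div_lt_one (by linarith)]; exact hq1)
  obtain ⟨z, hz1, hz2⟩ := (h1.and (Ioo_mem_nhdsGT hpos)).exists
  have hzb : z < b := hz2.2.trans_le (min_le_left _ _)
  have hzq : z < 1 - 1 / q := hz2.2.trans_le (min_le_right _ _)
  refine ⟨z, ⟨hz2.1, hzb⟩, ?_⟩
  have hT0 : 0 < T z := by
    rw [← hT.map_zero]
    exact hT.strictMonoOn (left_mem_Icc.2 zero_le_one) ⟨hz2.1.le, hzb.le.trans hb.2.le⟩ hz2.1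
  have h3 : 1 < q * (1 - z) := by
    have : q * (1 / q) = 1 := by field_simp
    nlinarith
  have h4 : q * (1 - z) < deriv T z * (1 - z) :=
    mul_lt_mul_of_pos_right hz1 (by linarith [hb.2])
  rw [tailGap]
  linarith

theorem exists_tailGap_eq_zero (hT : IsInverseS T b) : ∃ a ∈ Ioo 0 b, tailGap T a = 0 := by
  have hb := hT.b_mem
  obtain ⟨z, hz, hneg⟩ := hT.exists_tailGap_neg
  have hcont : ContinuousOn (tailGap T) (Icc z b) := by
    have hsub : Icc z b ⊆ Ioo 0 1 := fun t ht => ⟨hz.1.trans_le ht.1, ht.2.trans_lt hb.2⟩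
    exact (continuousOn_const.sub (hT.continuousOn.mono (hsub.trans Ioo_subset_Icc_self))).sub
      ((hT.differentiableOn_deriv.continuousOn.mono hsub).mul
        (continuousOn_const.sub continuousOn_id))
  obtain ⟨a, ha, h0⟩ := intermediate_value_Ioo hz.2.le hcont
    ⟨hneg, hT.tailGap_pos_of_le ⟨le_rfl, hb.2⟩⟩
  exact ⟨a, ⟨hz.1.trans ha.1, ha.2⟩, h0⟩

/-- The turning point of the tail ratio. -/
theorem exists_turning_point (hT : IsInverseS T b) :
    ∃ a ∈ Ioo 0 b, StrictAntiOn (tailRatio T) (Icc 0 a) ∧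
      StrictMonoOn (tailRatio T) (Ico a 1) ∧ (∀ z ∈ Ico a 1, 0 ≤ tailGap T z) ∧
      tailGap T a = 0 := by
  have hb := hT.b_mem
  obtain ⟨a, ha, h0⟩ := hT.exists_tailGap_eq_zero
  have hgt : ∀ z ∈ Ioo a 1, 0 < tailGap T z := by
    intro z hz
    rcases le_or_gt b z with h | h
    · exact hT.tailGap_pos_of_le ⟨h, hz.2⟩
    · rw [← h0]
      exact hT.strictMonoOn_tailGap ⟨ha.1, ha.2.le⟩ ⟨ha.1.trans hz.1, h.le⟩ hz.1
  refine ⟨a, ha, ?_, ?_, ?_, h0⟩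
  · refine strictAntiOn_of_deriv_neg (convex_Icc 0 a) (hT.continuousOn_tailRatio.mono
      fun z hz => ⟨hz.1, hz.2.trans_lt (ha.2.trans hb.2)⟩) fun z hz => ?_
    rw [interior_Icc] at hz
    have hz1 : z < 1 := hz.2.trans (ha.2.trans hb.2)
    rw [(hT.hasDerivAt_tailRatio ⟨hz.1, hz1⟩).deriv]
    refine div_neg_of_neg_of_pos ?_ (pow_pos (by linarith) 2)
    rw [← h0]
    exact hT.strictMonoOn_tailGap ⟨hz.1, (hz.2.trans ha.2).le⟩ ⟨ha.1, ha.2.le⟩ hz.2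
  · refine strictMonoOn_of_deriv_pos (convex_Ico a 1) (hT.continuousOn_tailRatio.mono
      fun z hz => ⟨ha.1.le.trans hz.1, hz.2⟩) fun z hz => ?_
    rw [interior_Ico] at hz
    rw [(hT.hasDerivAt_tailRatio ⟨ha.1.trans hz.1, hz.2⟩).deriv]
    exact div_pos (hgt z hz) (pow_pos (by linarith [hz.2]) 2)
  · intro z hz
    rcases hz.1.eq_or_lt with rfl | h
    · exact h0.ge
    · exact (hgt z ⟨h, hz.2⟩).le

theorem turning_point_unique {x y : ℝ} (hx : x < 1) (hy : y < 1) (hx0 : 0 < x) (hy0 : 0 < y)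
    (hxa : StrictAntiOn (tailRatio T) (Icc 0 x)) (hxm : StrictMonoOn (tailRatio T) (Ico x 1))
    (hya : StrictAntiOn (tailRatio T) (Icc 0 y)) (hym : StrictMonoOn (tailRatio T) (Ico y 1)) :
    x = y := by
  rcases lt_trichotomy x y with h | h | h
  · exact absurd (hxm ⟨le_rfl, hx⟩ ⟨h.le, hy⟩ h)
      (hya ⟨hx0.le, h.le⟩ ⟨hy0.le, le_rfl⟩ h).not_gt
  · exact h
  · exact absurd (hym ⟨le_rfl, hy⟩ ⟨h.le, hx⟩ h)
      (hxa ⟨hy0.le, h.le⟩ ⟨hx0.le, le_rfl⟩ h).not_gt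

theorem aPt_spec (hT : IsInverseS T b) :
    aPt T ∈ Ioo 0 b ∧ StrictAntiOn (tailRatio T) (Icc 0 (aPt T)) ∧
      StrictMonoOn (tailRatio T) (Ico (aPt T) 1) ∧ (∀ z ∈ Ico (aPt T) 1, 0 ≤ tailGap T z) ∧
      tailGap T (aPt T) = 0 := by
  have hb := hT.b_mem
  obtain ⟨a, ha, h1, h2, h3⟩ := hT.exists_turning_point
  have hset : {z : ℝ | z ∈ Ioo (0 : ℝ) 1 ∧ StrictAntiOn (tailRatio T) (Icc 0 z) ∧
      StrictMonoOn (tailRatio T) (Ico z 1)} = {a} := by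
    ext z
    simp only [mem_ofPred_eq, mem_singleton_iff]
    constructor
    · rintro ⟨hz, hza, hzm⟩
      exact turning_point_unique hz.2 (ha.2.trans hb.2) hz.1 ha.1 hza hzm h1 h2
    · rintro rfl
      exact ⟨⟨ha.1, ha.2.trans hb.2⟩, h1, h2⟩
  have : aPt T = a := by rw [aPt, hset, csInf_singleton]
  rw [this]
  exact ⟨ha, h1, h2, h3⟩

theorem aPt_mem (hT : IsInverseS T b) : aPt T ∈ Ioo (0 : ℝ) 1 :=
  ⟨hT.aPt_spec.1.1, hT.aPt_spec.1.2.trans hT.b_mem.2⟩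

/-- The tail ratio increases on [a,1), which forces T' to stay below it; at a itself equality holds.
-/
theorem deriv_le_tailRatio (hT : IsInverseS T b) {z : ℝ} (hz : z ∈ Ico (aPt T) 1) :
    deriv T z ≤ tailRatio T z := by
  have h := hT.aPt_spec.2.2.2.1 z hz
  rw [tailGap] at h
  rw [tailRatio, le_div_iff₀ (by linarith [hz.2])]
  linarith

theorem deriv_aPt (hT : IsInverseS T b) : deriv T (aPt T) = tailRatio T (aPt T) := by
  have h := hT.aPt_spec.2.2.2.2
  rw [tailGap] at h
  rw [tailRatio, eq_div_iff (by linarith [hT.aPt_mem.2])]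
  linarith

theorem tailRatio_zero (hT : IsInverseS T b) : tailRatio T 0 = 1 := by
  simp [tailRatio, hT.map_zero]

theorem exists_one_lt_tailRatio (hT : IsInverseS T b) : ∃ z ∈ Ioo (aPt T) 1, 1 < tailRatio T z := by
  have ha := hT.aPt_mem
  obtain ⟨y, hy, h⟩ := ((hT.deriv_one.eventually_gt_atTop 1).and (Ioo_mem_nhdsLT ha.2)).exists
  exact ⟨y, h, hy.trans_le (hT.deriv_le_tailRatio ⟨h.1.le, h.2⟩)⟩

theorem cPt_spec (hT : IsInverseS T b) : cPt T ∈ Ioo (aPt T) 1 ∧ tailRatio T (cPt T) = 1 := by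
  have ha := hT.aPt_mem
  obtain ⟨-, h1, h2, -⟩ := hT.aPt_spec
  obtain ⟨y, hy, hy1⟩ := hT.exists_one_lt_tailRatio
  have ha1 : tailRatio T (aPt T) < 1 := by
    rw [← hT.tailRatio_zero]
    exact h1 ⟨le_rfl, ha.1.le⟩ ⟨ha.1.le, le_rfl⟩ ha.1
  obtain ⟨c, hc, hc1⟩ := intermediate_value_Ioo hy.1.le
    (hT.continuousOn_tailRatio.mono fun z hz => ⟨ha.1.le.trans hz.1, hz.2.trans_lt hy.2⟩)
    ⟨ha1, hy1⟩
  have hset : {z : ℝ | z ∈ Ioo (aPt T) 1 ∧ tailRatio T z = 1} = {c} := by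
    ext z
    simp only [mem_ofPred_eq, mem_singleton_iff]
    constructor
    · rintro ⟨hz, hz1⟩
      exact h2.injOn ⟨hz.1.le, hz.2⟩ ⟨hc.1.le, hc.2.trans hy.2⟩ (hz1.trans hc1.symm)
    · rintro rfl
      exact ⟨⟨hc.1, hc.2.trans hy.2⟩, hc1⟩
  have : cPt T = c := by rw [cPt, hset, csInf_singleton]
  rw [this]
  exact ⟨⟨hc.1, hc.2.trans hy.2⟩, hc1⟩

theorem map_cPt (hT : IsInverseS T b) : T (cPt T) = cPt T := by
  have h := hT.cPt_spec.2
  rw [tailRatio, div_eq_one_iff_eq (by linarith [hT.cPt_spec.1.2])] at h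
  linarith

end IsInverseS

/-- A Lipschitz function of an absolutely continuous function is absolutely continuous. -/
theorem AbsolutelyContinuousOnInterval.lipschitzOnWith_comp {f φ : ℝ → ℝ} {a b : ℝ} {K : NNReal}
    {s : Set ℝ} (hf : AbsolutelyContinuousOnInterval f a b) (hφ : LipschitzOnWith K φ s)
    (hs : MapsTo f (uIcc a b) s) : AbsolutelyContinuousOnInterval (fun t => φ (f t)) a b := by
  rw [absolutelyContinuousOnInterval_iff] at hf ⊢
  intro ε hε
  obtain ⟨δ, hδ, h⟩ := hf (ε / (K + 1)) (by positivity)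
  refine ⟨δ, hδ, fun E hE hlt => ?_⟩
  have h1 := h E hE hlt
  have hmem := hE.1
  calc ∑ i ∈ Finset.range E.1, dist (φ (f (E.2 i).1)) (φ (f (E.2 i).2))
      ≤ ∑ i ∈ Finset.range E.1, (K + 1) * dist (f (E.2 i).1) (f (E.2 i).2) := by
        refine Finset.sum_le_sum fun i hi => ?_
        refine (hφ.dist_le_mul _ (hs (hmem i hi).1) _ (hs (hmem i hi).2)).trans ?_
        exact mul_le_mul_of_nonneg_right (by simp) dist_nonneg
    _ = (K + 1) * ∑ i ∈ Finset.range E.1, dist (f (E.2 i).1) (f (E.2 i).2) := by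
        rw [Finset.mul_sum]
    _ < (K + 1) * (ε / (K + 1)) := mul_lt_mul_of_pos_left h1 (by positivity)
    _ = ε := by field_simp

/-! ### Utility functions -/

namespace IsUtility

variable {u : ℝ → ℝ}

theorem hasDerivAt (hu : IsUtility u) {x : ℝ} (hx : 0 < x) : HasDerivAt u (deriv u x) x :=
  (hu.differentiableOn.differentiableAt (Ioi_mem_nhds hx)).hasDerivAt

theorem hasDerivAt_deriv (hu : IsUtility u) {x : ℝ} (hx : 0 < x) :
    HasDerivAt (deriv u) (deriv (deriv u) x) x :=
  (hu.differentiableOn_deriv.differentiableAt (Ioi_mem_nhds hx)).hasDerivAt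

theorem deriv_pos (hu : IsUtility u) {x : ℝ} (hx : 0 < x) : 0 < deriv u x := by
  have h : 0 ≤ deriv u (x + 1) := by
    have h := (hu.strictMonoOn.monotoneOn.mono Ioi_subset_Ici_self).derivWithin_nonneg (x := x + 1)
    rwa [derivWithin_of_mem_nhds (Ioi_mem_nhds (by linarith))] at h
  exact h.trans_lt (hu.deriv_anti hx (by simp only [mem_Ioi]; linarith) (by linarith))

theorem deriv_le_deriv (hu : IsUtility u) {x y : ℝ} (hx : 0 < x) (hxy : x ≤ y) :
    deriv u y ≤ deriv u x :=
  hu.deriv_anti.antitoneOn hx (hx.trans_le hxy) hxy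

theorem deriv_deriv_nonpos (hu : IsUtility u) {x : ℝ} (hx : 0 < x) : deriv (deriv u) x ≤ 0 := by
  have h := hu.deriv_anti.antitoneOn.derivWithin_nonpos (x := x)
  rwa [derivWithin_of_mem_nhds (Ioi_mem_nhds hx)] at h

theorem arrowPratt_nonneg (hu : IsUtility u) {x : ℝ} (hx : 0 < x) : 0 ≤ arrowPratt u x := by
  rw [arrowPratt, neg_nonneg]
  exact div_nonpos_of_nonpos_of_nonneg (hu.deriv_deriv_nonpos hx) (hu.deriv_pos hx).le

theorem hasDerivAt_log_deriv (hu : IsUtility u) {x : ℝ} (hx : 0 < x) :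
    HasDerivAt (fun y => Real.log (deriv u y)) (-arrowPratt u x) x := by
  refine ((hu.hasDerivAt_deriv hx).log (hu.deriv_pos hx).ne').congr_deriv ?_
  simp [arrowPratt]

theorem lt_tangent_of_pos (hu : IsUtility u) {x y : ℝ} (hx : 0 < x) (hy : 0 < y) (hxy : y ≠ x) :
    u y < u x + deriv u x * (y - x) := by
  rcases hxy.lt_or_gt with h | h
  · obtain ⟨t, ht, hs⟩ := exists_hasDerivAt_eq_slope u (deriv u) h
      (fun t ht => (hu.hasDerivAt (hy.trans_le ht.1)).continuousAt.continuousWithinAt)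
      (fun t ht => hu.hasDerivAt (hy.trans ht.1))
    rw [eq_div_iff (sub_pos.2 h).ne'] at hs
    nlinarith [hu.deriv_anti (hy.trans ht.1) hx ht.2]
  · obtain ⟨t, ht, hs⟩ := exists_hasDerivAt_eq_slope u (deriv u) h
      (fun t ht => (hu.hasDerivAt (hx.trans_le ht.1)).continuousAt.continuousWithinAt)
      (fun t ht => hu.hasDerivAt (hx.trans ht.1))
    rw [eq_div_iff (sub_pos.2 h).ne'] at hs
    nlinarith [hu.deriv_anti hx (hx.trans ht.1) ht.1]

/-- Continuity of u at 0 is not assumed: monotonicity puts u(0) below the tangent at every small t >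
0, and t tends to 0. -/
theorem map_zero_le (hu : IsUtility u) {x : ℝ} (hx : 0 < x) : u 0 ≤ u x - deriv u x * x := by
  have hlim : Tendsto (fun t => u x + deriv u x * (t - x)) (𝓝[>] 0)
      (𝓝 (u x + deriv u x * (0 - x))) := by
    have : Continuous fun t => u x + deriv u x * (t - x) := by fun_prop
    exact this.continuousAt.tendsto.mono_left nhdsWithin_le_nhds
  have h := ge_of_tendsto hlim (b := u 0) (by
    filter_upwards [Ioo_mem_nhdsGT hx] with t ht
    exact (hu.strictMonoOn (mem_Ici.2 le_rfl) ht.1.le ht.1).le.trans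
      (hu.lt_tangent_of_pos hx ht.1 ht.2.ne).le)
  linarith

/-- Strict concavity of `u` on `[0, ∞)` in tangent form. -/
theorem lt_tangent (hu : IsUtility u) {x y : ℝ} (hx : 0 < x) (hy : 0 ≤ y) (hxy : y ≠ x) :
    u y < u x + deriv u x * (y - x) := by
  rcases hy.eq_or_lt with rfl | hy
  -- The limit loses strictness, so the tangent at x/2 is inserted between 0 and x.
  · have hm : 0 < x / 2 := by linarith
    have h1 := hu.map_zero_le hm
    have h2 := hu.lt_tangent_of_pos hx hm (by linarith)
    nlinarith [hu.deriv_anti hm hx (by linarith)]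
  · exact hu.lt_tangent_of_pos hx hy hxy

theorem le_tangent (hu : IsUtility u) {x y : ℝ} (hx : 0 < x) (hy : 0 ≤ y) :
    u y ≤ u x + deriv u x * (y - x) := by
  rcases eq_or_ne y x with rfl | h
  · simp
  · exact (hu.lt_tangent hx hy h).le

/-- Decreasing absolute risk aversion: ratios of marginal utilities increase with wealth. -/
theorem deriv_mul_deriv_le (hu : IsUtility u) (hA : StrictAntiOn (arrowPratt u) (Ioi 0))
    {p q δ : ℝ} (hp : 0 < p) (hpq : p ≤ q) (hδ : 0 ≤ δ) :
    deriv u q * deriv u (p + δ) ≤ deriv u (q + δ) * deriv u p := by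
  -- The derivative in the wealth shift s is A_u(p + s) - A_u(q + s), nonnegative because p ≤ q.
  have hd : ∀ s : ℝ, 0 ≤ s → HasDerivAt
      (fun s => Real.log (deriv u (q + s)) - Real.log (deriv u (p + s)))
      (-arrowPratt u (q + s) - -arrowPratt u (p + s)) s := fun s hs =>
    ((hu.hasDerivAt_log_deriv (by linarith : 0 < q + s)).comp_const_add q s).sub
      ((hu.hasDerivAt_log_deriv (by linarith : 0 < p + s)).comp_const_add p s)
  have hmono : MonotoneOn (fun s => Real.log (deriv u (q + s)) - Real.log (deriv u (p + s)))
      (Ici 0) := by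
    refine monotoneOn_of_deriv_nonneg (convex_Ici 0)
      (fun s hs => (hd s hs).continuousAt.continuousWithinAt) ?_ ?_
    · intro s hs
      rw [interior_Ici] at hs
      exact (hd s (le_of_lt hs)).differentiableAt.differentiableWithinAt
    · intro s hs
      rw [interior_Ici] at hs
      have hs' : 0 < s := hs
      rw [(hd s hs'.le).deriv]
      have := hA.antitoneOn (by simp only [mem_Ioi]; linarith : p + s ∈ Ioi 0)
        (by simp only [mem_Ioi]; linarith : q + s ∈ Ioi 0) (by linarith)
      linarith
  have h := hmono (mem_Ici.2 le_rfl) hδ hδ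
  simp only [add_zero] at h
  have hq := hu.deriv_pos (hp.trans_le hpq)
  have hp' := hu.deriv_pos hp
  have hqδ := hu.deriv_pos (by linarith : 0 < q + δ)
  have hpδ := hu.deriv_pos (by linarith : 0 < p + δ)
  rw [← Real.log_le_log_iff (by positivity) (by positivity), Real.log_mul hq.ne' hpδ.ne',
    Real.log_mul hqδ.ne' hp'.ne']
  linarith

/-- The derivative of log u' is -A_u, bounded on [m, ∞) by A_u(m). This transfers absolute
continuity from F to log u'(w - F). -/
theorem lipschitzOnWith_log_deriv (hu : IsUtility u) (hA : StrictAntiOn (arrowPratt u) (Ioi 0))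
    {m : ℝ} (hm : 0 < m) :
    LipschitzOnWith (arrowPratt u m).toNNReal (fun y => Real.log (deriv u y)) (Ici m) := by
  refine (convex_Ici m).lipschitzOnWith_of_nnnorm_hasDerivWithin_le
    (fun x hx => (hu.hasDerivAt_log_deriv (hm.trans_le hx)).hasDerivWithinAt) fun x hx => ?_
  have hx0 : 0 < x := hm.trans_le hx
  rw [← NNReal.coe_le_coe, coe_nnnorm, norm_neg, Real.norm_of_nonneg (hu.arrowPratt_nonneg hx0),
    Real.coe_toNNReal _ (hu.arrowPratt_nonneg hm)]
  exact hA.antitoneOn hm hx0 hx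

end IsUtility

/-! ### Distribution and quantile functions -/

section Distribution

variable {Ω : Type*} [MeasurableSpace Ω] {P : Measure Ω}

theorem cdf_nonneg (Y : Ω → ℝ) (x : ℝ) : 0 ≤ cdf P Y x := measureReal_nonneg

theorem cdf_of_ae_lt {Y : Ω → ℝ} {x : ℝ} (h : ∀ᵐ ω ∂P, x < Y ω) : cdf P Y x = 0 := by
  rw [cdf, measureReal_def]
  have : P {ω | Y ω ≤ x} = 0 := by
    rw [measure_eq_zero_iff_ae_notMem]
    filter_upwards [h] with ω hω using by simpa using hω
  simp [this]

variable [IsProbabilityMeasure P]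

theorem cdf_eq_cdf_map {Y : Ω → ℝ} (hY : AEMeasurable Y P) :
    cdf P Y = ProbabilityTheory.cdf (P.map Y) := by
  have := Measure.isProbabilityMeasure_map hY
  ext x
  rw [ProbabilityTheory.cdf_eq_real, cdf, measureReal_def, measureReal_def,
    Measure.map_apply_of_aemeasurable hY measurableSet_Iic]
  rfl

theorem cdf_le_one (Y : Ω → ℝ) (x : ℝ) : cdf P Y x ≤ 1 := measureReal_le_one

theorem cdf_mono (Y : Ω → ℝ) : Monotone (cdf P Y) := fun _ _ h =>
  measureReal_mono fun _ hω => le_trans hω h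

theorem cdf_rightContinuous {Y : Ω → ℝ} (hY : AEMeasurable Y P) (x : ℝ) :
    ContinuousWithinAt (cdf P Y) (Ici x) x := by
  rw [cdf_eq_cdf_map hY]
  exact (ProbabilityTheory.cdf _).right_continuous x

theorem cdf_of_ae_le {Y : Ω → ℝ} {x : ℝ} (h : ∀ᵐ ω ∂P, Y ω ≤ x) : cdf P Y x = 1 :=
  (measureReal_congr (eventuallyEq_univ.2 h)).trans probReal_univ

end Distribution

namespace IsLoss

variable {Ω : Type*} [MeasurableSpace Ω] {P : Measure Ω} {X : Ω → ℝ} {M : ℝ}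

theorem quantile_nonneg (t : ℝ) : 0 ≤ quantile P X t :=
  Real.sInf_nonneg fun _ hx => hx.1

theorem continuousOn_quantile (hX : IsLoss P X M) : ContinuousOn (quantile P X) (Icc 0 1) := by
  have := hX.quantile_ac.continuousOn
  rwa [uIcc_of_le zero_le_one] at this

variable [IsProbabilityMeasure P]

theorem cdf_top (hX : IsLoss P X M) : cdf P X M = 1 :=
  cdf_of_ae_le (hX.support.mono fun _ h => h.2)

/-- Right-continuity of the distribution function makes the infimum attained; t ≤ 1 keeps its
defining set nonempty. -/
theorem quantile_le_iff (hX : IsLoss P X M) (hM : 0 < M) {t x : ℝ} (ht : t ≤ 1) (hx : 0 ≤ x) :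
    quantile P X t ≤ x ↔ t ≤ cdf P X x := by
  have hbdd : BddBelow {x : ℝ | 0 ≤ x ∧ t ≤ cdf P X x} := ⟨0, fun y hy => hy.1⟩
  have hne : {x : ℝ | 0 ≤ x ∧ t ≤ cdf P X x}.Nonempty := ⟨M, hM.le, ht.trans_eq hX.cdf_top.symm⟩
  constructor
  · intro h
    by_contra! hlt
    obtain ⟨y, hy, hy1⟩ : ∃ y, x < y ∧ cdf P X y < t := by
      have h1 := (cdf_rightContinuous (P := P) hX.measurable.aemeasurable x).mono Ioi_subset_Ici_self
      obtain ⟨y, hy, hy'⟩ := ((h1.eventually (gt_mem_nhds hlt)).and self_mem_nhdsWithin).exists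
      exact ⟨y, hy', hy⟩
    obtain ⟨z, hz, hzy⟩ := exists_lt_of_csInf_lt hne (h.trans_lt hy)
    exact absurd (hz.2.trans (cdf_mono X hzy.le)) hy1.not_ge
  · exact fun h => csInf_le hbdd ⟨hx, h⟩

theorem quantile_zero (hX : IsLoss P X M) (hM : 0 < M) : quantile P X 0 = 0 :=
  le_antisymm ((hX.quantile_le_iff hM zero_le_one le_rfl).2 (cdf_nonneg X 0)) (quantile_nonneg 0)

/-- Otherwise the distribution function would reach 1 before M, contrary to its strict increase up
to M. -/
theorem quantile_one (hX : IsLoss P X M) (hM : 0 < M) : quantile P X 1 = M := by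
  refine le_antisymm ((hX.quantile_le_iff hM le_rfl hM.le).2 hX.cdf_top.ge) ?_
  by_contra! h
  have h0 : 0 ≤ quantile P X 1 := quantile_nonneg 1
  have h1 := (hX.quantile_le_iff hM le_rfl h0).1 le_rfl
  have h2 := hX.cdf_strictMono ⟨h0, h.le⟩ ⟨hM.le, le_rfl⟩ h
  rw [hX.cdf_top] at h2
  linarith

theorem quantile_mono (hX : IsLoss P X M) (hM : 0 < M) :
    MonotoneOn (quantile P X) (Icc 0 1) := fun _ hs t ht hst =>
  (hX.quantile_le_iff hM hs.2 (quantile_nonneg t)).2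
    (hst.trans ((hX.quantile_le_iff hM ht.2 (quantile_nonneg t)).1 le_rfl))

/-- Inverse transform: the set of ranks with F(t) ≤ x is (0, F_X(x)], by the Galois connection. -/
theorem map_quantile (hX : IsLoss P X M) (hM : 0 < M) :
    (volume.restrict (Ioc (0 : ℝ) 1)).map (quantile P X) = P.map X := by
  have := Measure.isProbabilityMeasure_map (μ := P) hX.measurable.aemeasurable
  have hF : AEMeasurable (quantile P X) (volume.restrict (Ioc (0 : ℝ) 1)) :=
    aemeasurable_restrict_of_monotoneOn measurableSet_Ioc
      ((hX.quantile_mono hM).mono Ioc_subset_Icc_self)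
  refine (Measure.ext_of_Iic _ _ fun x => ?_).symm
  rw [Measure.map_apply_of_aemeasurable hF measurableSet_Iic,
    Measure.map_apply hX.measurable measurableSet_Iic]
  rcases lt_or_ge x 0 with hx | hx
  · have h1 : quantile P X ⁻¹' Iic x = ∅ :=
      eq_empty_of_forall_notMem fun t ht => ((quantile_nonneg t).trans ht).not_gt hx
    rw [h1, measure_empty, measure_eq_zero_iff_ae_notMem]
    filter_upwards [hX.support] with ω hω h using (hω.1.trans h).not_gt hx
  · rw [Measure.restrict_apply' measurableSet_Ioc]
    have h1 : quantile P X ⁻¹' Iic x ∩ Ioc 0 1 = Ioc 0 (cdf P X x) := by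
      ext t
      simp only [mem_inter_iff, mem_preimage, mem_Iic, mem_Ioc]
      constructor
      · rintro ⟨h, h0, h1⟩
        exact ⟨h0, (hX.quantile_le_iff hM h1 hx).1 h⟩
      · rintro ⟨h0, h⟩
        have h1 := h.trans (cdf_le_one X x)
        exact ⟨(hX.quantile_le_iff hM h1 hx).2 h, h0, h1⟩
    rw [h1, Real.volume_Ioc, sub_zero, cdf, ofReal_measureReal]
    rfl

theorem quantile_mem (hX : IsLoss P X M) (hM : 0 < M) {t : ℝ} (ht : t ∈ Icc (0 : ℝ) 1) :
    quantile P X t ∈ Icc 0 M :=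
  ⟨quantile_nonneg t, (hX.quantile_mono hM ht (right_mem_Icc.2 zero_le_one) ht.2).trans_eq
    (hX.quantile_one hM)⟩

theorem integral_comp (hX : IsLoss P X M) (hM : 0 < M) {φ : ℝ → ℝ}
    (hφ : ContinuousOn φ (Icc 0 M)) :
    ∫ ω, φ (X ω) ∂P = ∫ t in (0 : ℝ)..1, φ (quantile P X t) := by
  have hF : AEMeasurable (quantile P X) (volume.restrict (Ioc (0 : ℝ) 1)) :=
    aemeasurable_restrict_of_monotoneOn measurableSet_Ioc
      ((hX.quantile_mono hM).mono Ioc_subset_Icc_self)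
  have hae : ∀ᵐ x ∂P.map X, x ∈ Icc 0 M :=
    (ae_map_iff hX.measurable.aemeasurable measurableSet_Icc).2 hX.support
  have hmeas : AEStronglyMeasurable φ (P.map X) := by
    rw [← Measure.restrict_eq_self_of_ae_mem hae]
    exact hφ.aestronglyMeasurable measurableSet_Icc
  rw [intervalIntegral.integral_of_le zero_le_one, ← integral_map hF
    (by rwa [hX.map_quantile hM]), hX.map_quantile hM,
    integral_map hX.measurable.aemeasurable hmeas]

/-- A level at which the quantile function is flat is an atom. -/
theorem atom_of_quantile_eq (hX : IsLoss P X M) (hM : 0 < M) {s t : ℝ} (hs : 0 ≤ s) (hst : s < t)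
    (ht : t ≤ 1) (h : quantile P X s = quantile P X t) : P {ω | X ω = quantile P X s} ≠ 0 := by
  have hF : AEMeasurable (quantile P X) (volume.restrict (Ioc (0 : ℝ) 1)) :=
    aemeasurable_restrict_of_monotoneOn measurableSet_Ioc
      ((hX.quantile_mono hM).mono Ioc_subset_Icc_self)
  have h1 : P {ω | X ω = quantile P X s} = P.map X {quantile P X s} :=
    (Measure.map_apply hX.measurable (measurableSet_singleton _)).symm
  rw [h1, ← hX.map_quantile hM, Measure.map_apply_of_aemeasurable hF (measurableSet_singleton _),
    Measure.restrict_apply' measurableSet_Ioc]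
  have hsub : Ioc s t ⊆ quantile P X ⁻¹' {quantile P X s} ∩ Ioc 0 1 := by
    intro r hr
    have hr' : r ∈ Icc (0 : ℝ) 1 := ⟨hs.trans hr.1.le, hr.2.trans ht⟩
    refine ⟨le_antisymm ?_ ?_, hs.trans_lt hr.1, hr'.2⟩
    · rw [h]
      exact hX.quantile_mono hM hr' ⟨hs.trans hst.le, ht⟩ hr.2
    · exact hX.quantile_mono hM ⟨hs, hst.le.trans ht⟩ hr' hr.1.le
  refine (lt_of_lt_of_le ?_ (measure_mono hsub)).ne'
  rw [Real.volume_Ioc]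
  simpa using hst

theorem quantile_pos_of_lt (hX : IsLoss P X M) (hM : 0 < M) {t : ℝ} (ht : t ≤ 1)
    (h : P.real {ω | X ω = 0} < t) : 0 < quantile P X t := by
  by_contra! h0
  have h1 := (hX.quantile_le_iff hM ht le_rfl).1 h0
  have h2 : cdf P X 0 = P.real {ω | X ω = 0} := by
    refine measureReal_congr ?_
    filter_upwards [hX.support] with ω hω
    exact propext ⟨fun hh => le_antisymm hh hω.1, fun hh => le_of_eq hh⟩
  linarith

end IsLoss

/-! ### Rank-dependent utility in quantile form -/

namespace IsIndemnity

variable {M : ℝ} {I : ℝ → ℝ}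

/-- The retention of an admissible indemnity satisfies the same constraints. -/
theorem retention (hI : IsIndemnity M I) : IsIndemnity M fun x => x - I x := by
  refine ⟨by simp [hI.1], fun x y hy hyx hx => ?_⟩
  have := hI.2 x y hy hyx hx
  constructor <;> linarith

theorem monotoneOn (hI : IsIndemnity M I) : MonotoneOn I (Icc 0 M) := fun x hx y hy hxy => by
  linarith [(hI.2 y x hx.1 hxy hy.2).1]

theorem nonneg (hI : IsIndemnity M I) {x : ℝ} (hx : x ∈ Icc 0 M) : 0 ≤ I x := by
  linarith [(hI.2 x 0 le_rfl hx.1 hx.2).1, hI.1]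

theorem le_self (hI : IsIndemnity M I) {x : ℝ} (hx : x ∈ Icc 0 M) : I x ≤ x := by
  linarith [(hI.2 x 0 le_rfl hx.1 hx.2).2, hI.1]

theorem lipschitzOnWith (hI : IsIndemnity M I) : LipschitzOnWith 1 I (Icc 0 M) := by
  refine LipschitzOnWith.of_dist_le_mul fun x hx y hy => ?_
  rw [NNReal.coe_one, one_mul, Real.dist_eq, Real.dist_eq]
  rcases le_total x y with h | h
  · have := hI.2 y x hx.1 h hy.2
    rw [abs_sub_comm, abs_sub_comm x y, abs_of_nonneg this.1, abs_of_nonneg (sub_nonneg.2 h)]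
    exact this.2
  · have := hI.2 x y hy.1 h hx.2
    rw [abs_of_nonneg this.1, abs_of_nonneg (sub_nonneg.2 h)]
    exact this.2

theorem continuousOn (hI : IsIndemnity M I) : ContinuousOn I (Icc 0 M) :=
  hI.lipschitzOnWith.continuousOn

end IsIndemnity

/-- An upward closed subset of `(0, 1]` is an interval with endpoint `1`, up to a null set. -/
theorem ae_eq_Ioc_of_upward_closed {A : Set ℝ} (hA : A ⊆ Ioc 0 1)
    (hup : ∀ s ∈ A, ∀ t, s ≤ t → t ≤ 1 → t ∈ A) :
    A =ᵐ[volume] Ioc (1 - volume.real A) 1 := by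
  obtain ⟨s, hs, hae⟩ : ∃ s ∈ Icc (0 : ℝ) 1, A =ᵐ[volume] Ioc s 1 := by
    rcases A.eq_empty_or_nonempty with rfl | hne
    · exact ⟨1, ⟨zero_le_one, le_rfl⟩, by simp⟩
    · have hbdd : BddBelow A := ⟨0, fun x hx => (hA hx).1.le⟩
      obtain ⟨x, hx⟩ := hne
      refine ⟨sInf A, ⟨le_csInf ⟨x, hx⟩ fun y hy => (hA hy).1.le,
        (csInf_le hbdd hx).trans (hA hx).2⟩, ?_⟩
      refine Filter.EventuallyEq.symm ?_
      refine (LE.le.eventuallyLE fun t ht => ?_).antisymm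
        ((LE.le.eventuallyLE fun t ht => ?_ : A ≤ᵐ[volume] Icc (sInf A) 1).trans
          Ioc_ae_eq_Icc.symm.le)
      · obtain ⟨y, hy, hyt⟩ := exists_lt_of_csInf_lt ⟨x, hx⟩ ht.1
        exact hup y hy t hyt.le ht.2
      · exact ⟨csInf_le hbdd ht, (hA ht).2⟩
  have : volume.real A = 1 - s := by
    rw [measureReal_congr hae, Real.volume_real_Ioc_of_le hs.2]
  rw [this, sub_sub_cancel]
  exact hae

section RDU

variable {Ω : Type*} [MeasurableSpace Ω] {P : Measure Ω} [IsProbabilityMeasure P]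
  {X : Ω → ℝ} {M b : ℝ} {u T : ℝ → ℝ}

/-- The measure on `(0, 1]` with distribution function `T`. -/
noncomputable def weightMeasure (T : ℝ → ℝ) : Measure ℝ :=
  (volume.restrict (Ioc (0 : ℝ) 1)).withDensity fun t => ENNReal.ofReal (deriv T t)

theorem weightMeasure_Ioc (hT : IsInverseS T b) {s : ℝ} (hs : s ∈ Icc (0 : ℝ) 1) :
    weightMeasure T (Ioc s 1) = ENNReal.ofReal (1 - T s) := by
  have hae : ∀ᵐ t ∂volume.restrict (Ioc s 1), 0 ≤ deriv T t := by
    rw [← Measure.restrict_congr_set Ioo_ae_eq_Ioc]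
    exact ae_restrict_of_forall_mem measurableSet_Ioo fun t ht =>
      hT.deriv_nonneg ⟨hs.1.trans_lt ht.1, ht.2⟩
  have hint := hT.intervalIntegrable_deriv hs (right_mem_Icc.2 zero_le_one)
  rw [weightMeasure, withDensity_apply _ measurableSet_Ioc,
    Measure.restrict_restrict measurableSet_Ioc,
    inter_eq_left.2 (Ioc_subset_Ioc_left hs.1), ← ofReal_integral_eq_lintegral_ofReal
      ((intervalIntegrable_iff_integrableOn_Ioc_of_le hs.2).1 hint) hae,
    ← intervalIntegral.integral_of_le hs.2,
    hT.integral_deriv hs (right_mem_Icc.2 zero_le_one) hs.2, hT.map_one]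

theorem weightMeasure_absolutelyContinuous (T : ℝ → ℝ) :
    weightMeasure T ≪ volume.restrict (Ioc (0 : ℝ) 1) := withDensity_absolutelyContinuous _ _

/-- The rank-dependent utility of the final wealth, as an integral over the rank of the loss. -/
theorem rdu_eq_integral (hX : IsLoss P X M) (hM : 0 < M) (hT : IsInverseS T b)
    (hu : IsUtility u) {I : ℝ → ℝ} (hI : IsIndemnity M I) {w : ℝ} (hw : M ≤ w) :
    rdu P u T (fun ω => w - X ω + I (X ω)) =
      ∫ t in (0 : ℝ)..1, u (w - (quantile P X t - I (quantile P X t))) * deriv T t := by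
  set F := quantile P X with hF
  set Y : Ω → ℝ := fun ω => w - X ω + I (X ω) with hY
  have hR := hI.retention
  have hg : AntitoneOn (fun t => w - (F t - I (F t))) (Icc 0 1) := fun s hs t ht hst =>
    sub_le_sub_left (hR.monotoneOn (hX.quantile_mem hM hs) (hX.quantile_mem hM ht)
      (hX.quantile_mono hM hs ht hst)) w
  have hgm : AEMeasurable (fun t => w - (F t - I (F t))) (volume.restrict (Ioc (0 : ℝ) 1)) :=
    aemeasurable_restrict_of_antitoneOn measurableSet_Ioc (hg.mono Ioc_subset_Icc_self)
  have hFm : AEMeasurable F (volume.restrict (Ioc (0 : ℝ) 1)) :=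
    aemeasurable_restrict_of_monotoneOn measurableSet_Ioc
      ((hX.quantile_mono hM).mono Ioc_subset_Icc_self)
  have hYm : AEMeasurable Y P := by
    have hae : ∀ᵐ x ∂P.map X, x ∈ Icc 0 M :=
      (ae_map_iff hX.measurable.aemeasurable measurableSet_Icc).2 hX.support
    have hIm : AEMeasurable I (P.map X) := by
      rw [← Measure.restrict_eq_self_of_ae_mem hae]
      exact aemeasurable_restrict_of_monotoneOn measurableSet_Icc hI.monotoneOn
    exact (hX.measurable.aemeasurable.const_sub w).add
      (hIm.comp_aemeasurable hX.measurable.aemeasurable)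
  -- Wealth is in fact nonnegative; any strict lower bound makes the Stieltjes function equal to -1
  -- near -∞.
  have hYpos : ∀ᵐ ω ∂P, -1 < Y ω := by
    filter_upwards [hX.support] with ω hω
    have := hI.nonneg hω
    simp only [hY]
    linarith [hω.2]
  have h01 : ∀ y, 1 - cdf P Y y ∈ Icc (0 : ℝ) 1 := fun y =>
    ⟨by linarith [cdf_le_one (P := P) Y y], by linarith [cdf_nonneg (P := P) Y y]⟩
  have hmono : Monotone fun x => -T (1 - cdf P Y x) := fun x y hxy =>
    neg_le_neg (hT.strictMonoOn.monotoneOn (h01 y) (h01 x)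
      (sub_le_sub_left (cdf_mono Y hxy) 1))
  have hst : ∀ x, hmono.stieltjesFunction x = -T (1 - cdf P Y x) := fun x => by
    rw [hmono.stieltjesFunction_eq]
    refine ContinuousWithinAt.rightLim_eq ?_
    refine ContinuousWithinAt.neg ?_
    have h2 : ContinuousWithinAt (fun y => 1 - cdf P Y y) (Ici x) x :=
      continuousWithinAt_const.sub (cdf_rightContinuous hYm x)
    exact ContinuousWithinAt.comp (g := T) (t := Icc 0 1) (hT.continuousOn _ (h01 x)) h2
      fun y _ => h01 y
  -- Wealth decreases with the rank of the loss. Hence wealth is at most y on a tail of ranks which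
  -- is (1 - F_Y(y), 1] up to a null set, and both measures give it mass 1 - T(1 - F_Y(y)).
  have hmeas : hmono.stieltjesFunction.measure =
      (weightMeasure T).map (fun t => w - (F t - I (F t))) := by
    have hgm' := hgm.mono_ac (weightMeasure_absolutelyContinuous T)
    have hlim : Tendsto hmono.stieltjesFunction atBot (𝓝 (-1)) := by
      refine tendsto_const_nhds.congr' ?_
      filter_upwards [Iic_mem_atBot (-1 : ℝ)] with x hx
      rw [hst, cdf_of_ae_lt (hYpos.mono fun ω h => lt_of_le_of_lt hx h), sub_zero, hT.map_one]
    have hfin : IsFiniteMeasure hmono.stieltjesFunction.measure := by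
      refine StieltjesFunction.isFiniteMeasure _ hlim (u := 0) ?_
      refine tendsto_const_nhds.congr' ?_
      filter_upwards [Ici_mem_atTop w] with x hx
      rw [hst, cdf_of_ae_le, sub_self, hT.map_zero, neg_zero]
      filter_upwards [hX.support] with ω hω
      have := hI.le_self hω
      simp only [hY]
      linarith [mem_Ici.1 hx]
    refine Measure.ext_of_Iic _ _ fun y => ?_
    rw [StieltjesFunction.measure_Iic _ hlim, hst,
      Measure.map_apply_of_aemeasurable hgm' measurableSet_Iic]
    set A : Set ℝ := {t ∈ Ioc (0 : ℝ) 1 | w - (F t - I (F t)) ≤ y} with hA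
    have hAup : ∀ s ∈ A, ∀ t, s ≤ t → t ≤ 1 → t ∈ A := fun s hs t hst ht =>
      ⟨⟨hs.1.1.trans_le hst, ht⟩, (hg ⟨hs.1.1.le, hs.1.2⟩
        ⟨hs.1.1.le.trans hst, ht⟩ hst).trans hs.2⟩
    have hAc : volume.real A = cdf P Y y := by
      have hB : MeasurableSet {x ∈ Icc 0 M | w - (x - I x) ≤ y} := by
        refine Set.OrdConnected.measurableSet ⟨fun p hp q hq r hr => ?_⟩
        have hr' : r ∈ Icc 0 M := ⟨hp.1.1.trans hr.1, hr.2.trans hq.1.2⟩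
        have h2 : p - I p ≤ r - I r := hR.monotoneOn hp.1 hr' hr.1
        have h3 := hp.2
        exact ⟨hr', by linarith⟩
      have h1 : cdf P Y y = (P.map X).real {x ∈ Icc 0 M | w - (x - I x) ≤ y} := by
        rw [map_measureReal_apply hX.measurable hB]
        refine measureReal_congr ?_
        filter_upwards [hX.support] with ω hω
        refine propext ⟨fun h => ⟨hω, ?_⟩, fun h => ?_⟩
        · have : w - X ω + I (X ω) ≤ y := h
          linarith
        · have : w - (X ω - I (X ω)) ≤ y := h.2
          show w - X ω + I (X ω) ≤ y
          linarith
      rw [h1, ← hX.map_quantile hM, measureReal_def, measureReal_def,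
        Measure.map_apply_of_aemeasurable hFm hB, Measure.restrict_apply' measurableSet_Ioc]
      congr 2
      ext t
      constructor
      · rintro ⟨h1, h2⟩
        exact ⟨⟨hX.quantile_mem hM ⟨h1.1.le, h1.2⟩, h2⟩, h1⟩
      · rintro ⟨h1, h2⟩
        exact ⟨h2, h1.2⟩
    have hAae := ae_eq_Ioc_of_upward_closed (fun t ht => ht.1 : A ⊆ Ioc 0 1) hAup
    rw [hAc] at hAae
    have h1 : weightMeasure T ((fun t => w - (F t - I (F t))) ⁻¹' Iic y) =
        weightMeasure T A := by
      refine measure_congr ((weightMeasure_absolutelyContinuous T).ae_le ?_)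
      filter_upwards [ae_restrict_mem measurableSet_Ioc] with t ht
      exact propext ⟨fun h => ⟨ht, h⟩, fun h => h.2⟩
    rw [h1, measure_congr (((weightMeasure_absolutelyContinuous T).trans
      Measure.restrict_le_self.absolutelyContinuous).ae_le hAae), weightMeasure_Ioc hT (h01 y)]
    congr 1
    ring
  rw [rdu, dif_pos hmono, hmeas]
  have hgm' := hgm.mono_ac (weightMeasure_absolutelyContinuous T)
  have hmem : ∀ᵐ x ∂(weightMeasure T).map (fun t => w - (F t - I (F t))), x ∈ Ici (0 : ℝ) := by
    refine (ae_map_iff hgm' (measurableSet_Ici (a := (0 : ℝ)))).2 ?_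
    refine (weightMeasure_absolutelyContinuous T).ae_le ?_
    filter_upwards [ae_restrict_mem measurableSet_Ioc] with t ht
    have h1 := hX.quantile_mem hM ⟨ht.1.le, ht.2⟩
    have := hI.nonneg h1
    show (0 : ℝ) ≤ w - (F t - I (F t))
    linarith [h1.2]
  have hum : AEStronglyMeasurable u ((weightMeasure T).map (fun t => w - (F t - I (F t)))) := by
    rw [← Measure.restrict_eq_self_of_ae_mem hmem]
    exact (aemeasurable_restrict_of_monotoneOn measurableSet_Ici
      hu.strictMonoOn.monotoneOn).aestronglyMeasurable
  rw [Measure.restrict_eq_self_of_ae_mem hmem, integral_map hgm' hum, weightMeasure,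
    integral_withDensity_eq_integral_toReal_smul (measurable_deriv T).ennreal_ofReal (by simp),
    intervalIntegral.integral_of_le zero_le_one,
    ← Measure.restrict_congr_set (Ioo_ae_eq_Ioc (μ := volume) (a := (0 : ℝ)) (b := 1))]
  refine setIntegral_congr_fun measurableSet_Ioo fun t ht => ?_
  simp only [smul_eq_mul]
  rw [ENNReal.toReal_ofReal (hT.deriv_nonneg ht), mul_comm]

end RDU

/-! ### The data of the problem in quantile form -/

/-- The standing assumptions, expressed through the quantile function `F` of the loss. -/
structure InsuranceData (u T F : ℝ → ℝ) (M b W : ℝ) : Prop where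
  M_pos : 0 < M
  zero : F 0 = 0
  one : F 1 = M
  mono : MonotoneOn F (Icc 0 1)
  ac : AbsolutelyContinuousOnInterval F 0 1
  weighting : IsInverseS T b
  utility : IsUtility u
  dara : StrictAntiOn (arrowPratt u) (Ioi 0)
  risk : ∀ z ∈ Ioc 0 (aPt T), DifferentiableAt ℝ F z →
    arrowPratt u (W - F z) * deriv F z < arrowPratt T z
  wealth : M ≤ W

namespace InsuranceData

variable {u T F : ℝ → ℝ} {M b W : ℝ}

theorem continuousOn (H : InsuranceData u T F M b W) : ContinuousOn F (Icc 0 1) := by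
  have := H.ac.continuousOn
  rwa [uIcc_of_le zero_le_one] at this

theorem mem (H : InsuranceData u T F M b W) {t : ℝ} (ht : t ∈ Icc (0 : ℝ) 1) : F t ∈ Icc 0 M := by
  have h0 := H.mono (left_mem_Icc.2 zero_le_one) ht ht.1
  have h1 := H.mono ht (right_mem_Icc.2 zero_le_one) ht.2
  rw [H.zero] at h0
  rw [H.one] at h1
  exact ⟨h0, h1⟩

theorem deriv_nonneg (H : InsuranceData u T F M b W) {t : ℝ} (ht : t ∈ Ioo (0 : ℝ) 1) :
    0 ≤ deriv F t := by
  have h := (H.mono.mono Ioo_subset_Icc_self).derivWithin_nonneg (x := t)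
  rwa [derivWithin_of_mem_nhds (isOpen_Ioo.mem_nhds ht)] at h

/-- More wealth means less risk aversion. If F(z) = M, then W - F(z) may be 0, outside the domain of
A_u; but z is then a local maximum of F, so F'(z) = 0 and both products vanish. -/
theorem risk_of_le (H : InsuranceData u T F M b W) {w z : ℝ} (hw : W ≤ w) (hz : z ∈ Ioc 0 (aPt T))
    (hd : DifferentiableAt ℝ F z) (hpos : F z < w) :
    arrowPratt u (w - F z) * deriv F z < arrowPratt T z := by
  have ha := H.weighting.aPt_mem
  have hz1 : z ∈ Ioo (0 : ℝ) 1 := ⟨hz.1, hz.2.trans_lt ha.2⟩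
  refine lt_of_le_of_lt ?_ (H.risk z hz hd)
  rcases (H.mem (Ioo_subset_Icc_self hz1)).2.lt_or_eq with h | h
  · have h1 : 0 < W - F z := by linarith [H.wealth]
    exact mul_le_mul_of_nonneg_right (H.dara.antitoneOn h1 (sub_pos.2 hpos) (by linarith))
      (H.deriv_nonneg hz1)
  · have hmax : IsLocalMax F z := by
      filter_upwards [isOpen_Ioo.mem_nhds hz1] with t ht
      exact (H.mem (Ioo_subset_Icc_self ht)).2.trans_eq h.symm
    simp [hmax.deriv_eq_zero]

/-- The weighted marginal utility `u'(w - F) T'` decreases strictly on `(0, a]`. -/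
theorem strictAntiOn_marginal (H : InsuranceData u T F M b W) {w : ℝ} (hw : W ≤ w)
    (hpos : F (aPt T) < w) :
    StrictAntiOn (fun t => deriv u (w - F t) * deriv T t) (Ioc 0 (aPt T)) := by
  have hT := H.weighting
  have hu := H.utility
  have ha := hT.aPt_mem
  have hab := hT.aPt_spec.1.2
  intro s hs t ht hst
  have hsub : Icc s t ⊆ Ioc 0 (aPt T) := fun x hx => ⟨hs.1.trans_le hx.1, hx.2.trans ht.2⟩
  have hsub1 : Ioc 0 (aPt T) ⊆ Ioo (0 : ℝ) 1 := fun x hx => ⟨hx.1, hx.2.trans_lt ha.2⟩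
  have hFw : ∀ x ∈ Ioc 0 (aPt T), w - F (aPt T) ≤ w - F x := fun x hx =>
    sub_le_sub_left (H.mono (Ioo_subset_Icc_self (hsub1 hx)) (Ioo_subset_Icc_self ha) hx.2) w
  have hFpos : ∀ x ∈ Ioc 0 (aPt T), 0 < w - F x := fun x hx =>
    (sub_pos.2 hpos).trans_le (hFw x hx)
  have hTpos : ∀ x ∈ Ioc 0 (aPt T), 0 < deriv T x := fun x hx =>
    hT.deriv_pos (hsub1 hx) (hx.2.trans_lt hab).ne
  have hFac : AbsolutelyContinuousOnInterval F s t := H.ac.mono (by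
    rw [uIcc_of_le hst.le, uIcc_of_le zero_le_one]
    exact fun x hx => Ioo_subset_Icc_self (hsub1 (hsub hx)))
  -- F is only absolutely continuous, so log u'(w - F) and -log T' are compared through their a.e.
  -- derivatives, which are then integrated over [s,t].
  have hac : AbsolutelyContinuousOnInterval (fun x => Real.log (deriv u (w - F x))) s t := by
    have h1 : LipschitzOnWith 1 (fun y : ℝ => w - y) univ :=
      (LipschitzWith.of_dist_le_mul fun x y => by
        rw [Real.dist_eq, Real.dist_eq, abs_sub_comm x y]
        simp).lipschitzOnWith
    have h2 : AbsolutelyContinuousOnInterval (fun x => w - F x) s t :=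
      AbsolutelyContinuousOnInterval.lipschitzOnWith_comp hFac h1 fun _ _ => mem_univ _
    refine AbsolutelyContinuousOnInterval.lipschitzOnWith_comp (φ := fun y => Real.log (deriv u y)) h2
      (hu.lipschitzOnWith_log_deriv H.dara (sub_pos.2 hpos)) ?_
    rw [uIcc_of_le hst.le]
    exact fun x hx => hFw x (hsub hx)
  have hd2 : ∀ x ∈ Ioc 0 (aPt T), HasDerivAt (fun x => -Real.log (deriv T x))
      (arrowPratt T x) x := fun x hx => by
    have hd := (hT.differentiableOn_deriv.differentiableAt
      (isOpen_Ioo.mem_nhds (hsub1 hx))).hasDerivAt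
    exact (hd.log (hTpos x hx).ne').neg
  -- Nothing is assumed about integrability of T''; monotonicity of -log T' supplies integrability
  -- of its derivative.
  have hmono2 : MonotoneOn (fun x => -Real.log (deriv T x)) (uIcc s t) := by
    rw [uIcc_of_le hst.le]
    intro x hx y hy hxy
    refine neg_le_neg (Real.log_le_log (hTpos y (hsub hy)) ?_)
    exact hT.strictAntiOn_deriv.antitoneOn ⟨(hsub hx).1, (hsub hx).2.trans hab.le⟩
      ⟨(hsub hy).1, (hsub hy).2.trans hab.le⟩ hxy
  have hint2 := hmono2.intervalIntegrable_deriv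
  have h2 : ∫ x in s..t, deriv (fun x => -Real.log (deriv T x)) x =
      -Real.log (deriv T t) - -Real.log (deriv T s) := by
    refine intervalIntegral.integral_eq_sub_of_hasDerivAt_of_le hst.le
      (fun x hx => (hd2 x (hsub hx)).continuousAt.continuousWithinAt) (fun x hx => ?_) hint2
    exact (hd2 x (hsub (Ioo_subset_Icc_self hx))).differentiableAt.hasDerivAt
  have hlt : ∀ᵐ x ∂volume.restrict (Ioc s t), deriv (fun x => Real.log (deriv u (w - F x))) x <
      deriv (fun x => -Real.log (deriv T x)) x := by
    rw [ae_restrict_iff' measurableSet_Ioc]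
    filter_upwards [hFac.ae_differentiableAt] with x hx hxm
    have hxI : x ∈ Icc s t := Ioc_subset_Icc_self hxm
    have hxd := hx (by rwa [uIcc_of_le hst.le])
    have hx' := hsub hxI
    have h3 : HasDerivAt (fun x => Real.log (deriv u (w - F x)))
        (-arrowPratt u (w - F x) * -deriv F x) x :=
      HasDerivAt.comp (h₂ := fun y => Real.log (deriv u y)) x
        (hu.hasDerivAt_log_deriv (hFpos x hx')) (hxd.hasDerivAt.const_sub w)
    rw [h3.deriv, (hd2 x hx').deriv, neg_mul_neg]
    exact H.risk_of_le hw hx' hxd (by linarith [hFpos x hx'])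
  have h3 := intervalIntegral.integral_lt_integral_of_ae_le_of_measure_setOfPred_lt_ne_zero hst.le
    hac.intervalIntegrable_deriv hint2 (hlt.mono fun x hx => hx.le) (by
      have : volume.restrict (Ioc s t) {x | deriv (fun x => Real.log (deriv u (w - F x))) x <
          deriv (fun x => -Real.log (deriv T x)) x} = volume.restrict (Ioc s t) univ :=
        measure_congr (eventuallyEq_univ.2 hlt)
      rw [this, Measure.restrict_apply_univ, Real.volume_Ioc]
      simpa using hst)
  rw [hac.integral_deriv_eq_sub, h2] at h3
  have hus := hu.deriv_pos (hFpos s hs)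
  have hut := hu.deriv_pos (hFpos t ht)
  have hTs := hTpos s hs
  have hTt := hTpos t ht
  simp only
  rw [← Real.log_lt_log_iff (by positivity) (by positivity), Real.log_mul hut.ne' hTt.ne',
    Real.log_mul hus.ne' hTs.ne']
  linarith

end InsuranceData

/-! ### Layered retentions -/

/-- The loss retained under a threefold contract. -/
noncomputable def retention (x₂ x₁ x : ℝ) : ℝ := min (max (x - x₂) 0) (x₁ - x₂)

section Retention

variable {x₂ x₁ : ℝ}

theorem retention_of_le {x : ℝ} (h : x₂ ≤ x₁) (hx : x ≤ x₂) : retention x₂ x₁ x = 0 := by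
  rw [retention, max_eq_right (by linarith), min_eq_left (by linarith)]

theorem retention_of_mem {x : ℝ} (hx : x ∈ Icc x₂ x₁) : retention x₂ x₁ x = x - x₂ := by
  rw [retention, max_eq_left (by linarith [hx.1]), min_eq_left (by linarith [hx.2])]

theorem retention_of_ge {x : ℝ} (h : x₂ ≤ x₁) (hx : x₁ ≤ x) : retention x₂ x₁ x = x₁ - x₂ := by
  rw [retention, max_eq_left (by linarith), min_eq_right (by linarith)]

theorem retention_nonneg {x : ℝ} (h : x₂ ≤ x₁) : 0 ≤ retention x₂ x₁ x :=
  le_min (le_max_right _ _) (by linarith)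

theorem retention_le (x : ℝ) : retention x₂ x₁ x ≤ x₁ - x₂ := min_le_right _ _

theorem continuous_retention : Continuous fun p : ℝ × ℝ × ℝ => retention p.1 p.2.1 p.2.2 := by
  unfold retention
  fun_prop

theorem threefold_eq (h : x₂ ≤ x₁) (x : ℝ) : threefold x₂ x₁ x = x - retention x₂ x₁ x := by
  unfold threefold
  split_ifs with h1 h2
  · rw [retention_of_le h h1.le]; ring
  · rw [retention_of_mem ⟨not_lt.1 h1, h2.le⟩]; ring
  · rw [retention_of_ge h (not_lt.1 h2)]; ring

theorem deductible_eq {x₁ x : ℝ} (hx : 0 ≤ x) : deductible x₁ x = threefold 0 x₁ x := by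
  simp [deductible, threefold, hx.not_gt]

theorem isIndemnity_retention (M : ℝ) (h : x₂ ≤ x₁) (h0 : 0 ≤ x₂) :
    IsIndemnity M (retention x₂ x₁) := by
  refine ⟨retention_of_le h h0, fun x y hy hyx hx => ?_⟩
  constructor
  · rw [sub_nonneg]
    exact min_le_min_right _ (max_le_max_right _ (by linarith))
  · have : max (x - x₂) 0 ≤ max (y - x₂) 0 + (x - y) :=
      max_le (by linarith [le_max_left (y - x₂) 0]) (by linarith [le_max_right (y - x₂) 0])
    have h2 : retention x₂ x₁ x ≤ retention x₂ x₁ y + (x - y) := by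
      rw [retention, retention, ← min_add_add_right]
      exact min_le_min this (by linarith)
    linarith

end Retention

/-- Integration by parts: a sign condition on the tail integrals of `q` against the derivative
of `D`. -/
theorem integral_mul_nonpos_of_tail {q D : ℝ → ℝ} (hq : IntervalIntegrable q volume 0 1)
    (hD : AbsolutelyContinuousOnInterval D 0 1) (hD0 : D 0 = 0)
    (h : ∀ᵐ t, t ∈ Ioc (0 : ℝ) 1 → (∫ s in t..1, q s) * deriv D t ≤ 0) :
    ∫ t in (0 : ℝ)..1, q t * D t ≤ 0 := by
  have h0 : (0 : ℝ) ∈ uIcc (0 : ℝ) 1 := left_mem_uIcc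
  have hΨ := hq.absolutelyContinuousOnInterval_intervalIntegral h0
  have hparts := hΨ.integral_mul_deriv_eq_deriv_mul hD
  have hderiv : ∫ x in (0 : ℝ)..1, deriv (fun x => ∫ v in (0 : ℝ)..x, q v) x * D x =
      ∫ x in (0 : ℝ)..1, q x * D x := by
    refine intervalIntegral.integral_congr_ae ?_
    filter_upwards [hq.ae_hasDerivAt_integral] with x hx hxm
    rw [(hx (uIoc_subset_uIcc hxm) 0 h0).deriv]
  rw [hderiv, hD0, mul_zero, sub_zero] at hparts
  have hD1 := hD.integral_deriv_eq_sub
  rw [hD0, sub_zero] at hD1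
  have hDi := hD.intervalIntegrable_deriv
  have hΨi : IntervalIntegrable (fun x => (∫ v in (0 : ℝ)..x, q v) * deriv D x) volume 0 1 :=
    hDi.continuousOn_mul hΨ.continuousOn
  -- The boundary term is the full integral of q times D(1) = ∫ D'; absorbing it turns the primitive
  -- of q into its tail.
  have key : ∫ x in (0 : ℝ)..1, q x * D x =
      ∫ x in (0 : ℝ)..1, ((∫ v in (0 : ℝ)..1, q v) * deriv D x -
        (∫ v in (0 : ℝ)..x, q v) * deriv D x) := by
    rw [intervalIntegral.integral_sub (hDi.const_mul _) hΨi, intervalIntegral.integral_const_mul,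
      hD1, hparts]
    ring
  rw [key, intervalIntegral.integral_of_le zero_le_one]
  refine integral_nonpos_of_ae ?_
  rw [EventuallyLE, ae_restrict_iff' measurableSet_Ioc]
  filter_upwards [h] with t ht htm
  have hsub : ∫ s in t..1, q s = (∫ v in (0 : ℝ)..1, q v) - ∫ v in (0 : ℝ)..t, q v := by
    rw [intervalIntegral.integral_interval_sub_left hq]
    refine hq.mono_set ?_
    rw [uIcc_of_le htm.1.le, uIcc_of_le zero_le_one]
    exact Icc_subset_Icc_right htm.2
  have := ht htm
  rw [hsub] at this
  simp only [Pi.zero_apply]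
  linarith

theorem mul_deriv_nonpos_of_antitoneOn {D : ℝ → ℝ} {s : Set ℝ} {t m : ℝ} (hs : s ∈ 𝓝 t)
    (hD : AntitoneOn D s) (hm : 0 ≤ m) : m * deriv D t ≤ 0 := by
  have h := hD.derivWithin_nonpos (x := t)
  rw [derivWithin_of_mem_nhds hs] at h
  exact mul_nonpos_of_nonneg_of_nonpos hm h

theorem mul_deriv_nonpos_of_monotoneOn {D : ℝ → ℝ} {s : Set ℝ} {t m : ℝ} (hs : s ∈ 𝓝 t)
    (hD : MonotoneOn D s) (hm : m ≤ 0) : m * deriv D t ≤ 0 := by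
  have h := hD.derivWithin_nonneg (x := t)
  rw [derivWithin_of_mem_nhds hs] at h
  exact mul_nonpos_of_nonpos_of_nonneg hm h

/-! ### Integrability of marginal utilities and a closed form of ψ -/

namespace InsuranceData

variable {u T F : ℝ → ℝ} {M b W : ℝ}

theorem continuousOn_deriv_utility (H : InsuranceData u T F M b W) {G : ℝ → ℝ} {s : Set ℝ}
    (hG : ContinuousOn G s) (hpos : ∀ t ∈ s, 0 < G t) :
    ContinuousOn (fun t => deriv u (G t)) s :=
  H.utility.differentiableOn_deriv.continuousOn.comp hG hpos

theorem intervalIntegrable_mul (H : InsuranceData u T F M b W) {k : ℝ → ℝ} {p q : ℝ}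
    (hp : p ∈ Icc (0 : ℝ) 1) (hq : q ∈ Icc (0 : ℝ) 1) (hk : ContinuousOn k (uIcc p q)) :
    IntervalIntegrable (fun t => k t * deriv T t) volume p q :=
  (H.weighting.intervalIntegrable_deriv hp hq).continuousOn_mul hk

theorem intervalIntegrable_marginal (H : InsuranceData u T F M b W) {p q y : ℝ}
    (hp : 0 ≤ p) (hpq : p ≤ q) (hq : q ≤ 1) (hy : F q < y) :
    IntervalIntegrable (fun t => deriv u (y - F t) * deriv T t) volume p q := by
  have hsub : Icc p q ⊆ Icc (0 : ℝ) 1 := Icc_subset_Icc hp hq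
  refine H.intervalIntegrable_mul (hsub (left_mem_Icc.2 hpq)) (hsub (right_mem_Icc.2 hpq)) ?_
  rw [uIcc_of_le hpq]
  refine H.continuousOn_deriv_utility (continuousOn_const.sub (H.continuousOn.mono hsub)) ?_
  intro t ht
  linarith [H.mono (hsub ht) (hsub (right_mem_Icc.2 hpq)) ht.2]

theorem psiFun_eq (H : InsuranceData u T F M b W) {w z₂ z₁ : ℝ} (h0 : 0 ≤ z₂) (h21 : z₂ ≤ z₁)
    (h1 : z₁ < 1) (hpos : F z₁ < w + F z₂) :
    psiFun u T F w z₂ z₁ = deriv u (w + F z₂ - F z₁) * tailRatio T z₁ * (z₁ - z₂) -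
      ∫ t in z₂..z₁, deriv u (w + F z₂ - F t) * deriv T t := by
  have hint := H.intervalIntegrable_marginal h0 h21 h1.le hpos
  have h : psiFun u T F w z₂ z₁ = ∫ t in z₂..z₁, (deriv u (w + F z₂ - F z₁) * tailRatio T z₁ -
      deriv u (w + F z₂ - F t) * deriv T t) := by
    unfold psiFun tailRatio
    refine intervalIntegral.integral_congr fun t _ => ?_
    rw [show w - F z₁ + F z₂ = w + F z₂ - F z₁ by ring,
      show w - F t + F z₂ = w + F z₂ - F t by ring, mul_div_assoc]
  rw [h, intervalIntegral.integral_sub intervalIntegrable_const hint,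
    intervalIntegral.integral_const, smul_eq_mul]
  ring

theorem hFun_eq_psiFun (H : InsuranceData u T F M b W) (w z : ℝ) :
    hFun u T F w z = psiFun u T F w 0 z := by
  simp [hFun, psiFun, H.zero]

end InsuranceData

/-! ### Sufficiency of the first-order conditions -/

theorem intervalIntegral_nonpos {f : ℝ → ℝ} {p q : ℝ} (hpq : p ≤ q)
    (h : ∀ t ∈ Icc p q, f t ≤ 0) : ∫ t in p..q, f t ≤ 0 := by
  have := intervalIntegral.integral_nonneg (μ := volume) (f := fun t => -f t) hpq
    fun t ht => neg_nonneg.2 (h t ht)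
  rw [intervalIntegral.integral_neg] at this
  linarith

/-- The first-order conditions for a threefold contract with layer `[F z₂, F z₁]`. -/
structure IsCandidate (u T F : ℝ → ℝ) (W w z₂ z₁ : ℝ) : Prop where
  nonneg : 0 ≤ z₂
  le_a : z₂ ≤ aPt T
  a_le : aPt T ≤ z₁
  lt_one : z₁ < 1
  wealth : W ≤ w
  pos : F z₁ < w + F z₂
  psi_nonneg : 0 ≤ psiFun u T F w z₂ z₁
  slack : z₂ = 0 ∨ psiFun u T F w z₂ z₁ = 0 ∧ (z₂ < aPt T ∨ z₁ = aPt T)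

namespace InsuranceData

variable {u T F : ℝ → ℝ} {M b W w z₂ z₁ : ℝ}

/-- The multiplier of the participation constraint. -/
noncomputable def multiplier (u T F : ℝ → ℝ) (w z₂ z₁ : ℝ) : ℝ :=
  deriv u (w + F z₂ - F z₁) * tailRatio T z₁

/-- Beyond a, T'(t) is at most the tail ratio at t, hence at z₁, while u' is largest at the smallest
wealth, that of rank z₁. -/
theorem marginal_le_multiplier (H : InsuranceData u T F M b W) (ha : aPt T ≤ z₁) (h1 : z₁ < 1)
    (hpos : F z₁ < w + F z₂) {t : ℝ} (ht : t ∈ Icc (aPt T) z₁) :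
    deriv u (w + F z₂ - F t) * deriv T t ≤ multiplier u T F w z₂ z₁ := by
  have hT := H.weighting
  have ha0 := hT.aPt_mem
  have ht1 : t ∈ Ico (aPt T) 1 := ⟨ht.1, ht.2.trans_lt h1⟩
  have ht01 : t ∈ Icc (0 : ℝ) 1 := ⟨ha0.1.le.trans ht.1, ht1.2.le⟩
  have hF : F t ≤ F z₁ := H.mono ht01 ⟨ha0.1.le.trans ha, h1.le⟩ ht.2
  have h3 : deriv T t ≤ tailRatio T z₁ := (hT.deriv_le_tailRatio ht1).trans
    (hT.aPt_spec.2.2.1.monotoneOn ht1 ⟨ha, h1⟩ ht.2)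
  exact mul_le_mul (H.utility.deriv_le_deriv (by linarith) (by linarith)) h3
    (hT.deriv_nonneg ⟨ha0.1.trans_le ht.1, ht1.2⟩) (H.utility.deriv_pos (by linarith)).le

theorem mono' (H : InsuranceData u T F M b W) {s t : ℝ} (hs : 0 ≤ s) (hst : s ≤ t) (ht : t ≤ 1) :
    F s ≤ F t :=
  H.mono ⟨hs, hst.trans ht⟩ ⟨hs.trans hst, ht⟩ hst

theorem wealth_sub_retention_pos (hpos : F z₁ < w + F z₂) (x : ℝ) :
    0 < w - retention (F z₂) (F z₁) x := by
  linarith [retention_le (x₂ := F z₂) (x₁ := F z₁) x]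

theorem continuousOn_retention (H : InsuranceData u T F M b W) (x₂ x₁ : ℝ) :
    ContinuousOn (fun t => retention x₂ x₁ (F t)) (Icc 0 1) := by
  have h : Continuous fun x => retention x₂ x₁ x := by unfold retention; fun_prop
  exact h.comp_continuousOn H.continuousOn

/-- Marginal value of the retention at rank `t`, net of the multiplier. -/
noncomputable def netMarginal (u T F : ℝ → ℝ) (w z₂ z₁ t : ℝ) : ℝ :=
  deriv u (w - retention (F z₂) (F z₁) (F t)) * deriv T t - multiplier u T F w z₂ z₁

theorem intervalIntegrable_deriv_retention (H : InsuranceData u T F M b W)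
    (hpos : F z₁ < w + F z₂) {p q : ℝ} (hp : p ∈ Icc (0 : ℝ) 1) (hq : q ∈ Icc (0 : ℝ) 1) :
    IntervalIntegrable (fun t => deriv u (w - retention (F z₂) (F z₁) (F t)) * deriv T t)
      volume p q :=
  H.intervalIntegrable_mul hp hq (H.continuousOn_deriv_utility
    (continuousOn_const.sub ((H.continuousOn_retention _ _).mono (uIcc_subset_Icc hp hq)))
    fun _ _ => wealth_sub_retention_pos hpos _)

theorem intervalIntegrable_netMarginal (H : InsuranceData u T F M b W)
    (hpos : F z₁ < w + F z₂) {p q : ℝ} (hp : p ∈ Icc (0 : ℝ) 1) (hq : q ∈ Icc (0 : ℝ) 1) :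
    IntervalIntegrable (netMarginal u T F w z₂ z₁) volume p q :=
  (H.intervalIntegrable_deriv_retention hpos hp hq).sub intervalIntegrable_const

theorem integral_netMarginal_right (H : InsuranceData u T F M b W) (h0 : 0 ≤ z₂) (h21 : z₂ ≤ z₁)
    {t : ℝ} (ht : t ∈ Icc z₁ 1) :
    ∫ s in t..1, netMarginal u T F w z₂ z₁ s =
      deriv u (w + F z₂ - F z₁) * (1 - T t) - multiplier u T F w z₂ z₁ * (1 - t) := by
  have hT := H.weighting
  have ht1 : t ∈ Icc (0 : ℝ) 1 := ⟨h0.trans (h21.trans ht.1), ht.2⟩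
  have hone : (1 : ℝ) ∈ Icc (0 : ℝ) 1 := right_mem_Icc.2 zero_le_one
  have hcongr : ∫ s in t..1, netMarginal u T F w z₂ z₁ s =
      ∫ s in t..1, (deriv u (w + F z₂ - F z₁) * deriv T s - multiplier u T F w z₂ z₁) := by
    refine intervalIntegral.integral_congr fun s hs => ?_
    rw [uIcc_of_le ht.2] at hs
    rw [netMarginal, retention_of_ge (H.mono' h0 h21 (ht.1.trans ht.2))
      (H.mono' (h0.trans h21) (ht.1.trans hs.1) hs.2)]
    congr 3
    ring
  rw [hcongr, intervalIntegral.integral_sub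
      ((hT.intervalIntegrable_deriv ht1 hone).const_mul _) intervalIntegrable_const,
    intervalIntegral.integral_const_mul, hT.integral_deriv ht1 hone ht.2, hT.map_one,
    intervalIntegral.integral_const, smul_eq_mul]
  ring

/-- The multiplier is chosen for this: it is the mean of the marginal value over ranks above z₁. -/
theorem integral_netMarginal_z₁ (H : InsuranceData u T F M b W) (h0 : 0 ≤ z₂) (h21 : z₂ ≤ z₁)
    (h1 : z₁ < 1) : ∫ s in z₁..1, netMarginal u T F w z₂ z₁ s = 0 := by
  have h1' : 1 - z₁ ≠ 0 := by linarith
  rw [H.integral_netMarginal_right h0 h21 ⟨le_rfl, h1.le⟩, multiplier, tailRatio]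
  field_simp
  ring

theorem netMarginal_of_mem (H : InsuranceData u T F M b W) (h0 : 0 ≤ z₂) (h1 : z₁ ≤ 1) {t : ℝ}
    (ht : t ∈ Icc z₂ z₁) : netMarginal u T F w z₂ z₁ t =
      deriv u (w + F z₂ - F t) * deriv T t - multiplier u T F w z₂ z₁ := by
  rw [netMarginal, retention_of_mem ⟨H.mono' h0 ht.1 (ht.2.trans h1),
    H.mono' (h0.trans ht.1) ht.2 h1⟩]
  congr 3
  ring

theorem netMarginal_of_le (H : InsuranceData u T F M b W) (h21 : z₂ ≤ z₁) (h1 : z₁ ≤ 1) {t : ℝ}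
    (ht : t ∈ Icc 0 z₂) : netMarginal u T F w z₂ z₁ t =
      deriv u w * deriv T t - multiplier u T F w z₂ z₁ := by
  rw [netMarginal, retention_of_le (H.mono' (ht.1.trans ht.2) h21 h1)
    (H.mono' ht.1 ht.2 (h21.trans h1)), sub_zero]

/-- Since the tail vanishes at z₁, this identifies the tail integral at z₂ as -ψ. -/
theorem integral_netMarginal_layer (H : InsuranceData u T F M b W) (h0 : 0 ≤ z₂) (h21 : z₂ ≤ z₁)
    (h1 : z₁ < 1) (hpos : F z₁ < w + F z₂) :
    ∫ s in z₂..z₁, netMarginal u T F w z₂ z₁ s = -psiFun u T F w z₂ z₁ := by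
  have hint := H.intervalIntegrable_marginal h0 h21 h1.le hpos
  rw [H.psiFun_eq h0 h21 h1 hpos, intervalIntegral.integral_congr (g := fun t =>
    deriv u (w + F z₂ - F t) * deriv T t - multiplier u T F w z₂ z₁), intervalIntegral.integral_sub
    hint intervalIntegrable_const, intervalIntegral.integral_const, smul_eq_mul, multiplier]
  · ring
  · intro t ht
    rw [uIcc_of_le h21] at ht
    exact H.netMarginal_of_mem h0 h1.le ht

/-- The tail at t is u'(w + F(z₂) - F(z₁)) (1 - t) times the increase of the tail ratio from z₁ to
t. -/
theorem tail_nonneg_right (H : InsuranceData u T F M b W)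
    (C : IsCandidate u T F W w z₂ z₁) {t : ℝ} (ht : t ∈ Ioo z₁ 1) :
    0 ≤ ∫ s in t..1, netMarginal u T F w z₂ z₁ s := by
  have h21 := C.le_a.trans C.a_le
  rw [H.integral_netMarginal_right C.nonneg h21 ⟨ht.1.le, ht.2.le⟩, multiplier]
  have h := (H.weighting.aPt_spec.2.2.1 ⟨C.a_le, C.lt_one⟩ ⟨C.a_le.trans ht.1.le, ht.2⟩ ht.1).le
  have h1t : 0 < 1 - t := by linarith [ht.2]
  rw [tailRatio, tailRatio, le_div_iff₀ h1t] at h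
  rw [tailRatio]
  have hu := H.utility.deriv_pos (sub_pos.2 C.pos)
  nlinarith

theorem netMarginal_nonpos (H : InsuranceData u T F M b W)
    (C : IsCandidate u T F W w z₂ z₁) {t : ℝ} (ht : t ∈ Icc (aPt T) z₁) :
    netMarginal u T F w z₂ z₁ t ≤ 0 := by
  rw [H.netMarginal_of_mem C.nonneg C.lt_one.le ⟨C.le_a.trans ht.1, ht.2⟩]
  linarith [H.marginal_le_multiplier C.a_le C.lt_one C.pos ht]

theorem strictAntiOn_netMarginal (H : InsuranceData u T F M b W)
    (C : IsCandidate u T F W w z₂ z₁) :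
    StrictAntiOn (netMarginal u T F w z₂ z₁) (Icc z₂ (aPt T) ∩ Ioi 0) := by
  have ha := H.weighting.aPt_mem
  have hFa : F (aPt T) ≤ F z₁ := H.mono' ha.1.le C.a_le C.lt_one.le
  have hF2 : 0 ≤ F z₂ := (H.mem ⟨C.nonneg, C.le_a.trans ha.2.le⟩).1
  have h := H.strictAntiOn_marginal (w := w + F z₂) (by linarith [C.wealth])
    (by linarith [C.pos])
  intro s hs t ht hst
  rw [H.netMarginal_of_mem C.nonneg C.lt_one.le ⟨hs.1.1, hs.1.2.trans C.a_le⟩,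
    H.netMarginal_of_mem C.nonneg C.lt_one.le ⟨ht.1.1, ht.1.2.trans C.a_le⟩]
  exact sub_lt_sub_right (h ⟨hs.2, hs.1.2⟩ ⟨ht.2, ht.1.2⟩ hst) _

theorem tail_eq (H : InsuranceData u T F M b W)
    (C : IsCandidate u T F W w z₂ z₁) {t : ℝ} (ht : t ∈ Icc 0 z₁) :
    ∫ s in t..1, netMarginal u T F w z₂ z₁ s = ∫ s in t..z₁, netMarginal u T F w z₂ z₁ s := by
  have h1 : z₁ ∈ Icc (0 : ℝ) 1 := ⟨ht.1.trans ht.2, C.lt_one.le⟩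
  rw [← intervalIntegral.integral_add_adjacent_intervals
    (H.intervalIntegrable_netMarginal C.pos ⟨ht.1, ht.2.trans C.lt_one.le⟩ h1)
    (H.intervalIntegrable_netMarginal C.pos h1 (right_mem_Icc.2 zero_le_one)),
    H.integral_netMarginal_z₁ C.nonneg (C.le_a.trans C.a_le) C.lt_one, add_zero]

/-- If the net marginal is nonpositive at t, it stays so up to z₁: it decreases up to a and is
nonpositive after a. If it is positive at t, then t < a and it is positive on (z₂, t], so the tail
at t is at most the tail at z₂, which is -ψ ≤ 0. -/
theorem tail_nonpos_layer (H : InsuranceData u T F M b W)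
    (C : IsCandidate u T F W w z₂ z₁) {t : ℝ} (ht : t ∈ Ioo z₂ z₁) :
    ∫ s in t..1, netMarginal u T F w z₂ z₁ s ≤ 0 := by
  have h21 := C.le_a.trans C.a_le
  have ht0 : 0 < t := C.nonneg.trans_lt ht.1
  have ht1 : t ∈ Icc (0 : ℝ) 1 := ⟨ht0.le, ht.2.le.trans C.lt_one.le⟩
  have hz1 : z₁ ∈ Icc (0 : ℝ) 1 := ⟨C.nonneg.trans h21, C.lt_one.le⟩
  have hz2 : z₂ ∈ Icc (0 : ℝ) 1 := ⟨C.nonneg, h21.trans C.lt_one.le⟩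
  rw [H.tail_eq C ⟨ht0.le, ht.2.le⟩]
  have hright : (∀ s ∈ Icc t z₁, netMarginal u T F w z₂ z₁ s ≤ 0) →
      ∫ s in t..z₁, netMarginal u T F w z₂ z₁ s ≤ 0 := fun h =>
    intervalIntegral_nonpos ht.2.le h
  rcases le_or_gt (netMarginal u T F w z₂ z₁ t) 0 with h | h
  · refine hright fun s hs => ?_
    rcases le_or_gt (aPt T) s with has | has
    · exact H.netMarginal_nonpos C ⟨has, hs.2⟩
    · exact ((H.strictAntiOn_netMarginal C).antitoneOn
        ⟨⟨ht.1.le, hs.1.trans has.le⟩, ht0⟩ ⟨⟨ht.1.le.trans hs.1, has.le⟩, ht0.trans_le hs.1⟩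
        hs.1).trans h
  · have hta : t < aPt T := by
      by_contra! hta
      exact (H.netMarginal_nonpos C ⟨hta, ht.2.le⟩).not_gt h
    have hleft : 0 ≤ ∫ s in z₂..t, netMarginal u T F w z₂ z₁ s := by
      refine intervalIntegral.integral_nonneg_of_ae_restrict ht.1.le ?_
      rw [← Measure.restrict_congr_set Ioc_ae_eq_Icc]
      refine (ae_restrict_of_forall_mem measurableSet_Ioc fun s hs => ?_)
      have hs0 : 0 < s := C.nonneg.trans_lt hs.1
      exact h.le.trans ((H.strictAntiOn_netMarginal C).antitoneOn
        ⟨⟨hs.1.le, hs.2.trans hta.le⟩, hs0⟩ ⟨⟨ht.1.le, hta.le⟩, ht0⟩ hs.2)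
    have hsum := intervalIntegral.integral_add_adjacent_intervals
      (H.intervalIntegrable_netMarginal C.pos hz2 ht1)
      (H.intervalIntegrable_netMarginal C.pos ht1 hz1)
    rw [H.integral_netMarginal_layer C.nonneg h21 C.lt_one C.pos] at hsum
    linarith [C.psi_nonneg]

/-- For z₂ < a, a negative value at z₂ would make the net marginal negative on (z₂, a) and
nonpositive after a, contrary to ψ = 0. For z₂ = a the layer is empty and the value is 0, because
T'(a) is the tail ratio at a. -/
theorem netMarginal_z₂_nonneg (H : InsuranceData u T F M b W)
    (C : IsCandidate u T F W w z₂ z₁) (h0 : 0 < z₂) : 0 ≤ netMarginal u T F w z₂ z₁ z₂ := by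
  have h21 := C.le_a.trans C.a_le
  obtain ⟨hpsi, hor⟩ := C.slack.resolve_left h0.ne'
  rcases C.le_a.eq_or_lt with h2a | h2a
  · obtain rfl := (hor.resolve_left h2a.not_lt).trans h2a.symm
    rw [H.netMarginal_of_mem C.nonneg C.lt_one.le ⟨le_rfl, le_rfl⟩, multiplier, h2a,
      H.weighting.deriv_aPt, sub_self]
  by_contra! hneg
  have hle : ∀ s ∈ Icc (aPt T) z₁, netMarginal u T F w z₂ z₁ s ≤ 0 := fun s hs =>
    H.netMarginal_nonpos C hs
  have hlt : ∀ s ∈ Ioo z₂ (aPt T), 0 < -netMarginal u T F w z₂ z₁ s := fun s hs => by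
    have := H.strictAntiOn_netMarginal C ⟨⟨le_rfl, h2a.le⟩, h0⟩ ⟨⟨hs.1.le, hs.2.le⟩, h0.trans hs.1⟩
      hs.1
    linarith
  have hz1 : z₁ ∈ Icc (0 : ℝ) 1 := ⟨C.nonneg.trans h21, C.lt_one.le⟩
  have hz2 : z₂ ∈ Icc (0 : ℝ) 1 := ⟨C.nonneg, h21.trans C.lt_one.le⟩
  have ha := Ioo_subset_Icc_self H.weighting.aPt_mem
  have hi1 := H.intervalIntegrable_netMarginal C.pos hz2 ha
  have h3 := intervalIntegral.intervalIntegral_pos_of_pos_on hi1.neg hlt h2a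
  have h4 := intervalIntegral_nonpos C.a_le hle
  have hsum := intervalIntegral.integral_add_adjacent_intervals hi1
    (H.intervalIntegrable_netMarginal C.pos ha hz1)
  rw [H.integral_netMarginal_layer C.nonneg h21 C.lt_one C.pos, hpsi] at hsum
  simp only [Pi.neg_apply, intervalIntegral.integral_neg] at h3
  linarith

/-- The tail vanishes at z₂. To its left nothing is retained, so the net marginal is u'(w) T' - λ,
which decreases to its nonnegative value at z₂. -/
theorem tail_nonneg_left (H : InsuranceData u T F M b W)
    (C : IsCandidate u T F W w z₂ z₁) {t : ℝ} (ht : t ∈ Ioo 0 z₂) :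
    0 ≤ ∫ s in t..1, netMarginal u T F w z₂ z₁ s := by
  have hT := H.weighting
  have h21 := C.le_a.trans C.a_le
  have h0 : 0 < z₂ := ht.1.trans ht.2
  obtain ⟨hpsi, -⟩ := C.slack.resolve_left h0.ne'
  have hz1 : z₁ ∈ Icc (0 : ℝ) 1 := ⟨C.nonneg.trans h21, C.lt_one.le⟩
  have hz2 : z₂ ∈ Icc (0 : ℝ) 1 := ⟨C.nonneg, h21.trans C.lt_one.le⟩
  have ht1 : t ∈ Icc (0 : ℝ) 1 := ⟨ht.1.le, ht.2.le.trans hz2.2⟩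
  have hw : 0 < w := by linarith [H.M_pos, H.wealth, C.wealth]
  rw [H.tail_eq C ⟨ht.1.le, ht.2.le.trans h21⟩,
    ← intervalIntegral.integral_add_adjacent_intervals
    (H.intervalIntegrable_netMarginal C.pos ht1 hz2)
    (H.intervalIntegrable_netMarginal C.pos hz2 hz1),
    H.integral_netMarginal_layer C.nonneg h21 C.lt_one C.pos, hpsi, neg_zero, add_zero]
  refine intervalIntegral.integral_nonneg ht.2.le fun s hs => ?_
  have hs0 : 0 < s := ht.1.trans_le hs.1
  have h2 := H.netMarginal_z₂_nonneg C h0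
  rw [H.netMarginal_of_le h21 C.lt_one.le ⟨h0.le, le_rfl⟩] at h2
  rw [H.netMarginal_of_le h21 C.lt_one.le ⟨hs0.le, hs.2⟩]
  have hb := hT.aPt_spec.1.2.le
  have h3 : deriv T z₂ ≤ deriv T s := hT.strictAntiOn_deriv.antitoneOn
    ⟨hs0, hs.2.trans (C.le_a.trans hb)⟩ ⟨h0, C.le_a.trans hb⟩ hs.2
  nlinarith [H.utility.deriv_pos hw]

/-! ### Comparison of a candidate layer with arbitrary retentions -/

theorem mapsTo (H : InsuranceData u T F M b W) : MapsTo F (uIcc 0 1) (Icc 0 M) := by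
  rw [uIcc_of_le zero_le_one]
  exact fun t ht => H.mem ht

theorem surjOn (H : InsuranceData u T F M b W) : SurjOn F (Icc 0 1) (Icc 0 M) := by
  have h := intermediate_value_Icc zero_le_one H.continuousOn
  rwa [H.zero, H.one] at h

theorem continuousOn_comp (H : InsuranceData u T F M b W) {R : ℝ → ℝ} (hR : IsIndemnity M R) :
    ContinuousOn (fun t => R (F t)) (Icc 0 1) :=
  hR.continuousOn.comp H.continuousOn fun _ ht => H.mem ht

theorem intervalIntegrable_utility (H : InsuranceData u T F M b W) {R : ℝ → ℝ}
    (hR : IsIndemnity M R) (hw : M ≤ w) :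
    IntervalIntegrable (fun t => u (w - R (F t)) * deriv T t) volume 0 1 := by
  have hT := H.weighting
  have hmem : ∀ t ∈ Icc (0 : ℝ) 1, 0 ≤ w - R (F t) ∧ w - R (F t) ≤ w := fun t ht => by
    have h1 := H.mem ht
    have := hR.le_self h1
    have := hR.nonneg h1
    exact ⟨by linarith [h1.2], by linarith⟩
  have hanti : AntitoneOn (fun t => u (w - R (F t))) (Icc 0 1) := fun s hs t ht hst =>
    H.utility.strictMonoOn.monotoneOn (hmem t ht).1 (hmem s hs).1
      (sub_le_sub_left (hR.monotoneOn (H.mem hs) (H.mem ht) (H.mono hs ht hst)) w)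
  have hi := hT.intervalIntegrable_deriv (left_mem_Icc.2 zero_le_one) (right_mem_Icc.2 zero_le_one)
  rw [intervalIntegrable_iff_integrableOn_Ioc_of_le zero_le_one] at hi ⊢
  refine Integrable.bdd_mul (c := u w) hi (aemeasurable_restrict_of_antitoneOn measurableSet_Ioc
    (hanti.mono Ioc_subset_Icc_self)).aestronglyMeasurable ?_
  refine ae_restrict_of_forall_mem measurableSet_Ioc fun t ht => ?_
  have h := hmem t (Ioc_subset_Icc_self ht)
  rw [Real.norm_of_nonneg (H.utility.nonneg _ h.1)]
  exact H.utility.strictMonoOn.monotoneOn h.1 (h.1.trans h.2) h.2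

/-- Bang-bang principle: outside the layer G∘F is constant and (G - R)∘F decreases where the tail is
nonnegative; inside it G has slope 1, so (G - R)∘F increases where the tail is nonpositive. -/
theorem integral_netMarginal_mul_nonpos (H : InsuranceData u T F M b W)
    (C : IsCandidate u T F W w z₂ z₁) {R : ℝ → ℝ} (hR : IsIndemnity M R) :
    ∫ t in (0 : ℝ)..1, netMarginal u T F w z₂ z₁ t *
      (retention (F z₂) (F z₁) (F t) - R (F t)) ≤ 0 := by
  have h21 := C.le_a.trans C.a_le
  have hF21 := H.mono' C.nonneg h21 C.lt_one.le
  have hF2 : 0 ≤ F z₂ := (H.mem ⟨C.nonneg, h21.trans C.lt_one.le⟩).1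
  have hG := isIndemnity_retention M hF21 hF2
  refine integral_mul_nonpos_of_tail
    (H.intervalIntegrable_netMarginal C.pos (left_mem_Icc.2 zero_le_one)
      (right_mem_Icc.2 zero_le_one)) ?_ ?_ ?_
  · exact (AbsolutelyContinuousOnInterval.lipschitzOnWith_comp H.ac hG.lipschitzOnWith
      H.mapsTo).fun_sub (AbsolutelyContinuousOnInterval.lipschitzOnWith_comp H.ac
        hR.lipschitzOnWith H.mapsTo)
  · rw [H.zero, hG.1, hR.1, sub_zero]
  · have hne : ∀ x : ℝ, ∀ᵐ t : ℝ, t ≠ x := fun x => by simp [ae_iff, measure_singleton]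
    filter_upwards [hne z₂, hne z₁, hne 1] with t ht2 ht1 htone ht
    rcases lt_or_gt_of_ne ht2 with hlt2 | hgt2
    · refine mul_deriv_nonpos_of_antitoneOn (Ioo_mem_nhds ht.1 hlt2) ?_
        (H.tail_nonneg_left C ⟨ht.1, hlt2⟩)
      intro r hr s hs hrs
      have hz : z₂ ≤ 1 := h21.trans C.lt_one.le
      simp only
      rw [retention_of_le hF21 (H.mono' hr.1.le hr.2.le hz),
        retention_of_le hF21 (H.mono' hs.1.le hs.2.le hz)]
      exact sub_le_sub_left (hR.monotoneOn (H.mem ⟨hr.1.le, hr.2.le.trans hz⟩)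
        (H.mem ⟨hs.1.le, hs.2.le.trans hz⟩) (H.mono' hr.1.le hrs (hs.2.le.trans hz))) _
    · rcases lt_or_gt_of_ne ht1 with hlt1 | hgt1
      · refine mul_deriv_nonpos_of_monotoneOn (Ioo_mem_nhds hgt2 hlt1) ?_
          (H.tail_nonpos_layer C ⟨hgt2, hlt1⟩)
        intro r hr s hs hrs
        have hr0 : 0 ≤ r := C.nonneg.trans hr.1.le
        have hs1 : s ≤ 1 := hs.2.le.trans C.lt_one.le
        have hFrs := H.mono' hr0 hrs hs1
        simp only
        rw [retention_of_mem ⟨H.mono' C.nonneg hr.1.le (hrs.trans hs1),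
            H.mono' hr0 hr.2.le C.lt_one.le⟩,
          retention_of_mem ⟨H.mono' C.nonneg hs.1.le hs1,
            H.mono' (hr0.trans hrs) hs.2.le C.lt_one.le⟩]
        linarith [(hR.2 (F s) (F r) (H.mem ⟨hr0, hrs.trans hs1⟩).1 hFrs
          (H.mem ⟨hr0.trans hrs, hs1⟩).2).2]
      · have ht1 : t < 1 := lt_of_le_of_ne ht.2 htone
        refine mul_deriv_nonpos_of_antitoneOn (Ioo_mem_nhds hgt1 ht1) ?_
          (H.tail_nonneg_right C ⟨hgt1, ht1⟩)
        intro r hr s hs hrs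
        have hz0 : 0 ≤ z₁ := C.nonneg.trans h21
        simp only
        rw [retention_of_ge hF21 (H.mono' hz0 hr.1.le hr.2.le),
          retention_of_ge hF21 (H.mono' hz0 hs.1.le hs.2.le)]
        exact sub_le_sub_left (hR.monotoneOn (H.mem ⟨hz0.trans hr.1.le, hr.2.le⟩)
          (H.mem ⟨hz0.trans hs.1.le, hs.2.le⟩) (H.mono' (hz0.trans hr.1.le) hrs hs.2.le)) _

theorem multiplier_nonneg (H : InsuranceData u T F M b W) (C : IsCandidate u T F W w z₂ z₁) :
    0 ≤ multiplier u T F w z₂ z₁ :=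
  mul_nonneg (H.utility.deriv_pos (sub_pos.2 C.pos)).le
    (H.weighting.tailRatio_pos ⟨C.nonneg.trans (C.le_a.trans C.a_le), C.lt_one⟩).le

/-- A layered retention satisfying the first-order conditions is the unique best one among the
retentions with at least the same mean. -/
theorem value_le (H : InsuranceData u T F M b W) (C : IsCandidate u T F W w z₂ z₁) {R : ℝ → ℝ}
    (hR : IsIndemnity M R) (hmean : ∫ t in (0 : ℝ)..1, retention (F z₂) (F z₁) (F t) ≤
      ∫ t in (0 : ℝ)..1, R (F t)) :
    ∫ t in (0 : ℝ)..1, u (w - R (F t)) * deriv T t ≤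
        ∫ t in (0 : ℝ)..1, u (w - retention (F z₂) (F z₁) (F t)) * deriv T t ∧
      (∫ t in (0 : ℝ)..1, u (w - R (F t)) * deriv T t =
        ∫ t in (0 : ℝ)..1, u (w - retention (F z₂) (F z₁) (F t)) * deriv T t →
        EqOn R (retention (F z₂) (F z₁)) (Icc 0 M)) := by
  have hT := H.weighting
  have hu := H.utility
  have h21 := C.le_a.trans C.a_le
  have hF21 := H.mono' C.nonneg h21 C.lt_one.le
  have hF2 : 0 ≤ F z₂ := (H.mem ⟨C.nonneg, h21.trans C.lt_one.le⟩).1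
  have hG := isIndemnity_retention M hF21 hF2
  have hMw : M ≤ w := H.wealth.trans C.wealth
  set G := retention (F z₂) (F z₁) with hGdef
  have h0 : (0 : ℝ) ∈ Icc (0 : ℝ) 1 := left_mem_Icc.2 zero_le_one
  have h1 : (1 : ℝ) ∈ Icc (0 : ℝ) 1 := right_mem_Icc.2 zero_le_one
  have hGc := H.continuousOn_comp hG
  have hRc := H.continuousOn_comp hR
  have hGi : IntervalIntegrable (fun t => G (F t)) volume 0 1 :=
    ContinuousOn.intervalIntegrable (by rwa [uIcc_of_le zero_le_one])
  have hRi : IntervalIntegrable (fun t => R (F t)) volume 0 1 :=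
    ContinuousOn.intervalIntegrable (by rwa [uIcc_of_le zero_le_one])
  have hVR := H.intervalIntegrable_utility hR hMw
  have hVG := H.intervalIntegrable_utility hG hMw
  have hlin : IntervalIntegrable (fun t => deriv u (w - G (F t)) * deriv T t *
      (G (F t) - R (F t))) volume 0 1 :=
    (H.intervalIntegrable_deriv_retention C.pos h0 h1).mul_continuousOn
      (by rw [uIcc_of_le zero_le_one]; exact hGc.sub hRc)
  have hnet : IntervalIntegrable (fun t => netMarginal u T F w z₂ z₁ t *
      (G (F t) - R (F t))) volume 0 1 :=
    (H.intervalIntegrable_netMarginal C.pos h0 h1).mul_continuousOn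
      (by rw [uIcc_of_le zero_le_one]; exact hGc.sub hRc)
  -- The linear term is the net-marginal term plus λ times a difference of means, and both are
  -- nonpositive.
  have hlin_le : ∫ t in (0 : ℝ)..1, deriv u (w - G (F t)) * deriv T t * (G (F t) - R (F t)) ≤ 0 := by
    have hsplit : ∫ t in (0 : ℝ)..1, deriv u (w - G (F t)) * deriv T t * (G (F t) - R (F t)) =
        (∫ t in (0 : ℝ)..1, netMarginal u T F w z₂ z₁ t * (G (F t) - R (F t))) +
          multiplier u T F w z₂ z₁ * ((∫ t in (0 : ℝ)..1, G (F t)) - ∫ t in (0 : ℝ)..1, R (F t)) := by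
      rw [← intervalIntegral.integral_sub hGi hRi, ← intervalIntegral.integral_const_mul,
        ← intervalIntegral.integral_add hnet ((hGi.sub hRi).const_mul _)]
      refine intervalIntegral.integral_congr fun t _ => ?_
      simp only [netMarginal, ← hGdef]
      ring
    rw [hsplit]
    have := H.integral_netMarginal_mul_nonpos C hR
    have := mul_nonneg (H.multiplier_nonneg C) (sub_nonneg.2 hmean)
    linarith
  have hwealth : ∀ t ∈ Icc (0 : ℝ) 1, 0 ≤ w - R (F t) := fun t ht => by
    have h1 := H.mem ht
    linarith [h1.2, hR.le_self h1]
  -- d is the gap in the tangent inequality for u, weighted by T'.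
  set d : ℝ → ℝ := fun t => (u (w - G (F t)) * deriv T t + deriv u (w - G (F t)) * deriv T t *
    (G (F t) - R (F t))) - u (w - R (F t)) * deriv T t with hd
  have hdform : ∀ t, d t = (u (w - G (F t)) + deriv u (w - G (F t)) *
      ((w - R (F t)) - (w - G (F t))) - u (w - R (F t))) * deriv T t := fun t => by
    simp only [hd]
    ring
  have hdnn : ∀ t ∈ Ioo (0 : ℝ) 1, 0 ≤ d t := fun t ht => by
    rw [hdform]
    refine mul_nonneg ?_ (hT.deriv_nonneg ht)
    linarith [hu.le_tangent (wealth_sub_retention_pos C.pos (F t))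
      (hwealth t (Ioo_subset_Icc_self ht))]
  have hdi : IntervalIntegrable d volume 0 1 := (hVG.add hlin).sub hVR
  have hdae : 0 ≤ᵐ[volume.restrict (Ioc (0 : ℝ) 1)] d := by
    rw [← Measure.restrict_congr_set Ioo_ae_eq_Ioc]
    exact ae_restrict_of_forall_mem measurableSet_Ioo hdnn
  have hdint : ∫ t in (0 : ℝ)..1, d t =
      (∫ t in (0 : ℝ)..1, u (w - G (F t)) * deriv T t) +
      (∫ t in (0 : ℝ)..1, deriv u (w - G (F t)) * deriv T t * (G (F t) - R (F t))) -
      ∫ t in (0 : ℝ)..1, u (w - R (F t)) * deriv T t := by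
    rw [← intervalIntegral.integral_add hVG hlin, ← intervalIntegral.integral_sub
      (hVG.add hlin) hVR]
  have hdpos : 0 ≤ ∫ t in (0 : ℝ)..1, d t := by
    rw [intervalIntegral.integral_of_le zero_le_one]
    exact integral_nonneg_of_ae hdae
  refine ⟨by linarith, fun heq => ?_⟩
  have hzero : ∫ t in (0 : ℝ)..1, d t = 0 := le_antisymm (by linarith) hdpos
  rw [intervalIntegral.integral_eq_zero_iff_of_le_of_nonneg_ae zero_le_one hdae hdi] at hzero
  -- A zero gap forces R = G at F(t) wherever T' > 0, that is off b. Continuity extends this to all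
  -- ranks, and surjectivity of F to all losses.
  have hae : (fun t => R (F t)) =ᵐ[volume.restrict (Icc (0 : ℝ) 1)] fun t => G (F t) := by
    rw [← Measure.restrict_congr_set Ioc_ae_eq_Icc]
    have hne : ∀ x : ℝ, ∀ᵐ t ∂volume.restrict (Ioc (0 : ℝ) 1), t ≠ x := fun x =>
      ae_restrict_of_ae (by simp [ae_iff, measure_singleton])
    filter_upwards [hzero, hne b, hne 1, ae_restrict_mem measurableSet_Ioc] with t ht htb ht1 htm
    have htm' : t ∈ Ioo (0 : ℝ) 1 := ⟨htm.1, lt_of_le_of_ne htm.2 ht1⟩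
    by_contra hcon
    have hlt := hu.lt_tangent (wealth_sub_retention_pos C.pos (F t))
      (hwealth t (Ioc_subset_Icc_self htm)) (fun h => hcon (by linarith))
    have := mul_pos (sub_pos.2 hlt) (hT.deriv_pos htm' htb)
    rw [← hdform] at this
    exact this.ne' ht
  have hEq := Measure.eqOn_Icc_of_ae_eq volume zero_ne_one hae hRc hGc
  intro x hx
  obtain ⟨t, ht, rfl⟩ := H.surjOn hx
  exact hEq ht

/-! ### The function `Δ` -/

theorem intervalIntegrable_quantile (H : InsuranceData u T F M b W) {p q : ℝ}
    (hp : p ∈ Icc (0 : ℝ) 1) (hq : q ∈ Icc (0 : ℝ) 1) : IntervalIntegrable F volume p q :=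
  (H.continuousOn.mono (uIcc_subset_Icc hp hq)).intervalIntegrable

theorem deltaFun_sub_ge (H : InsuranceData u T F M b W) {d e : ℝ} (hd : 0 ≤ d) (hde : d ≤ e)
    (he : e ≤ 1) : (F e - F d) * (1 - e) ≤ deltaFun F e - deltaFun F d := by
  have hd1 : d ∈ Icc (0 : ℝ) 1 := ⟨hd, hde.trans he⟩
  have he1 : e ∈ Icc (0 : ℝ) 1 := ⟨hd.trans hde, he⟩
  have hsum := intervalIntegral.integral_add_adjacent_intervals
    (H.intervalIntegrable_quantile (left_mem_Icc.2 zero_le_one) hd1)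
    (H.intervalIntegrable_quantile hd1 he1)
  have hge : F d * (e - d) ≤ ∫ t in d..e, F t := by
    have := intervalIntegral.integral_mono_on hde (intervalIntegrable_const (c := F d))
      (H.intervalIntegrable_quantile hd1 he1) fun t ht => H.mono' hd ht.1 (ht.2.trans he)
    rw [intervalIntegral.integral_const, smul_eq_mul] at this
    linarith
  rw [deltaFun, deltaFun]
  linarith

theorem deltaFun_mono (H : InsuranceData u T F M b W) {d e : ℝ} (hd : 0 ≤ d) (hde : d ≤ e)
    (he : e ≤ 1) : deltaFun F d ≤ deltaFun F e := by
  have := H.deltaFun_sub_ge hd hde he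
  have := mul_nonneg (sub_nonneg.2 (H.mono' hd hde he)) (sub_nonneg.2 he)
  linarith

theorem deltaFun_lt (H : InsuranceData u T F M b W) {d e : ℝ} (hd : 0 ≤ d) (hde : d ≤ e)
    (he : e ≤ 1) (hF : F d < F e) : deltaFun F d < deltaFun F e := by
  -- The lower bound on the increment degenerates at e = 1, so an intermediate rank m < e carries
  -- the strict inequality.
  obtain ⟨m, hm, hFm⟩ := intermediate_value_Ioo hde
    (H.continuousOn.mono (Icc_subset_Icc hd he))
    (show (F d + F e) / 2 ∈ Ioo (F d) (F e) from ⟨by linarith, by linarith⟩)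
  have h1 := H.deltaFun_sub_ge hd hm.1.le (hm.2.le.trans he)
  have h2 := H.deltaFun_mono (hd.trans hm.1.le) hm.2.le he
  have h3 : 0 < (F m - F d) * (1 - m) := mul_pos (by linarith) (by linarith [hm.2])
  linarith

theorem quantile_eq_of_deltaFun_eq (H : InsuranceData u T F M b W) {d e : ℝ}
    (hd : d ∈ Icc (0 : ℝ) 1) (he : e ∈ Icc (0 : ℝ) 1) (h : deltaFun F d = deltaFun F e) :
    F d = F e := by
  by_contra hne
  rcases le_total d e with hde | hde
  · exact (H.deltaFun_lt hd.1 hde he.2 (lt_of_le_of_ne (H.mono hd he hde) hne)).ne h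
  · exact (H.deltaFun_lt he.1 hde hd.2 (lt_of_le_of_ne (H.mono he hd hde) (Ne.symm hne))).ne h.symm

theorem deltaFun_zero (H : InsuranceData u T F M b W) : deltaFun F 0 = 0 := by
  simp [deltaFun, H.zero]

theorem deltaFun_nonneg (H : InsuranceData u T F M b W) {d : ℝ} (hd : d ∈ Icc (0 : ℝ) 1) :
    0 ≤ deltaFun F d :=
  H.deltaFun_zero.symm.le.trans (H.deltaFun_mono le_rfl hd.1 hd.2)

/-- Wealth W ≥ M alone gives only F(d) ≤ W. The inequality is strict because Δ(d) > 0 when F(d) > 0,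
and because W ≥ M > 0 when F(d) = 0. -/
theorem lt_wealth_deltaFun (H : InsuranceData u T F M b W) {ρ d : ℝ} (hρ : -1 < ρ)
    (hd : d ∈ Icc (0 : ℝ) 1) : F d < W + (1 + ρ) * deltaFun F d := by
  have hF := H.mem hd
  rcases hF.1.eq_or_lt with h | h
  · have := mul_nonneg (by linarith : 0 ≤ 1 + ρ) (H.deltaFun_nonneg hd)
    linarith [H.M_pos, H.wealth]
  · have h1 := H.deltaFun_lt le_rfl hd.1 hd.2 (by rwa [H.zero])
    rw [H.deltaFun_zero] at h1
    have := mul_pos (by linarith : 0 < 1 + ρ) h1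
    linarith [H.wealth, hF.2]

theorem continuousOn_deltaFun (H : InsuranceData u T F M b W) :
    ContinuousOn (deltaFun F) (Icc 0 1) := by
  have hint : IntegrableOn F (uIcc (0 : ℝ) 1) := by
    rw [uIcc_of_le zero_le_one]
    exact H.continuousOn.integrableOn_Icc
  have := intervalIntegral.continuousOn_primitive_interval hint
  rw [uIcc_of_le zero_le_one] at this
  exact this.add (H.continuousOn.mul (continuousOn_const.sub continuousOn_id))

/-- Identifies Δ(d) as the mean loss retained under the deductible F(d). -/
theorem integral_retention_zero (H : InsuranceData u T F M b W) {d : ℝ}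
    (hd : d ∈ Icc (0 : ℝ) 1) :
    ∫ t in (0 : ℝ)..1, retention 0 (F d) (F t) = deltaFun F d := by
  have h0 : (0 : ℝ) ∈ Icc (0 : ℝ) 1 := left_mem_Icc.2 zero_le_one
  have h1 : (1 : ℝ) ∈ Icc (0 : ℝ) 1 := right_mem_Icc.2 zero_le_one
  have hc : ∀ p ∈ Icc (0 : ℝ) 1, ∀ q ∈ Icc (0 : ℝ) 1,
      IntervalIntegrable (fun t => retention 0 (F d) (F t)) volume p q := fun p hp q hq =>
    ((H.continuousOn_retention 0 (F d)).mono (uIcc_subset_Icc hp hq)).intervalIntegrable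
  rw [← intervalIntegral.integral_add_adjacent_intervals (hc 0 h0 d hd) (hc d hd 1 h1), deltaFun]
  congr 1
  · refine intervalIntegral.integral_congr fun t ht => ?_
    rw [uIcc_of_le hd.1] at ht
    rw [retention_of_mem ⟨(H.mem ⟨ht.1, ht.2.trans hd.2⟩).1, H.mono' ht.1 ht.2 hd.2⟩, sub_zero]
  · rw [intervalIntegral.integral_congr (g := fun _ => F d), intervalIntegral.integral_const,
      smul_eq_mul, mul_comm]
    intro t ht
    rw [uIcc_of_le hd.2] at ht
    simp only
    rw [retention_of_ge (H.mem hd).1 (H.mono' hd.1 ht.1 ht.2), sub_zero]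

/-! ### Monotonicity and sign of `psiFun` -/

theorem integral_marginal_le (H : InsuranceData u T F M b W) {p q y : ℝ}
    (hp : 0 ≤ p) (hpq : p ≤ q) (hq : q ≤ 1) (hy : F q < y) :
    ∫ t in p..q, deriv u (y - F t) * deriv T t ≤ deriv u (y - F q) * (T q - T p) := by
  have hT := H.weighting
  have hp1 : p ∈ Icc (0 : ℝ) 1 := ⟨hp, hpq.trans hq⟩
  have hq1 : q ∈ Icc (0 : ℝ) 1 := ⟨hp.trans hpq, hq⟩
  rw [← hT.integral_deriv hp1 hq1 hpq, ← intervalIntegral.integral_const_mul]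
  refine intervalIntegral.integral_mono_on_of_le_Ioo hpq
    (H.intervalIntegrable_marginal hp hpq hq hy)
    ((hT.intervalIntegrable_deriv hp1 hq1).const_mul _) fun t ht => ?_
  have hF := H.mono' (hp.trans ht.1.le) ht.2.le hq
  exact mul_le_mul_of_nonneg_right (H.utility.deriv_le_deriv (by linarith) (by linarith))
    (hT.deriv_nonneg ⟨hp.trans_lt ht.1, ht.2.trans_le hq⟩)

theorem one_sub_eq {z : ℝ} (hz : z < 1) : 1 - T z = tailRatio T z * (1 - z) := by
  rw [tailRatio, div_mul_cancel₀ _ (by linarith)]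

/-- Let r be the tail ratio and m = u'(w + F(z₂) - F(q)). Bounding u' by m on [p,q] and writing T(q)
- T(p) through r shows that ψ grows by at least m (r(q) - r(p))(1 - z₂). -/
theorem psiFun_lt (H : InsuranceData u T F M b W) {p q : ℝ} (h0 : 0 ≤ z₂) (h2 : z₂ ≤ aPt T)
    (hp : aPt T ≤ p) (hpq : p < q) (hq : q < 1) (hpos : F q < w + F z₂) :
    psiFun u T F w z₂ p < psiFun u T F w z₂ q := by
  have hT := H.weighting
  have hp0 : 0 ≤ p := hT.aPt_mem.1.le.trans hp
  have hFpq := H.mono' hp0 hpq.le hq.le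
  rw [H.psiFun_eq h0 (h2.trans hp) (hpq.trans hq) (hFpq.trans_lt hpos),
    H.psiFun_eq h0 (h2.trans (hp.trans hpq.le)) hq hpos,
    ← intervalIntegral.integral_add_adjacent_intervals
      (H.intervalIntegrable_marginal h0 (h2.trans hp) (hpq.trans hq).le (hFpq.trans_lt hpos))
      (H.intervalIntegrable_marginal hp0 hpq.le hq.le hpos)]
  have hle := H.integral_marginal_le hp0 hpq.le hq.le hpos
  have hTpq : T q - T p = tailRatio T p * (1 - p) - tailRatio T q * (1 - q) := by
    rw [← one_sub_eq hq, ← one_sub_eq (hpq.trans hq)]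
    ring
  rw [hTpq] at hle
  have hm := H.utility.deriv_le_deriv (sub_pos.2 hpos)
    (sub_le_sub_left hFpq (w + F z₂))
  have hmq := H.utility.deriv_pos (sub_pos.2 hpos)
  have hr := hT.aPt_spec.2.2.1 ⟨hp, hpq.trans hq⟩ ⟨hp.trans hpq.le, hq⟩ hpq
  have hrp := hT.tailRatio_pos ⟨hp0, hpq.trans hq⟩
  have hz2 : 0 < 1 - z₂ := by linarith
  have e1 : deriv u (w + F z₂ - F p) * (tailRatio T p * (p - z₂)) ≤
      deriv u (w + F z₂ - F q) * (tailRatio T p * (p - z₂)) :=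
    mul_le_mul_of_nonneg_right hm (mul_nonneg hrp.le (by linarith))
  have e2 : 0 < deriv u (w + F z₂ - F q) * ((tailRatio T q - tailRatio T p) * (1 - z₂)) :=
    mul_pos hmq (mul_pos (by linarith) hz2)
  linarith

theorem psiFun_self : psiFun u T F w z₁ z₁ = 0 := by simp [psiFun]

/-- Below a the weighted marginal utility exceeds its value at a, which is exactly the constant term
of ψ because T'(a) equals the tail ratio. -/
theorem psiFun_aPt_neg (H : InsuranceData u T F M b W) (hw : W ≤ w) (h0 : 0 ≤ z₂)
    (h2 : z₂ < aPt T) (hpos : F (aPt T) < w + F z₂) : psiFun u T F w z₂ (aPt T) < 0 := by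
  have hT := H.weighting
  have ha := hT.aPt_mem
  have hint := H.intervalIntegrable_marginal h0 h2.le ha.2.le hpos
  have hF2 := (H.mem ⟨h0, h2.le.trans ha.2.le⟩).1
  have hanti := H.strictAntiOn_marginal (by linarith : W ≤ w + F z₂) hpos
  have h := intervalIntegral.intervalIntegral_pos_of_pos_on
    (hint.sub (intervalIntegrable_const (c := deriv u (w + F z₂ - F (aPt T)) * deriv T (aPt T))))
    (fun t ht => sub_pos.2 (hanti ⟨h0.trans_lt ht.1, ht.2.le⟩ ⟨ha.1, le_rfl⟩ ht.2)) h2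
  rw [intervalIntegral.integral_sub hint intervalIntegrable_const,
    intervalIntegral.integral_const, smul_eq_mul, hT.deriv_aPt] at h
  rw [H.psiFun_eq h0 h2.le ha.2 hpos]
  linarith

theorem psiFun_aPt_nonpos (H : InsuranceData u T F M b W) (hw : W ≤ w) (h0 : 0 ≤ z₂)
    (h2 : z₂ ≤ aPt T) (hpos : F (aPt T) < w + F z₂) : psiFun u T F w z₂ (aPt T) ≤ 0 := by
  rcases h2.eq_or_lt with rfl | h
  · exact psiFun_self.le
  · exact (H.psiFun_aPt_neg hw h0 h hpos).le

/-- At c the tail ratio is 1 and T(c) = c, so ψ is at least u'(w + F(z₂) - F(c)) (T(z₂) - z₂); on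
[0,a] the tail ratio is at most 1, that is T(z₂) ≥ z₂. -/
theorem psiFun_cPt_nonneg (H : InsuranceData u T F M b W) (h0 : 0 ≤ z₂)
    (h2 : z₂ ≤ aPt T) (hpos : F (cPt T) < w + F z₂) : 0 ≤ psiFun u T F w z₂ (cPt T) := by
  have hT := H.weighting
  have ha := hT.aPt_mem
  obtain ⟨hc, hc1⟩ := hT.cPt_spec
  have h2c := h2.trans hc.1.le
  have hle := H.integral_marginal_le h0 h2c hc.2.le hpos
  rw [H.psiFun_eq h0 h2c hc.2 hpos, hc1]
  rw [hT.map_cPt] at hle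
  have hr : tailRatio T z₂ ≤ 1 := by
    rw [← hT.tailRatio_zero]
    exact hT.aPt_spec.2.1.antitoneOn ⟨le_rfl, ha.1.le⟩ ⟨h0, h2⟩ h0
  rw [tailRatio, div_le_one (by linarith [ha.2])] at hr
  nlinarith [H.utility.deriv_pos (sub_pos.2 hpos)]

theorem psiFun_cPt_pos (H : InsuranceData u T F M b W) (hc0 : 0 < F (cPt T))
    (hpos : F (cPt T) < w) : 0 < psiFun u T F w 0 (cPt T) := by
  have hT := H.weighting
  have ha := hT.aPt_mem
  obtain ⟨hc, hc1⟩ := hT.cPt_spec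
  have hcpos : 0 < cPt T := ha.1.trans hc.1
  have hpos' : F (cPt T) < w + F 0 := by rwa [H.zero, add_zero]
  -- Up to the rank m with F(m) = F(c)/2 the marginal utility stays strictly below that at c, which
  -- gives strictness.
  obtain ⟨m, hm, hFm⟩ := intermediate_value_Ioo hcpos.le
    (H.continuousOn.mono (Icc_subset_Icc le_rfl hc.2.le))
    (show F (cPt T) / 2 ∈ Ioo (F 0) (F (cPt T)) by
      rw [H.zero]; exact ⟨by linarith, by linarith⟩)
  have hm1 : m ≤ 1 := hm.2.le.trans hc.2.le
  have hFmw : F m < w + F 0 := by rw [H.zero]; linarith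
  rw [H.psiFun_eq le_rfl hcpos.le hc.2 hpos', hc1,
    ← intervalIntegral.integral_add_adjacent_intervals
      (H.intervalIntegrable_marginal le_rfl hm.1.le hm1 hFmw)
      (H.intervalIntegrable_marginal hm.1.le hm.2.le hc.2.le hpos')]
  have h1 := H.integral_marginal_le le_rfl hm.1.le hm1 hFmw
  have h2 := H.integral_marginal_le hm.1.le hm.2.le hc.2.le hpos'
  rw [hT.map_zero, sub_zero] at h1
  rw [hT.map_cPt] at h2
  have hlt : deriv u (w + F 0 - F m) < deriv u (w + F 0 - F (cPt T)) :=
    H.utility.deriv_anti (by simp only [mem_Ioi]; linarith) (by simp only [mem_Ioi]; linarith)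
      (by linarith)
  have hTm : 0 < T m := by
    rw [← hT.map_zero]
    exact hT.strictMonoOn (left_mem_Icc.2 zero_le_one) ⟨hm.1.le, hm1⟩ hm.1
  nlinarith [mul_lt_mul_of_pos_right hlt hTm]

/-- With decreasing absolute risk aversion, the sign of `h` can only improve when wealth
decreases. -/
theorem psiFun_nonneg_of_le (H : InsuranceData u T F M b W) {w' f : ℝ} (hf0 : 0 ≤ f) (hf1 : f < 1)
    (hw : w' ≤ w) (hpos : F f < w') (h : 0 ≤ psiFun u T F w 0 f) : 0 ≤ psiFun u T F w' 0 f := by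
  have hT := H.weighting
  have hpos' : F f < w' + F 0 := by rwa [H.zero, add_zero]
  have hposw : F f < w + F 0 := by linarith
  rw [H.psiFun_eq le_rfl hf0 hf1 hposw] at h
  rw [H.psiFun_eq le_rfl hf0 hf1 hpos']
  simp only [H.zero, add_zero, sub_zero] at h hpos' hposw ⊢
  have hi := H.intervalIntegrable_marginal le_rfl hf0 hf1.le hpos'
  have hiw := H.intervalIntegrable_marginal le_rfl hf0 hf1.le hposw
  have hmw := H.utility.deriv_pos (sub_pos.2 hposw)
  have hmw' := H.utility.deriv_pos (sub_pos.2 hpos')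
  -- Decreasing risk aversion pointwise: u'(w - F f) u'(w' - F t) ≤ u'(w' - F f) u'(w - F t) for t ≤
  -- f.
  have hcmp : deriv u (w - F f) * ∫ t in (0 : ℝ)..f, deriv u (w' - F t) * deriv T t ≤
      deriv u (w' - F f) * ∫ t in (0 : ℝ)..f, deriv u (w - F t) * deriv T t := by
    rw [← intervalIntegral.integral_const_mul, ← intervalIntegral.integral_const_mul]
    refine intervalIntegral.integral_mono_on_of_le_Ioo hf0 (hi.const_mul _) (hiw.const_mul _)
      fun t ht => ?_
    have hd := H.utility.deriv_mul_deriv_le H.dara (sub_pos.2 hpos')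
      (sub_le_sub_left (H.mono' ht.1.le ht.2.le hf1.le) w') (sub_nonneg.2 hw)
    rw [show w' - F f + (w - w') = w - F f by ring,
      show w' - F t + (w - w') = w - F t by ring] at hd
    nlinarith [hT.deriv_nonneg ⟨ht.1, ht.2.trans hf1⟩]
  by_contra! hneg
  nlinarith [mul_le_mul_of_nonneg_left (sub_nonneg.1 h) hmw'.le,
    mul_lt_mul_of_pos_left (sub_neg.1 hneg) hmw]

/-! ### Existence of threefold pairs -/

theorem continuousOn_psiFun_right (H : InsuranceData u T F M b W) (h0 : 0 ≤ z₂)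
    (h2 : z₂ ≤ aPt T) (hpos : F (cPt T) < w + F z₂) :
    ContinuousOn (fun z => psiFun u T F w z₂ z) (Icc (aPt T) (cPt T)) := by
  have hT := H.weighting
  have ha := hT.aPt_mem
  obtain ⟨hc, -⟩ := hT.cPt_spec
  have hsub : Icc (aPt T) (cPt T) ⊆ Icc (0 : ℝ) 1 := Icc_subset_Icc ha.1.le hc.2.le
  have hlt : ∀ z ∈ Icc (aPt T) (cPt T), F z < w + F z₂ := fun z hz =>
    (H.mono' (hsub hz).1 hz.2 hc.2.le).trans_lt hpos
  have hprim : ContinuousOn (fun z => ∫ t in z₂..z, deriv u (w + F z₂ - F t) * deriv T t)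
      (Icc (aPt T) (cPt T)) := by
    have hint := H.intervalIntegrable_marginal h0 (h2.trans hc.1.le) hc.2.le hpos
    have hint' : IntegrableOn (fun t => deriv u (w + F z₂ - F t) * deriv T t)
        (uIcc z₂ (cPt T)) := by
      rw [uIcc_of_le (h2.trans hc.1.le)]
      exact (intervalIntegrable_iff_integrableOn_Icc_of_le (h2.trans hc.1.le)).1 hint
    have := intervalIntegral.continuousOn_primitive_interval hint'
    rw [uIcc_of_le (h2.trans hc.1.le)] at this
    exact this.mono (Icc_subset_Icc_left h2)
  have hmain : ContinuousOn (fun z => deriv u (w + F z₂ - F z) * tailRatio T z * (z - z₂) -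
      ∫ t in z₂..z, deriv u (w + F z₂ - F t) * deriv T t) (Icc (aPt T) (cPt T)) := by
    refine ContinuousOn.sub (ContinuousOn.mul (ContinuousOn.mul ?_ ?_)
      (continuousOn_id.sub continuousOn_const)) hprim
    · exact H.continuousOn_deriv_utility (continuousOn_const.sub (H.continuousOn.mono hsub))
        fun z hz => sub_pos.2 (hlt z hz)
    · exact hT.continuousOn_tailRatio.mono fun z hz => ⟨(hsub hz).1, hz.2.trans_lt hc.2⟩
  exact hmain.congr fun z hz => H.psiFun_eq h0 (h2.trans hz.1) (hz.2.trans_lt hc.2) (hlt z hz)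

/-- The upper rank of the layer is determined by the lower one. -/
theorem exists_psiFun_eq_zero (H : InsuranceData u T F M b W) (hw : W ≤ w) (h0 : 0 ≤ z₂)
    (h2 : z₂ ≤ aPt T) (hpos : F (cPt T) < w + F z₂) :
    ∃ z ∈ Icc (aPt T) (cPt T), psiFun u T F w z₂ z = 0 := by
  have hT := H.weighting
  have ha := hT.aPt_mem
  obtain ⟨hc, -⟩ := hT.cPt_spec
  have hFa := (H.mono' ha.1.le hc.1.le hc.2.le).trans_lt hpos
  exact intermediate_value_Icc hc.1.le (H.continuousOn_psiFun_right h0 h2 hpos)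
    ⟨H.psiFun_aPt_nonpos hw h0 h2 hFa, H.psiFun_cPt_nonneg h0 h2 hpos⟩

theorem psiFun_le_iff (H : InsuranceData u T F M b W) (h0 : 0 ≤ z₂) (h2 : z₂ ≤ aPt T) {p q r : ℝ}
    (hr : r < 1) (hpos : F r < w + F z₂) (hp : p ∈ Icc (aPt T) r) (hq : q ∈ Icc (aPt T) r) :
    psiFun u T F w z₂ p ≤ psiFun u T F w z₂ q ↔ p ≤ q := by
  have hmono : StrictMonoOn (fun z => psiFun u T F w z₂ z) (Icc (aPt T) r) :=
    fun p hp q hq hpq => H.psiFun_lt h0 h2 hp.1 hpq (hq.2.trans_lt hr)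
      ((H.mono' (H.weighting.aPt_mem.1.le.trans hq.1) hq.2 hr.le).trans_lt hpos)
  exact hmono.le_iff_le hp hq

/-- Moves z₂ from the limit of integration into the integrand, so that continuity in z₂ follows by
dominated convergence on a fixed interval. -/
theorem integral_layer_eq (H : InsuranceData u T F M b W) (h0 : 0 ≤ z₂) (h21 : z₂ ≤ z₁)
    (h1 : z₁ < 1) (hpos : F z₁ < w + F z₂) :
    ∫ t in z₂..z₁, deriv u (w + F z₂ - F t) * deriv T t =
      (∫ t in (0 : ℝ)..z₁, deriv u (w - retention (F z₂) (F z₁) (F t)) * deriv T t) -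
        deriv u w * T z₂ := by
  have hT := H.weighting
  have hz0 : (0 : ℝ) ∈ Icc (0 : ℝ) 1 := left_mem_Icc.2 zero_le_one
  have hz2 : z₂ ∈ Icc (0 : ℝ) 1 := ⟨h0, h21.trans h1.le⟩
  have hz1 : z₁ ∈ Icc (0 : ℝ) 1 := ⟨h0.trans h21, h1.le⟩
  have hF21 := H.mono' h0 h21 h1.le
  rw [← intervalIntegral.integral_add_adjacent_intervals
    (H.intervalIntegrable_deriv_retention hpos hz0 hz2)
    (H.intervalIntegrable_deriv_retention hpos hz2 hz1)]
  have e1 : ∫ t in (0 : ℝ)..z₂, deriv u (w - retention (F z₂) (F z₁) (F t)) * deriv T t =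
      deriv u w * T z₂ := by
    rw [intervalIntegral.integral_congr (g := fun t => deriv u w * deriv T t),
      intervalIntegral.integral_const_mul, hT.integral_deriv hz0 hz2 h0, hT.map_zero, sub_zero]
    intro t ht
    rw [uIcc_of_le h0] at ht
    simp only
    rw [retention_of_le hF21 (H.mono' ht.1 ht.2 hz2.2), sub_zero]
  have e2 : ∫ t in z₂..z₁, deriv u (w - retention (F z₂) (F z₁) (F t)) * deriv T t =
      ∫ t in z₂..z₁, deriv u (w + F z₂ - F t) * deriv T t := by
    refine intervalIntegral.integral_congr fun t ht => ?_
    rw [uIcc_of_le h21] at ht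
    rw [retention_of_mem ⟨H.mono' h0 ht.1 (ht.2.trans h1.le),
      H.mono' (h0.trans ht.1) ht.2 h1.le⟩]
    congr 2
    ring
  rw [e1, e2]
  ring

theorem continuousOn_psiFun_left (H : InsuranceData u T F M b W) (hz : z₁ ∈ Icc (aPt T) (cPt T))
    (hpos : F (cPt T) < w) :
    ContinuousOn (fun z => psiFun u T F w z z₁) (Icc 0 (aPt T)) := by
  have hT := H.weighting
  have ha := hT.aPt_mem
  obtain ⟨hc, -⟩ := hT.cPt_spec
  have hz1 : z₁ < 1 := hz.2.trans_lt hc.2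
  have hz0 : 0 ≤ z₁ := ha.1.le.trans hz.1
  have hF1 : F z₁ ≤ F (cPt T) := H.mono' hz0 hz.2 hc.2.le
  have hsub : Icc 0 (aPt T) ⊆ Icc (0 : ℝ) 1 := Icc_subset_Icc_right ha.2.le
  have hF0 : ∀ z ∈ Icc 0 (aPt T), 0 ≤ F z := fun z hz => (H.mem (hsub hz)).1
  have hFc := H.continuousOn.mono hsub
  have hint : ContinuousOn (fun z => ∫ t in (0 : ℝ)..z₁,
      deriv u (w - retention (F z) (F z₁) (F t)) * deriv T t) (Icc 0 (aPt T)) := by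
    intro z hz'
    refine intervalIntegral.continuousWithinAt_of_dominated_interval
      (bound := fun t => deriv u (w - F (cPt T)) * deriv T t) ?_ ?_ ?_ ?_
    · filter_upwards [self_mem_nhdsWithin] with x hx
      have hpx : F z₁ < w + F x := by linarith [hF0 x hx]
      rw [uIoc_of_le hz0]
      exact (H.intervalIntegrable_deriv_retention hpx
        (left_mem_Icc.2 zero_le_one) ⟨hz0, hz1.le⟩).1.aestronglyMeasurable
    · filter_upwards [self_mem_nhdsWithin] with x hx
      refine Eventually.of_forall fun t ht => ?_
      rw [uIoc_of_le hz0] at ht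
      have hnn := hT.deriv_nonneg ⟨ht.1, ht.2.trans_lt hz1⟩
      have hr := retention_le (x₂ := F x) (x₁ := F z₁) (F t)
      have hx0 := hF0 x hx
      have hp := H.utility.deriv_pos
        (by linarith : 0 < w - retention (F x) (F z₁) (F t))
      rw [Real.norm_of_nonneg (mul_nonneg hp.le hnn)]
      exact mul_le_mul_of_nonneg_right
        (H.utility.deriv_le_deriv (by linarith) (by linarith)) hnn
    · exact (hT.intervalIntegrable_deriv (left_mem_Icc.2 zero_le_one) ⟨hz0, hz1.le⟩).const_mul _
    · refine Eventually.of_forall fun t ht => ?_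
      refine ContinuousOn.continuousWithinAt ?_ hz'
      refine ContinuousOn.mul ?_ continuousOn_const
      refine H.continuousOn_deriv_utility (continuousOn_const.sub ?_) fun x hx => ?_
      · exact continuous_retention.comp_continuousOn
          (hFc.prodMk (continuousOn_const.prodMk continuousOn_const))
      · exact wealth_sub_retention_pos (by linarith [hF0 x hx]) _
  have hmain : ContinuousOn (fun z => deriv u (w + F z - F z₁) * tailRatio T z₁ * (z₁ - z) -
      ((∫ t in (0 : ℝ)..z₁, deriv u (w - retention (F z) (F z₁) (F t)) * deriv T t) -
        deriv u w * T z)) (Icc 0 (aPt T)) := by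
    refine ContinuousOn.sub (ContinuousOn.mul (ContinuousOn.mul ?_ continuousOn_const)
      (continuousOn_const.sub continuousOn_id))
      (hint.sub (continuousOn_const.mul (hT.continuousOn.mono hsub)))
    exact H.continuousOn_deriv_utility ((continuousOn_const.add hFc).sub continuousOn_const)
      fun z hz => by linarith [hF0 z hz]
  refine hmain.congr fun z hz' => ?_
  have hp : F z₁ < w + F z := by linarith [hF0 z hz']
  simp only
  rw [H.psiFun_eq hz'.1 (hz'.2.trans hz.1) hz1 hp,
    H.integral_layer_eq hz'.1 (hz'.2.trans hz.1) hz1 hp]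

/-- The root in the upper rank depends continuously on the lower rank. -/
theorem continuousOn_of_psiFun_eq_zero (H : InsuranceData u T F M b W) (hpos : F (cPt T) < w)
    {ζ : ℝ → ℝ} (hζ : ∀ z ∈ Icc 0 (aPt T), ζ z ∈ Icc (aPt T) (cPt T) ∧ psiFun u T F w z (ζ z) = 0) :
    ContinuousOn ζ (Icc 0 (aPt T)) := by
  have hT := H.weighting
  have ha := hT.aPt_mem
  obtain ⟨hc, -⟩ := hT.cPt_spec
  have hpos' : ∀ z ∈ Icc 0 (aPt T), F (cPt T) < w + F z := fun z hz => by
    linarith [(H.mem ⟨hz.1, hz.2.trans ha.2.le⟩).1]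
  intro z hz
  obtain ⟨hζz, hroot⟩ := hζ z hz
  -- For p < ζ(z) < q in [a,c], ψ(z,p) < 0 < ψ(z,q). These signs persist for nearby lower ranks, and
  -- monotonicity in the upper rank then confines the root.
  refine tendsto_order.2 ⟨fun p hp => ?_, fun q hq => ?_⟩
  · rcases lt_or_ge p (aPt T) with hpa | hpa
    · filter_upwards [self_mem_nhdsWithin] with x hx
      exact hpa.trans_le (hζ x hx).1.1
    · have hpI : p ∈ Icc (aPt T) (cPt T) := ⟨hpa, hp.le.trans hζz.2⟩
      have hneg : psiFun u T F w z p < 0 := by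
        rw [← hroot, lt_iff_not_ge, H.psiFun_le_iff hz.1 hz.2 hc.2 (hpos' z hz) hζz hpI]
        exact hp.not_ge
      filter_upwards [self_mem_nhdsWithin,
        (H.continuousOn_psiFun_left hpI hpos z hz).eventually (gt_mem_nhds hneg)] with x hx hxn
      by_contra! hle
      rw [← H.psiFun_le_iff hx.1 hx.2 hc.2 (hpos' x hx) (hζ x hx).1 hpI, (hζ x hx).2] at hle
      exact hle.not_gt hxn
  · rcases lt_or_ge (cPt T) q with hqc | hqc
    · filter_upwards [self_mem_nhdsWithin] with x hx
      exact (hζ x hx).1.2.trans_lt hqc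
    · have hqI : q ∈ Icc (aPt T) (cPt T) := ⟨hζz.1.trans hq.le, hqc⟩
      have hposq : 0 < psiFun u T F w z q := by
        rw [← hroot, lt_iff_not_ge, H.psiFun_le_iff hz.1 hz.2 hc.2 (hpos' z hz) hqI hζz]
        exact hq.not_ge
      filter_upwards [self_mem_nhdsWithin,
        (H.continuousOn_psiFun_left hqI hpos z hz).eventually (lt_mem_nhds hposq)] with x hx hxn
      by_contra! hle
      rw [← H.psiFun_le_iff hx.1 hx.2 hc.2 (hpos' x hx) hqI (hζ x hx).1, (hζ x hx).2] at hle
      exact hle.not_gt hxn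

/-- Intermediate value theorem along the curve of roots: the mean retention is Δ(l) at z₂ = 0 and 0
at z₂ = a, where the layer is empty. -/
theorem exists_threefold_pair (H : InsuranceData u T F M b W) (hw : W ≤ w)
    (hpos : F (cPt T) < w) {l D : ℝ} (hl : l ∈ Icc (aPt T) (cPt T))
    (hroot : psiFun u T F w 0 l = 0) (hD : D ∈ Icc 0 (deltaFun F l)) :
    ∃ z₂ ∈ Icc 0 (aPt T), ∃ z₁ ∈ Icc (aPt T) (cPt T), psiFun u T F w z₂ z₁ = 0 ∧
      ∫ t in (0 : ℝ)..1, retention (F z₂) (F z₁) (F t) = D := by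
  have hT := H.weighting
  have ha := hT.aPt_mem
  obtain ⟨hc, -⟩ := hT.cPt_spec
  have hpos' : ∀ z ∈ Icc 0 (aPt T), F (cPt T) < w + F z := fun z hz => by
    linarith [(H.mem ⟨hz.1, hz.2.trans ha.2.le⟩).1]
  have hex : ∀ z, ∃ y, z ∈ Icc 0 (aPt T) → y ∈ Icc (aPt T) (cPt T) ∧ psiFun u T F w z y = 0 := by
    intro z
    by_cases hz : z ∈ Icc 0 (aPt T)
    · obtain ⟨y, hy, h⟩ := H.exists_psiFun_eq_zero hw hz.1 hz.2 (hpos' z hz)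
      exact ⟨y, fun _ => ⟨hy, h⟩⟩
    · exact ⟨0, fun h => absurd h hz⟩
  choose ζ hζ using hex
  have huniq : ∀ z ∈ Icc 0 (aPt T), ∀ y ∈ Icc (aPt T) (cPt T), psiFun u T F w z y = 0 →
      ζ z = y := fun z hz y hy h => by
    obtain ⟨h1, h2⟩ := hζ z hz
    exact le_antisymm
      ((H.psiFun_le_iff hz.1 hz.2 hc.2 (hpos' z hz) h1 hy).1 (by rw [h, h2]))
      ((H.psiFun_le_iff hz.1 hz.2 hc.2 (hpos' z hz) hy h1).1 (by rw [h, h2]))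
  have hsub : Icc 0 (aPt T) ⊆ Icc (0 : ℝ) 1 := Icc_subset_Icc_right ha.2.le
  have hζc := H.continuousOn_of_psiFun_eq_zero hpos hζ
  have hFc := H.continuousOn.mono hsub
  have hFζ : ContinuousOn (fun z => F (ζ z)) (Icc 0 (aPt T)) :=
    H.continuousOn.comp hζc fun z hz => ⟨ha.1.le.trans (hζ z hz).1.1,
      (hζ z hz).1.2.trans hc.2.le⟩
  have hF21 : ∀ z ∈ Icc 0 (aPt T), F z ≤ F (ζ z) := fun z hz =>
    H.mono' hz.1 (hz.2.trans (hζ z hz).1.1) ((hζ z hz).1.2.trans hc.2.le)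
  have hcont : ContinuousOn (fun z => ∫ t in (0 : ℝ)..1, retention (F z) (F (ζ z)) (F t))
      (Icc 0 (aPt T)) := by
    intro z hz
    refine intervalIntegral.continuousWithinAt_of_dominated_interval (bound := fun _ => M)
      ?_ ?_ intervalIntegrable_const ?_
    · filter_upwards with x
      have hcx := H.continuousOn_retention (F x) (F (ζ x))
      rw [uIoc_of_le zero_le_one]
      exact (hcx.mono Ioc_subset_Icc_self).aestronglyMeasurable measurableSet_Ioc
    · filter_upwards [self_mem_nhdsWithin] with x hx
      refine Eventually.of_forall fun t _ => ?_
      rw [Real.norm_of_nonneg (retention_nonneg (hF21 x hx))]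
      have h1 := (H.mem (hsub hx)).1
      have h2 := (H.mem ⟨ha.1.le.trans (hζ x hx).1.1, (hζ x hx).1.2.trans hc.2.le⟩).2
      linarith [retention_le (x₂ := F x) (x₁ := F (ζ x)) (F t)]
    · refine Eventually.of_forall fun t _ => ?_
      exact (continuous_retention.comp_continuousOn
        (hFc.prodMk (hFζ.prodMk continuousOn_const))) z hz
  have hend : ∫ t in (0 : ℝ)..1, retention (F (aPt T)) (F (ζ (aPt T))) (F t) = 0 := by
    rw [huniq (aPt T) ⟨ha.1.le, le_rfl⟩ (aPt T) ⟨le_rfl, hc.1.le⟩ psiFun_self,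
      intervalIntegral.integral_congr (g := fun _ => (0 : ℝ)), intervalIntegral.integral_zero]
    intro t _
    simp [retention]
  have hstart : ∫ t in (0 : ℝ)..1, retention (F 0) (F (ζ 0)) (F t) = deltaFun F l := by
    rw [huniq 0 ⟨le_rfl, ha.1.le⟩ l hl hroot, H.zero]
    exact H.integral_retention_zero ⟨ha.1.le.trans hl.1, hl.2.trans hc.2.le⟩
  have hivt := intermediate_value_Icc' ha.1.le hcont
  simp only [hend, hstart] at hivt
  obtain ⟨z, hz, hzD⟩ := hivt hD
  exact ⟨z, hz, ζ z, (hζ z hz).1, (hζ z hz).2, hzD⟩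

end InsuranceData

/-! ### Optimality in the original problem -/

section Optimality

variable {Ω : Type*} [MeasurableSpace Ω] {P : Measure Ω}
  {X : Ω → ℝ} {u T : ℝ → ℝ} {M b W W₀ ρ prem : ℝ}

/-- Only the slackness condition needs work: if z₂ = a, then ψ(a,·) increases strictly from its zero
at a, so z₁ = a. -/
theorem IsThreefoldPair.isCandidate (H : InsuranceData u T (quantile P X) M b W)
    (hw : W ≤ W₀ - prem) (hMw : M < W₀ - prem) {z₂ z₁ : ℝ}
    (h : IsThreefoldPair P X u T W₀ ρ prem z₂ z₁) :
    IsCandidate u T (quantile P X) W (W₀ - prem) z₂ z₁ := by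
  obtain ⟨h0, h2, h1, hlt, hpsi, -⟩ := h
  have ha := H.weighting.aPt_mem
  have hF2 := (H.mem ⟨h0, h2.trans ha.2.le⟩).1
  have hF1 := (H.mem ⟨ha.1.le.trans h1, hlt.le⟩).2
  have hpos : quantile P X z₁ < W₀ - prem + quantile P X z₂ := by linarith
  refine ⟨h0, h2, h1, hlt, hw, hpos, hpsi.ge, Or.inr ⟨hpsi, ?_⟩⟩
  by_contra! hcon
  obtain rfl : z₂ = aPt T := le_antisymm h2 hcon.1
  have := H.psiFun_lt h0 le_rfl le_rfl (lt_of_le_of_ne h1 hcon.2.symm) hlt hpos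
  rw [hpsi, InsuranceData.psiFun_self] at this
  exact lt_irrefl _ this

/-- The endpoints can be read off the retention of a nonempty layer: its maximum is x₁ - x₂, first
attained at x₁. -/
theorem layer_unique {x₂ x₁ y₂ y₁ : ℝ} (hx : x₂ < x₁) (hy : y₂ ≤ y₁)
    (hx₂ : 0 ≤ x₂) (hy₂ : 0 ≤ y₂) (hx₁ : x₁ ≤ M) (hy₁ : y₁ ≤ M)
    (h : EqOn (threefold y₂ y₁) (threefold x₂ x₁) (Icc 0 M)) : y₂ = x₂ ∧ y₁ = x₁ := by
  have hr : ∀ x ∈ Icc 0 M, retention y₂ y₁ x = retention x₂ x₁ x := fun x hxm => by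
    have := h hxm
    rw [threefold_eq hy, threefold_eq hx.le] at this
    linarith
  have hM0 : 0 ≤ M := by linarith
  have hM := hr M ⟨hM0, le_rfl⟩
  rw [retention_of_ge hy hy₁, retention_of_ge hx.le hx₁] at hM
  have key : ∀ p₂ p₁ q : ℝ, p₂ < p₁ → retention p₂ p₁ q = p₁ - p₂ → p₁ ≤ q := by
    intro p₂ p₁ q hp hq
    by_contra! hlt
    have : retention p₂ p₁ q ≤ max (q - p₂) 0 := min_le_left _ _
    have h2 : max (q - p₂) 0 < p₁ - p₂ := max_lt (by linarith) (by linarith)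
    linarith
  have h1 := key y₂ y₁ x₁ (by linarith) (by
    rw [hr x₁ ⟨by linarith, hx₁⟩, retention_of_ge hx.le le_rfl, hM])
  have h2 := key x₂ x₁ y₁ hx (by
    rw [← hr y₁ ⟨by linarith, hy₁⟩, retention_of_ge hy le_rfl, hM])
  constructor <;> linarith

/-- For a given upper rank, the lower rank of a layer is determined within a flat part of the
quantile function. -/
theorem InsuranceData.lower_rank_not_lt {F : ℝ → ℝ} {w z₂ y₂ z₁ : ℝ}
    (H : InsuranceData u T F M b W)
    (Cz : IsCandidate u T F W w z₂ z₁) (Cy : IsCandidate u T F W w y₂ z₁)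
    (hz : psiFun u T F w z₂ z₁ = 0) (hy : psiFun u T F w y₂ z₁ = 0)
    (hF : F z₂ = F y₂) : ¬ z₂ < y₂ := by
  intro hlt
  have hT := H.weighting
  have ha := hT.aPt_mem
  have hab := hT.aPt_spec.1.2
  have hy0 : 0 < y₂ := Cz.nonneg.trans_lt hlt
  have hy1 := Cy.le_a.trans Cy.a_le
  have hz2 : z₂ ∈ Icc (0 : ℝ) 1 := ⟨Cz.nonneg, Cz.le_a.trans ha.2.le⟩
  have hy2 : y₂ ∈ Icc (0 : ℝ) 1 := ⟨Cy.nonneg, Cy.le_a.trans ha.2.le⟩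
  have hw : 0 < w := by linarith [H.M_pos, H.wealth, Cz.wealth]
  rw [H.psiFun_eq Cz.nonneg (Cz.le_a.trans Cz.a_le) Cz.lt_one Cz.pos,
    ← intervalIntegral.integral_add_adjacent_intervals
      (H.intervalIntegrable_marginal Cz.nonneg hlt.le hy2.2 (by linarith))
      (H.intervalIntegrable_marginal hy0.le hy1 Cz.lt_one.le Cz.pos)] at hz
  rw [H.psiFun_eq Cy.nonneg hy1 Cy.lt_one Cy.pos] at hy
  have hflat : ∫ t in z₂..y₂, deriv u (w + F z₂ - F t) * deriv T t =
      deriv u w * (T y₂ - T z₂) := by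
    rw [intervalIntegral.integral_congr (g := fun t => deriv u w * deriv T t),
      intervalIntegral.integral_const_mul, hT.integral_deriv hz2 hy2 hlt.le]
    intro t ht
    rw [uIcc_of_le hlt.le] at ht
    have h1 := H.mono' hz2.1 ht.1 (ht.2.trans hy2.2)
    have h2 := H.mono' (hz2.1.trans ht.1) ht.2 hy2.2
    have h3 : F t = F z₂ := by linarith
    simp only [h3, add_sub_cancel_right]
  rw [hflat, hF] at hz
  -- Subtracting the two equations gives λ(y₂ - z₂) = u'(w)(T(y₂) - T(z₂)). Strict decrease of T'
  -- makes the right side exceed u'(w) T'(y₂)(y₂ - z₂), which is at least λ(y₂ - z₂): a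
  -- contradiction.
  have hnet := H.netMarginal_z₂_nonneg Cy hy0
  rw [H.netMarginal_of_le hy1 Cy.lt_one.le ⟨hy0.le, le_rfl⟩, InsuranceData.multiplier] at hnet
  obtain ⟨t, ht, hslope⟩ := hT.exists_deriv_eq_slope hz2.1 hlt hy2.2
  have hTt := hT.strictAntiOn_deriv ⟨hz2.1.trans_lt ht.1, ht.2.le.trans (Cy.le_a.trans hab.le)⟩
    ⟨hy0, Cy.le_a.trans hab.le⟩ ht.2
  rw [hslope] at hz
  have e1 := mul_lt_mul_of_pos_left hTt (H.utility.deriv_pos hw)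
  have e2 : deriv u (w + F y₂ - F z₁) * tailRatio T z₁ * (y₂ - z₂) <
      deriv u w * deriv T t * (y₂ - z₂) :=
    mul_lt_mul_of_pos_right (by linarith) (by linarith)
  linarith

/-! ### From quantile form back to the insurance problem -/

variable [IsProbabilityMeasure P]

theorem integral_indemnity (hX : IsLoss P X M) (hM : 0 < M) {I R : ℝ → ℝ} (hR : IsIndemnity M R)
    (hIR : ∀ x ∈ Icc 0 M, I x = x - R x) :
    ∫ ω, I (X ω) ∂P = ∫ ω, X ω ∂P - ∫ t in (0 : ℝ)..1, R (quantile P X t) := by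
  have hId : ContinuousOn (fun x : ℝ => x) (Icc 0 M) := continuousOn_id
  have hc : ContinuousOn I (Icc 0 M) := (hId.sub hR.continuousOn).congr hIR
  have hF := hX.continuousOn_quantile
  have hmaps : MapsTo (quantile P X) (Icc 0 1) (Icc 0 M) := fun t ht => hX.quantile_mem hM ht
  rw [hX.integral_comp hM hc, hX.integral_comp hM hId, ← intervalIntegral.integral_sub]
  · refine intervalIntegral.integral_congr fun t ht => ?_
    rw [uIcc_of_le zero_le_one] at ht
    exact hIR _ (hmaps ht)
  · exact ContinuousOn.intervalIntegrable (by rwa [uIcc_of_le zero_le_one])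
  · refine ContinuousOn.intervalIntegrable ?_
    rw [uIcc_of_le zero_le_one]
    exact hR.continuousOn.comp hF hmaps

/-- Reduction of the optimal insurance problem to a problem for retentions in quantile form. -/
theorem isTheOptimal_of_value (hX : IsLoss P X M) (hM : 0 < M) (hT : IsInverseS T b)
    (hu : IsUtility u) (hρ : -1 < ρ) (hw : M ≤ W₀ - prem) {I R₀ : ℝ → ℝ}
    (hR₀ : IsIndemnity M R₀) (hI : ∀ x ∈ Icc 0 M, I x = x - R₀ x)
    (hmean : ∫ t in (0 : ℝ)..1, R₀ (quantile P X t) = ∫ ω, X ω ∂P - prem / (1 + ρ))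
    (hval : ∀ R, IsIndemnity M R → ∫ t in (0 : ℝ)..1, R₀ (quantile P X t) ≤
        ∫ t in (0 : ℝ)..1, R (quantile P X t) →
      ∫ t in (0 : ℝ)..1, u (W₀ - prem - R (quantile P X t)) * deriv T t ≤
        ∫ t in (0 : ℝ)..1, u (W₀ - prem - R₀ (quantile P X t)) * deriv T t ∧
      (∫ t in (0 : ℝ)..1, u (W₀ - prem - R (quantile P X t)) * deriv T t =
        ∫ t in (0 : ℝ)..1, u (W₀ - prem - R₀ (quantile P X t)) * deriv T t →
        EqOn R R₀ (Icc 0 M))) :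
    IsTheOptimal P X u T M W₀ ρ prem I := by
  have hρ' : 0 < 1 + ρ := by linarith
  have hIind : IsIndemnity M I := by
    refine ⟨by rw [hI 0 ⟨le_rfl, hM.le⟩, hR₀.1, sub_zero], fun x y hy hyx hx => ?_⟩
    rw [hI x ⟨hy.trans hyx, hx⟩, hI y ⟨hy, hyx.trans hx⟩]
    exact hR₀.retention.2 x y hy hyx hx
  have hrdu : ∀ J R : ℝ → ℝ, IsIndemnity M J → (∀ x ∈ Icc 0 M, J x = x - R x) →
      rdu P u T (fun ω => W₀ - prem - X ω + J (X ω)) =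
        ∫ t in (0 : ℝ)..1, u (W₀ - prem - R (quantile P X t)) * deriv T t := by
    intro J R hJ hJR
    rw [rdu_eq_integral hX hM hT hu hJ hw]
    refine intervalIntegral.integral_congr fun t ht => ?_
    rw [uIcc_of_le zero_le_one] at ht
    rw [hJR _ (hX.quantile_mem hM ht), sub_sub_cancel]
  have hfeas : ∀ J : ℝ → ℝ, IsFeasible P X M ρ prem J →
      ∫ t in (0 : ℝ)..1, R₀ (quantile P X t) ≤
        ∫ t in (0 : ℝ)..1, (quantile P X t - J (quantile P X t)) := by
    intro J hJ
    have h1 := hJ.2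
    rw [integral_indemnity hX hM hJ.1.retention (fun x _ => by ring), mul_comm,
      ← le_div_iff₀ hρ'] at h1
    linarith
  have hself : ∀ J : ℝ → ℝ, ∀ x ∈ Icc 0 M, J x = x - (x - J x) := fun J x _ => by ring
  refine ⟨⟨⟨hIind, ?_⟩, fun J hJ => ?_⟩, fun J hJ => ?_⟩
  · rw [integral_indemnity hX hM hR₀ hI, hmean, sub_sub_cancel, mul_div_cancel₀ _ hρ'.ne']
  · rw [hrdu J _ hJ.1 (hself J), hrdu I R₀ hIind hI]
    exact (hval _ hJ.1.retention (hfeas J hJ)).1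
  · have hle := hJ.2 I ⟨hIind, by
      rw [integral_indemnity hX hM hR₀ hI, hmean, sub_sub_cancel, mul_div_cancel₀ _ hρ'.ne']⟩
    rw [hrdu J _ hJ.1.1 (hself J), hrdu I R₀ hIind hI] at hle
    obtain ⟨h1, h2⟩ := hval _ hJ.1.1.retention (hfeas J hJ.1)
    intro x hx
    have := h2 (le_antisymm h1 hle) hx
    rw [hI x hx, ← this, sub_sub_cancel]

theorem IsLoss.insuranceData (hX : IsLoss P X M) (hM : 0 < M) (hT : IsInverseS T b)
    (hu : IsUtility u) (hAu : StrictAntiOn (arrowPratt u) (Ioi 0))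
    (hAT : ∀ z ∈ Ioc 0 (aPt T), DifferentiableAt ℝ (quantile P X) z →
      arrowPratt u (W - quantile P X z) * deriv (quantile P X) z < arrowPratt T z)
    (hW : M ≤ W) : InsuranceData u T (quantile P X) M b W where
  M_pos := hM
  zero := hX.quantile_zero hM
  one := hX.quantile_one hM
  mono := hX.quantile_mono hM
  ac := hX.quantile_ac
  weighting := hT
  utility := hu
  dara := hAu
  risk := hAT
  wealth := hW

theorem isTheOptimal_threefold (hX : IsLoss P X M)
    (H : InsuranceData u T (quantile P X) M b W) (hρ : -1 < ρ) {z₂ z₁ : ℝ}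
    (C : IsCandidate u T (quantile P X) W (W₀ - prem) z₂ z₁)
    (hmean : ∫ t in (0 : ℝ)..1, retention (quantile P X z₂) (quantile P X z₁) (quantile P X t) =
      ∫ ω, X ω ∂P - prem / (1 + ρ)) {I : ℝ → ℝ}
    (hI : ∀ x ∈ Icc 0 M, I x = threefold (quantile P X z₂) (quantile P X z₁) x) :
    IsTheOptimal P X u T M W₀ ρ prem I := by
  have h21 := H.mono' C.nonneg (C.le_a.trans C.a_le) C.lt_one.le
  have h2 := (H.mem ⟨C.nonneg, (C.le_a.trans C.a_le).trans C.lt_one.le⟩).1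
  exact isTheOptimal_of_value hX H.M_pos H.weighting H.utility hρ (H.wealth.trans C.wealth)
    (isIndemnity_retention M h21 h2) (fun x hx => by rw [hI x hx, threefold_eq h21]) hmean
    fun R hR hle => H.value_le C hR hle

/-! #### Threefold contracts -/

theorem IsThreefoldPair.mean (hX : IsLoss P X M) (H : InsuranceData u T (quantile P X) M b W)
    {z₂ z₁ : ℝ} (h : IsThreefoldPair P X u T W₀ ρ prem z₂ z₁) :
    ∫ t in (0 : ℝ)..1, retention (quantile P X z₂) (quantile P X z₁) (quantile P X t) =
      ∫ ω, X ω ∂P - prem / (1 + ρ) := by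
  obtain ⟨h0, h2, h1, hlt, -, hm⟩ := h
  have h21 := H.mono' h0 (h2.trans h1) hlt.le
  rw [integral_indemnity hX H.M_pos (isIndemnity_retention M h21
    (H.mem ⟨h0, (h2.trans h1).trans hlt.le⟩).1) (fun x _ => threefold_eq h21 x)] at hm
  linarith

theorem eq_of_quantile_eq (hX : IsLoss P X M) (hM : 0 < M) {s t : ℝ} (hs : s ∈ Icc (0 : ℝ) 1)
    (ht : t ∈ Icc (0 : ℝ) 1) (h : quantile P X s = quantile P X t)
    (hatom : P {ω | X ω = quantile P X t} = 0) : s = t := by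
  rcases lt_trichotomy s t with hlt | rfl | hlt
  · rw [← h] at hatom
    exact absurd hatom (hX.atom_of_quantile_eq hM hs.1 hlt ht.2 h)
  · rfl
  · exact absurd hatom (hX.atom_of_quantile_eq hM ht.1 hlt hs.2 h.symm)

/-- Uniqueness of the optimal contract fixes both layer endpoints. A non-atomic endpoint fixes its
rank; then ψ = 0 fixes the other, by strict monotonicity in the upper rank or by
`InsuranceData.lower_rank_not_lt`. -/
theorem optimalIsThreefold_of_pair (hX : IsLoss P X M)
    (H : InsuranceData u T (quantile P X) M b W) (hρ : -1 < ρ)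
    (hw : W ≤ W₀ - prem) (hMw : M < W₀ - prem) (hprem : prem < (1 + ρ) * ∫ ω, X ω ∂P)
    {z₂ z₁ : ℝ} (hz : IsThreefoldPair P X u T W₀ ρ prem z₂ z₁) :
    OptimalIsThreefold P X u T M W₀ ρ prem := by
  have hM := H.M_pos
  have ha := H.weighting.aPt_mem
  have hmem : ∀ {p₂ p₁ : ℝ}, IsThreefoldPair P X u T W₀ ρ prem p₂ p₁ →
      p₂ ∈ Icc (0 : ℝ) 1 ∧ p₁ ∈ Icc (0 : ℝ) 1 := fun hp =>
    ⟨⟨hp.1, hp.2.1.trans ha.2.le⟩, ha.1.le.trans hp.2.2.1, hp.2.2.2.1.le⟩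
  have hopt : ∀ {p₂ p₁ : ℝ}, IsThreefoldPair P X u T W₀ ρ prem p₂ p₁ →
      IsTheOptimal P X u T M W₀ ρ prem (threefold (quantile P X p₂) (quantile P X p₁)) :=
    fun hp => isTheOptimal_threefold hX H hρ (hp.isCandidate H hw hMw) (hp.mean hX H)
      fun _ _ => rfl
  have hDpos : 0 < ∫ ω, X ω ∂P - prem / (1 + ρ) := by
    rw [sub_pos, div_lt_iff₀ (by linarith)]
    linarith
  refine ⟨z₂, z₁, hz, hopt hz, fun y₂ y₁ hy => ?_⟩
  obtain ⟨hz2, hz1⟩ := hmem hz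
  obtain ⟨hy2, hy1⟩ := hmem hy
  have Cz := hz.isCandidate H hw hMw
  have Cy := hy.isCandidate H hw hMw
  have hFz := H.mono hz2 hz1 (Cz.le_a.trans Cz.a_le)
  -- A premium below that of full coverage forces a positive mean retention, so the layer is
  -- nonempty.
  have hFlt : quantile P X z₂ < quantile P X z₁ := by
    refine lt_of_le_of_ne hFz fun heq => ?_
    have := hz.mean hX H
    rw [← heq, intervalIntegral.integral_congr (g := fun _ => (0 : ℝ)),
      intervalIntegral.integral_zero] at this
    · exact hDpos.ne this
    · intro t _
      simp [retention]
  obtain ⟨h2, h1⟩ := layer_unique hFlt (H.mono hy2 hy1 (Cy.le_a.trans Cy.a_le))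
    (H.mem hz2).1 (H.mem hy2).1 (H.mem hz1).2 (H.mem hy1).2 ((hopt hz).2 _ (hopt hy).1)
  refine ⟨h2, h1, ?_⟩
  have hpsiz : psiFun u T (quantile P X) (W₀ - prem) z₂ z₁ = 0 := hz.2.2.2.2.1
  have hpsiy : psiFun u T (quantile P X) (W₀ - prem) y₂ y₁ = 0 := hy.2.2.2.2.1
  rintro (hatom | hatom)
  · obtain rfl := eq_of_quantile_eq hX hM hy2 hz2 h2 hatom
    refine ⟨rfl, ?_⟩
    rcases lt_trichotomy y₁ z₁ with hlt | heq | hlt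
    · have := H.psiFun_lt Cz.nonneg Cz.le_a Cy.a_le hlt Cz.lt_one Cz.pos
      linarith
    · exact heq
    · have := H.psiFun_lt Cz.nonneg Cz.le_a Cz.a_le hlt Cy.lt_one Cy.pos
      linarith
  · obtain rfl := eq_of_quantile_eq hX hM hy1 hz1 h1 hatom
    refine ⟨le_antisymm ?_ ?_, rfl⟩
    · exact not_lt.1 (H.lower_rank_not_lt Cz Cy hpsiz hpsiy h2.symm)
    · exact not_lt.1 (H.lower_rank_not_lt Cy Cz hpsiy hpsiz h2)

/-! #### Deductible contracts -/

theorem integral_deductible (hX : IsLoss P X M) (H : InsuranceData u T (quantile P X) M b W)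
    {f : ℝ} (hf : f ∈ Icc (0 : ℝ) 1) :
    ∫ ω, deductible (quantile P X f) (X ω) ∂P = ∫ ω, X ω ∂P - deltaFun (quantile P X) f := by
  rw [integral_indemnity hX H.M_pos (isIndemnity_retention M (H.mem hf).1 le_rfl)
    (fun x hx => by rw [deductible_eq hx.1, threefold_eq (H.mem hf).1]),
    H.integral_retention_zero hf]

theorem optimalIsDeductible_of (hX : IsLoss P X M)
    (H : InsuranceData u T (quantile P X) M b W) {S : Set ℝ} (hS : S ⊆ Icc 0 1) {f : ℝ}
    (hf : f ∈ S) (hΔ : deltaFun (quantile P X) f = ∫ ω, X ω ∂P - prem / (1 + ρ))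
    (hopt : IsTheOptimal P X u T M W₀ ρ prem (deductible (quantile P X f))) :
    OptimalIsDeductible P X u T M W₀ ρ prem S := by
  refine ⟨f, hf, ?_, hopt, fun f' hf' hm => ?_⟩
  · rw [integral_deductible hX H (hS hf), hΔ, sub_sub_cancel]
  · rw [integral_deductible hX H (hS hf')] at hm
    have h := H.quantile_eq_of_deltaFun_eq (hS hf') (hS hf) (by linarith)
    exact ⟨h, eq_of_quantile_eq hX H.M_pos (hS hf') (hS hf) h⟩

theorem isTheOptimal_deductible (hX : IsLoss P X M)
    (H : InsuranceData u T (quantile P X) M b W) (hρ : -1 < ρ) {f : ℝ}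
    (hf : aPt T ≤ f) (hf1 : f < 1) (hw : W ≤ W₀ - prem) (hpos : quantile P X f < W₀ - prem)
    (hpsi : 0 ≤ psiFun u T (quantile P X) (W₀ - prem) 0 f)
    (hΔ : deltaFun (quantile P X) f = ∫ ω, X ω ∂P - prem / (1 + ρ)) :
    IsTheOptimal P X u T M W₀ ρ prem (deductible (quantile P X f)) := by
  have ha := H.weighting.aPt_mem
  have C : IsCandidate u T (quantile P X) W (W₀ - prem) 0 f :=
    ⟨le_rfl, ha.1.le, hf, hf1, hw, by rwa [H.zero, add_zero], hpsi, Or.inl rfl⟩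
  refine isTheOptimal_threefold hX H hρ C ?_ fun x hx => ?_
  · rw [H.zero, H.integral_retention_zero ⟨ha.1.le.trans hf, hf1.le⟩, hΔ]
  · rw [H.zero, deductible_eq hx.1]

/-- Without a premium there is no coverage. -/
theorem isTheOptimal_no_coverage (hX : IsLoss P X M)
    (H : InsuranceData u T (quantile P X) M b W) (hρ : -1 < ρ) (hw : M ≤ W₀ - prem)
    (hΔ : deltaFun (quantile P X) 1 = ∫ ω, X ω ∂P - prem / (1 + ρ)) :
    IsTheOptimal P X u T M W₀ ρ prem (deductible (quantile P X 1)) := by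
  have hone : (1 : ℝ) ∈ Icc (0 : ℝ) 1 := right_mem_Icc.2 zero_le_one
  have hG := isIndemnity_retention M (H.mem hone).1 le_rfl
  have hGid : ∀ x ∈ Icc 0 M, retention 0 (quantile P X 1) x = x := fun x hx => by
    rw [retention_of_mem ⟨hx.1, hx.2.trans_eq H.one.symm⟩, sub_zero]
  refine isTheOptimal_of_value hX H.M_pos H.weighting H.utility hρ hw hG
    (fun x hx => by rw [deductible_eq hx.1, threefold_eq (H.mem hone).1])
    (by rw [H.integral_retention_zero hone, hΔ]) fun R hR hle => ?_
  set F := quantile P X with hF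
  -- Retaining everything is the only admissible choice: R(x) ≤ x, yet its mean is at least that of
  -- x.
  have hEq : EqOn R (retention 0 (F 1)) (Icc 0 M) := by
    have hGc := H.continuousOn_comp hG
    have hRc := H.continuousOn_comp hR
    have hGi : IntervalIntegrable (fun t => retention 0 (F 1) (F t)) volume 0 1 :=
      ContinuousOn.intervalIntegrable (by rwa [uIcc_of_le zero_le_one])
    have hRi : IntervalIntegrable (fun t => R (F t)) volume 0 1 :=
      ContinuousOn.intervalIntegrable (by rwa [uIcc_of_le zero_le_one])
    have hnn : 0 ≤ᵐ[volume.restrict (Ioc (0 : ℝ) 1)]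
        fun t => retention 0 (F 1) (F t) - R (F t) :=
      ae_restrict_of_forall_mem measurableSet_Ioc fun t ht => by
        have hm := H.mem (Ioc_subset_Icc_self ht)
        simp only [Pi.zero_apply, hGid _ hm]
        linarith [hR.le_self hm]
    have hint := intervalIntegral.integral_sub hGi hRi
    have hzero : ∫ t in (0 : ℝ)..1, (retention 0 (F 1) (F t) - R (F t)) = 0 := by
      refine le_antisymm (by linarith) ?_
      rw [intervalIntegral.integral_of_le zero_le_one]
      exact integral_nonneg_of_ae hnn
    rw [intervalIntegral.integral_eq_zero_iff_of_le_of_nonneg_ae zero_le_one hnn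
      (hGi.sub hRi)] at hzero
    have hae : (fun t => R (F t)) =ᵐ[volume.restrict (Icc (0 : ℝ) 1)]
        fun t => retention 0 (F 1) (F t) := by
      rw [← Measure.restrict_congr_set Ioc_ae_eq_Icc]
      filter_upwards [hzero] with t ht
      simp only [Pi.zero_apply] at ht
      linarith
    have h := Measure.eqOn_Icc_of_ae_eq volume zero_ne_one hae hRc hGc
    intro x hx
    obtain ⟨t, ht, rfl⟩ := H.surjOn hx
    exact h ht
  refine ⟨le_of_eq (intervalIntegral.integral_congr fun t ht => ?_), fun _ => hEq⟩
  rw [uIcc_of_le zero_le_one] at ht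
  simp only [hEq (H.mem ht)]

end Optimality

namespace InsuranceData

variable {u T F : ℝ → ℝ} {M b W w : ℝ}

/-! ### The zero of `h` -/

/-- h is ψ with z₂ = 0: strictly increasing on [a,c], negative at a and nonnegative at c. -/
theorem lPt_spec (H : InsuranceData u T F M b W) (hw : W ≤ w) (hpos : F (cPt T) < w) :
    lPt u T F w ∈ Ioc (aPt T) (cPt T) ∧ hFun u T F w (lPt u T F w) = 0 ∧
      ∀ z ∈ Icc (aPt T) (cPt T), hFun u T F w z = 0 → z = lPt u T F w := by
  have ha := H.weighting.aPt_mem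
  obtain ⟨hc, -⟩ := H.weighting.cPt_spec
  have hpos' : F (cPt T) < w + F 0 := by rwa [H.zero, add_zero]
  obtain ⟨l, hl, hl0⟩ := H.exists_psiFun_eq_zero hw le_rfl ha.1.le hpos'
  have huniq : ∀ z ∈ Icc (aPt T) (cPt T), hFun u T F w z = 0 → z = l := fun z hz h => by
    rw [H.hFun_eq_psiFun] at h
    exact le_antisymm
      ((H.psiFun_le_iff le_rfl ha.1.le hc.2 hpos' hz hl).1 (by rw [h, hl0]))
      ((H.psiFun_le_iff le_rfl ha.1.le hc.2 hpos' hl hz).1 (by rw [h, hl0]))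
  have hset : {z : ℝ | z ∈ Icc (aPt T) (cPt T) ∧ hFun u T F w z = 0} = {l} := by
    ext z
    simp only [mem_ofPred_eq, mem_singleton_iff]
    constructor
    · exact fun h => huniq z h.1 h.2
    · rintro rfl
      exact ⟨hl, by rw [H.hFun_eq_psiFun, hl0]⟩
  have hlPt : lPt u T F w = l := by rw [lPt, hset, csInf_singleton]
  rw [hlPt]
  refine ⟨⟨lt_of_le_of_ne hl.1 ?_, hl.2⟩, by rw [H.hFun_eq_psiFun, hl0], huniq⟩
  rintro rfl
  have hFa := (H.mono' ha.1.le hc.1.le hc.2.le).trans_lt hpos'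
  exact (H.psiFun_aPt_neg hw le_rfl ha.1 hFa).ne hl0

theorem lPt_lt (H : InsuranceData u T F M b W) (hw : W ≤ w) (hpos : F (cPt T) < w)
    (hc0 : 0 < F (cPt T)) : lPt u T F w < cPt T := by
  obtain ⟨h1, h2, -⟩ := H.lPt_spec hw hpos
  refine lt_of_le_of_ne h1.2 fun h => ?_
  rw [H.hFun_eq_psiFun, h] at h2
  exact (H.psiFun_cPt_pos hc0 hpos).ne' h2

theorem psiFun_nonneg_iff (H : InsuranceData u T F M b W) (hw : W ≤ w) (hpos : F (cPt T) < w)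
    {f : ℝ} (hf : f ∈ Icc (aPt T) (cPt T)) : 0 ≤ psiFun u T F w 0 f ↔ lPt u T F w ≤ f := by
  have ha := H.weighting.aPt_mem
  obtain ⟨hc, -⟩ := H.weighting.cPt_spec
  obtain ⟨h1, h2, -⟩ := H.lPt_spec hw hpos
  rw [H.hFun_eq_psiFun] at h2
  have h := H.psiFun_le_iff le_rfl ha.1.le hc.2 (by rwa [H.zero, add_zero])
    (Ioc_subset_Icc_self h1) hf
  rwa [h2] at h

/-- At the zero for the higher wealth, h at the lower wealth is still nonnegative by decreasing risk
aversion, so its own zero lies no further right. -/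
theorem lPt_mono (H : InsuranceData u T F M b W) {w' : ℝ} (hw' : W ≤ w') (hpos : F (cPt T) < w')
    (hw : w' ≤ w) : lPt u T F w' ≤ lPt u T F w := by
  have ha := H.weighting.aPt_mem
  obtain ⟨hc, -⟩ := H.weighting.cPt_spec
  have hl := Ioc_subset_Icc_self (H.lPt_spec (hw'.trans hw) (hpos.trans_le hw)).1
  rw [← H.psiFun_nonneg_iff hw' hpos hl]
  refine H.psiFun_nonneg_of_le (ha.1.le.trans hl.1) (hl.2.trans_lt hc.2) hw
    ((H.mono' (ha.1.le.trans hl.1) hl.2 hc.2.le).trans_lt hpos) ?_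
  exact (H.psiFun_nonneg_iff (hw'.trans hw) (hpos.trans_le hw) hl).2 le_rfl

end InsuranceData

/-! ### Assembling the premium ranges -/

section Main

variable {Ω : Type*} [MeasurableSpace Ω] {P : Measure Ω} [IsProbabilityMeasure P]
  {X : Ω → ℝ} {u T : ℝ → ℝ} {M b W W₀ ρ prem : ℝ}

theorem wealth_eq (hρ : -1 < ρ) (EX : ℝ) :
    W₀ - prem = W₀ - (1 + ρ) * EX + (1 + ρ) * (EX - prem / (1 + ρ)) := by
  have : 1 + ρ ≠ 0 := by linarith
  field_simp
  ring

theorem deltaFun_one (hX : IsLoss P X M) (H : InsuranceData u T (quantile P X) M b W) :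
    deltaFun (quantile P X) 1 = ∫ ω, X ω ∂P := by
  rw [deltaFun, sub_self, mul_zero, add_zero]
  exact (hX.integral_comp H.M_pos (φ := fun x => x) continuousOn_id).symm

theorem isTheOptimal_full (hX : IsLoss P X M) (H : InsuranceData u T (quantile P X) M b W)
    (hρ : -1 < ρ) (hW : W = W₀ - (1 + ρ) * ∫ ω, X ω ∂P) (hprem : prem = (1 + ρ) * ∫ ω, X ω ∂P) :
    IsTheOptimal P X u T M W₀ ρ prem fun z => z := by
  have ha := H.weighting.aPt_mem
  have hw : W₀ - prem = W := by rw [hW, hprem]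
  -- Full coverage is the empty layer, placed at z₂ = z₁ = a.
  have C : IsCandidate u T (quantile P X) W (W₀ - prem) (aPt T) (aPt T) :=
    ⟨ha.1.le, le_rfl, le_rfl, ha.2, hw.ge, by linarith [H.M_pos, H.wealth],
      InsuranceData.psiFun_self.ge, Or.inr ⟨InsuranceData.psiFun_self, Or.inr rfl⟩⟩
  refine isTheOptimal_threefold hX H hρ C ?_ fun x _ => ?_
  · rw [hprem, mul_div_cancel_left₀ _ (by linarith), sub_self,
      intervalIntegral.integral_congr (g := fun _ => (0 : ℝ)), intervalIntegral.integral_zero]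
    intro t _
    simp [retention]
  · rw [threefold_eq le_rfl]
    simp [retention]

/-- A threefold contract is optimal when the mean retention is at most the one of the deductible
at the zero of `h`. -/
theorem optimalIsThreefold (hX : IsLoss P X M) (H : InsuranceData u T (quantile P X) M b W)
    (hρ : -1 < ρ) (hW : W = W₀ - (1 + ρ) * ∫ ω, X ω ∂P) (hprem : prem < (1 + ρ) * ∫ ω, X ω ∂P)
    (hle : ∫ ω, X ω ∂P - prem / (1 + ρ) ≤
      deltaFun (quantile P X) (lPt u T (quantile P X) (W₀ - prem))) :
    OptimalIsThreefold P X u T M W₀ ρ prem := by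
  have hρ' : 0 < 1 + ρ := by linarith
  have ha := H.weighting.aPt_mem
  obtain ⟨hc, -⟩ := H.weighting.cPt_spec
  have hWw : W < W₀ - prem := by rw [hW]; linarith
  have hMw : M < W₀ - prem := H.wealth.trans_lt hWw
  have hpos : quantile P X (cPt T) < W₀ - prem :=
    (H.mem ⟨(ha.1.trans hc.1).le, hc.2.le⟩).2.trans_lt hMw
  obtain ⟨hl, hl0, -⟩ := H.lPt_spec hWw.le hpos
  rw [H.hFun_eq_psiFun] at hl0
  have hD : 0 ≤ ∫ ω, X ω ∂P - prem / (1 + ρ) := by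
    rw [sub_nonneg, div_le_iff₀ hρ']
    linarith
  obtain ⟨z₂, hz2, z₁, hz1, hpsi, hmean⟩ :=
    H.exists_threefold_pair hWw.le hpos (Ioc_subset_Icc_self hl) hl0 ⟨hD, hle⟩
  refine optimalIsThreefold_of_pair hX H hρ hWw.le hMw hprem (z₂ := z₂) (z₁ := z₁)
    ⟨hz2.1, hz2.2, hz1.1, hz1.2.trans_lt hc.2, hpsi, ?_⟩
  have h21 := H.mono' hz2.1 (hz2.2.trans hz1.1) (hz1.2.trans hc.2.le)
  rw [integral_indemnity hX H.M_pos (isIndemnity_retention M h21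
    (H.mem ⟨hz2.1, hz2.2.trans ha.2.le⟩).1) (fun x _ => threefold_eq h21 x), hmean,
    sub_sub_cancel]

end Main

end RDUInsurance

open RDUInsurance in
theorem mainTheorem8 {Ω : Type*} [MeasurableSpace Ω] (P : Measure Ω) [IsProbabilityMeasure P]
    (X : Ω → ℝ) (u T : ℝ → ℝ) (M b ρ W₀ EX W a c lₐ l_c : ℝ) (F Δ : ℝ → ℝ)
    (hM : 0 < M) (hρ : -1 < ρ)
    -- notation
    (hEX : EX = ∫ ω, X ω ∂P) (hWdef : W = W₀ - (1 + ρ) * EX)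
    (hF : F = quantile P X) (hΔ : Δ = deltaFun F)
    (ha : a = aPt T) (hc : c = cPt T)
    (hla : lₐ = lPt u T F (W + (1 + ρ) * Δ a)) (hlc : l_c = lPt u T F (W + (1 + ρ) * Δ c))
    -- assumptions
    (hX : IsLoss P X M) (hT : IsInverseS T b) (hu : IsUtility u)
    (hAu : StrictAntiOn (arrowPratt u) (Ioi 0))
    (hAT : ∀ z ∈ Ioc 0 a, DifferentiableAt ℝ F z →
      arrowPratt u (W - F z) * deriv F z < arrowPratt T z)
    (hW : M ≤ W)
    (hpos : F c < W + (1 + ρ) * Δ a) :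
    -- the auxiliary points are well defined
    ((a ∈ Ioo 0 b ∧ StrictAntiOn (tailRatio T) (Icc 0 a) ∧ StrictMonoOn (tailRatio T) (Ico a 1)) ∧
      (c ∈ Ioo a 1 ∧ T c = c) ∧
      (lₐ ∈ Ioc a c ∧ hFun u T F (W + (1 + ρ) * Δ a) lₐ = 0 ∧
        ∀ z ∈ Icc a c, hFun u T F (W + (1 + ρ) * Δ a) z = 0 → z = lₐ) ∧
      (l_c ∈ Ioc a c ∧ hFun u T F (W + (1 + ρ) * Δ c) l_c = 0 ∧
        ∀ z ∈ Icc a c, hFun u T F (W + (1 + ρ) * Δ c) z = 0 → z = l_c) ∧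
      (P.real {ω | X ω = 0} < c → lₐ < c ∧ l_c < c)) ∧
    -- (i)
    (∀ prem : ℝ, prem = (1 + ρ) * EX → IsTheOptimal P X u T M W₀ ρ prem (fun z => z)) ∧
    -- (ii)
    (∀ prem : ℝ, (1 + ρ) * (EX - Δ lₐ) ≤ prem → prem < (1 + ρ) * EX →
      OptimalIsThreefold P X u T M W₀ ρ prem) ∧
    -- (iii)
    (∀ prem : ℝ, (1 + ρ) * (EX - Δ l_c) < prem → prem < (1 + ρ) * (EX - Δ lₐ) →
      (∃ p ∈ Ioo lₐ l_c, Δ p = EX - prem / (1 + ρ)) ∧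
      ∀ p ∈ Ioo lₐ l_c, Δ p = EX - prem / (1 + ρ) →
        (gFun u T F W ρ p < 0 → OptimalIsThreefold P X u T M W₀ ρ prem) ∧
        (0 ≤ gFun u T F W ρ p →
          OptimalIsDeductible P X u T M W₀ ρ prem (Ico 0 l_c))) ∧
    -- (iv)
    (∀ prem : ℝ, 0 ≤ prem → prem ≤ (1 + ρ) * (EX - Δ l_c) →
      OptimalIsDeductible P X u T M W₀ ρ prem (Icc l_c 1)) := by
  subst hF hΔ ha hc
  have H : InsuranceData u T (quantile P X) M b W := hX.insuranceData hM hT hu hAu hAT hW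
  have hρ' : 0 < 1 + ρ := by linarith
  have ha := hT.aPt_mem
  have hc := hT.cPt_spec.1
  have hc0 : 0 < cPt T := ha.1.trans hc.1
  have hΔa : 0 ≤ deltaFun (quantile P X) (aPt T) :=
    H.deltaFun_nonneg (Ioo_subset_Icc_self ha)
  have hΔac := H.deltaFun_mono ha.1.le hc.1.le hc.2.le
  have hwa : W ≤ W + (1 + ρ) * deltaFun (quantile P X) (aPt T) := by
    linarith [mul_nonneg hρ'.le hΔa]
  have hwac : W + (1 + ρ) * deltaFun (quantile P X) (aPt T) ≤
      W + (1 + ρ) * deltaFun (quantile P X) (cPt T) := by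
    linarith [mul_le_mul_of_nonneg_left hΔac hρ'.le]
  have hposc := hpos.trans_le hwac
  have hspeca := H.lPt_spec hwa hpos
  have hspecc := H.lPt_spec (hwa.trans hwac) hposc
  have hlac := H.lPt_mono hwa hpos hwac
  rw [← hla] at hspeca hlac
  rw [← hlc] at hspecc hlac
  have hmem : ∀ {z : ℝ}, z ∈ Icc (aPt T) (cPt T) → z ∈ Icc (0 : ℝ) 1 := fun hz =>
    ⟨ha.1.le.trans hz.1, hz.2.trans hc.2.le⟩
  have hla01 := hmem (Ioc_subset_Icc_self hspeca.1)
  have hlc01 := hmem (Ioc_subset_Icc_self hspecc.1)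
  have hWint : W = W₀ - (1 + ρ) * ∫ ω, X ω ∂P := by rw [hWdef, hEX]
  have hweq : ∀ prem : ℝ, W₀ - prem = W + (1 + ρ) * (EX - prem / (1 + ρ)) := fun prem => by
    rw [hWdef]
    exact wealth_eq hρ EX
  have hbound : ∀ prem x : ℝ, EX - prem / (1 + ρ) ≤ x ↔ (1 + ρ) * (EX - x) ≤ prem :=
    fun prem x => by
      rw [sub_le_comm, le_div_iff₀ hρ', mul_comm]
  have hbound' : ∀ prem x : ℝ, x ≤ EX - prem / (1 + ρ) ↔ prem ≤ (1 + ρ) * (EX - x) :=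
    fun prem x => by
      rw [le_sub_comm, div_le_iff₀ hρ', mul_comm]
  refine ⟨⟨⟨hT.aPt_spec.1, hT.aPt_spec.2.1, hT.aPt_spec.2.2.1⟩, ⟨hc, hT.map_cPt⟩, hspeca, hspecc,
    fun hP => ?_⟩, fun prem hprem => ?_, fun prem h1 h2 => ?_, fun prem h1 h2 => ⟨?_, ?_⟩,
    fun prem h0 h1 => ?_⟩
  · have hFc := hX.quantile_pos_of_lt hM hc.2.le hP
    rw [hla, hlc]
    exact ⟨H.lPt_lt hwa hpos hFc, H.lPt_lt (hwa.trans hwac) hposc hFc⟩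
  · exact isTheOptimal_full hX H hρ hWint (by rw [hprem, hEX])
  · refine optimalIsThreefold hX H hρ hWint (by rwa [← hEX]) ?_
    rw [← hEX]
    rw [← hbound] at h1
    have hDpos : 0 ≤ EX - prem / (1 + ρ) := by
      rw [sub_nonneg, div_le_iff₀ hρ']
      linarith
    have hMw : M < W₀ - prem := by
      rw [hWdef] at hW
      linarith
    have hFw : quantile P X (cPt T) < W₀ - prem := (H.mem ⟨hc0.le, hc.2.le⟩).2.trans_lt hMw
    have hWw : W ≤ W₀ - prem := by
      rw [hWdef]
      linarith
    have hlw := Ioc_subset_Icc_self (H.lPt_spec hWw hFw).1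
    -- With l the zero at the actual wealth: if D ≥ Δ(a), wealth is at least W_Δ(a), so l ≥ lₐ and D
    -- ≤ Δ(lₐ) ≤ Δ(l); if D < Δ(a), then l > a suffices.
    rcases le_or_gt (deltaFun (quantile P X) (aPt T)) (EX - prem / (1 + ρ)) with h | h
    · have hww : W + (1 + ρ) * deltaFun (quantile P X) (aPt T) ≤ W₀ - prem := by
        rw [hweq]
        linarith [mul_le_mul_of_nonneg_left h hρ'.le]
      have hll := H.lPt_mono hwa hpos hww
      rw [← hla] at hll
      exact h1.trans (H.deltaFun_mono hla01.1 hll (hmem hlw).2)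
    · exact h.le.trans (H.deltaFun_mono ha.1.le hlw.1 (hmem hlw).2)
  · have hcont : ContinuousOn (deltaFun (quantile P X)) (Icc lₐ l_c) :=
      H.continuousOn_deltaFun.mono (Icc_subset_Icc hla01.1 hlc01.2)
    refine intermediate_value_Ioo hlac hcont ⟨?_, ?_⟩
    · rw [lt_iff_not_ge, hbound]
      exact h2.not_ge
    · rw [lt_iff_not_ge, hbound']
      exact h1.not_ge
  · intro p hp hΔp
    have hpI : p ∈ Icc (aPt T) (cPt T) :=
      ⟨hspeca.1.1.le.trans hp.1.le, hp.2.le.trans hspecc.1.2⟩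
    have hp01 := hmem hpI
    have hw : W₀ - prem = W + (1 + ρ) * deltaFun (quantile P X) p := by rw [hweq, hΔp]
    have hwap : W + (1 + ρ) * deltaFun (quantile P X) (aPt T) ≤ W₀ - prem := by
      rw [hw]
      linarith [mul_le_mul_of_nonneg_left (H.deltaFun_mono ha.1.le hpI.1 hp01.2) hρ'.le]
    -- Since Δ(p) = D, the wealth built into g at p is W₀ - π; the sign of g(p) thus tells on which
    -- side of the zero of h the rank p lies.
    have hg : gFun u T (quantile P X) W ρ p = psiFun u T (quantile P X) (W₀ - prem) 0 p := by
      rw [← H.hFun_eq_psiFun, hw]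
      rfl
    have hFw := hpos.trans_le hwap
    have hWw := hwa.trans hwap
    refine ⟨fun hneg => ?_, fun hnn => ?_⟩
    · refine optimalIsThreefold hX H hρ hWint ?_ ?_
      · rw [← hEX]
        have := mul_nonneg hρ'.le (H.deltaFun_nonneg hla01)
        linarith
      · rw [← hEX, ← hΔp]
        rw [hg, ← not_le, H.psiFun_nonneg_iff hWw hFw hpI, not_le] at hneg
        exact H.deltaFun_mono hp01.1 hneg.le
          (hmem (Ioc_subset_Icc_self (H.lPt_spec hWw hFw).1)).2
    · rw [hg] at hnn
      rw [hEX] at hΔp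
      have hp1 : p < 1 := hpI.2.trans_lt hc.2
      refine optimalIsDeductible_of hX H (fun x hx => ⟨hx.1, hx.2.le.trans hlc01.2⟩)
        ⟨hp01.1, hp.2⟩ hΔp (isTheOptimal_deductible hX H hρ hpI.1 hp1 hWw
          ((H.mono' hp01.1 hpI.2 hc.2.le).trans_lt hFw) hnn hΔp)
  · have hcont : ContinuousOn (deltaFun (quantile P X)) (Icc l_c 1) :=
      H.continuousOn_deltaFun.mono (Icc_subset_Icc_left hlc01.1)
    have hΔ1 := deltaFun_one hX H
    rw [← hEX] at hΔ1
    have hmemD : EX - prem / (1 + ρ) ∈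
        Icc (deltaFun (quantile P X) l_c) (deltaFun (quantile P X) 1) := by
      refine ⟨(hbound' _ _).2 h1, ?_⟩
      rw [hΔ1]
      linarith [div_nonneg h0 hρ'.le]
    obtain ⟨f, hf, hΔf⟩ := intermediate_value_Icc hlc01.2 hcont hmemD
    have hf01 : f ∈ Icc (0 : ℝ) 1 := ⟨hlc01.1.trans hf.1, hf.2⟩
    have hw : W₀ - prem = W + (1 + ρ) * deltaFun (quantile P X) f := by rw [hweq, hΔf]
    have hWw : W ≤ W₀ - prem := by
      rw [hw]
      linarith [mul_nonneg hρ'.le (H.deltaFun_nonneg hf01)]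
    have hFf : quantile P X f < W₀ - prem := by
      rw [hw]
      exact H.lt_wealth_deltaFun hρ hf01
    rw [hEX] at hΔf
    refine optimalIsDeductible_of hX H (fun x hx => ⟨hlc01.1.trans hx.1, hx.2⟩) hf hΔf ?_
    -- The rank f = 1 is no candidate, since the multiplier divides by 1 - f.
    rcases hf.2.eq_or_lt with rfl | hf1
    · exact isTheOptimal_no_coverage hX H hρ (hW.trans hWw) hΔf
    have hfa : aPt T ≤ f := hspecc.1.1.le.trans hf.1
    refine isTheOptimal_deductible hX H hρ hfa hf1 hWw hFf ?_ hΔf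
    -- Beyond c, ψ stays nonnegative by monotonicity. Below c, wealth is at most W_Δ(c), where f ≥
    -- l_c makes h nonnegative, and this sign persists when wealth falls.
    rcases le_or_gt (cPt T) f with hcf | hcf
    · have hFc := (H.mono' hc0.le hcf hf.2).trans_lt hFf
      have hFf' : quantile P X f < W₀ - prem + quantile P X 0 := by rwa [H.zero, add_zero]
      refine (H.psiFun_cPt_nonneg le_rfl ha.1.le (by rwa [H.zero, add_zero])).trans ?_
      exact (H.psiFun_le_iff le_rfl ha.1.le hf1 hFf' ⟨hc.1.le, hcf⟩ ⟨hfa, le_rfl⟩).2 hcf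
    · have hww : W₀ - prem ≤ W + (1 + ρ) * deltaFun (quantile P X) (cPt T) := by
        rw [hw]
        linarith [mul_le_mul_of_nonneg_left (H.deltaFun_mono hf01.1 hcf.le hc.2.le) hρ'.le]
      refine H.psiFun_nonneg_of_le hf01.1 hf1 hww hFf ?_
      rw [H.psiFun_nonneg_iff (hwa.trans hwac) hposc ⟨hfa, hcf.le⟩, ← hlc]
      exact hf.1
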